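/- **Setting.** For $k\in\mathbb R$ let $J_1=\mathbb R$, $\varphi_1(z)=z$, and for $k\ne1$ let $J_k=\,]0,\infty[$, $\varphi_k(z)=\frac{2}{k-1}\log z$. A $[\varphi_k,\vec e_3]$-minimal surface is a smooth immersed surface in $\mathbb R^2\times J_k$ whose mean curvature vector (the trace of the second fundamental form) is $\mathbf H=(\dot\varphi_k\,\vec e_3)^\perp$, where $\perp$ is the projection to the normal bundle. Let $\Pi$ be the stereographic projection of $\mathbb S^2$ from the south pole $-\vec e_3$. Björling data on an open interval $I\subseteq\mathbb R$ are a regular real-analytic curve $\beta=(\beta_1,\beta_2,\beta_3):I\to\mathbb R^3$ and a real-analytic map $V:I\to\mathbb S^2\setminus\{-\vec e_3\}$ with $\langle\beta',V\rangle=0$, $|\Pi\circ V|<1$, and $\beta_3>0$ if $k\neq1$. Put $$\phi=(\phi_1,\phi_2,\phi_3)=\tfrac12\,(\beta'-i\,\beta'\wedge V).$$ Write $\zeta=u+iv$, $\partial_\zeta=\frac12(\partial_u-i\partial_v)$, $\partial_{\bar\zeta}=\frac12(\partial_u+i\partial_v)$, and identify $s\in I$ with $s+0i\in\mathbb C$.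 **Theorem.** Let $k\in\mathbb R$, $k\ne0$, and let $\beta,V$ be Björling data on $I$. There are a continuous $\varepsilon:I\to\,]0,\infty[$, with $\mathcal U=\{s+it: s\in I,\ |t|<\varepsilon(s)\}$ (so $\mathcal U$ contains a strip $K\times\,]-\varepsilon_K,\varepsilon_K[$ for every compact $K\subset I$), a real-analytic $G:\mathcal U\to\mathbb C$ and a smooth $\psi:\mathcal U\to\mathbb R^3$ such that the following hold. 1. $|G|\neq1$ on $\mathcal U$ and $G$ solves the Cauchy problem $$G_{\zeta\bar\zeta}+2\,\frac{|G|^2G_\zeta G_{\bar\zeta}}{1-|G|^4}\,\overline G+2k\,\frac{|G_{\bar\zeta}|^2}{1-|G|^4}\,G=0,\qquad G(s,0)=\frac{\phi_3(s)}{\phi_1(s)-i\phi_2(s)},$$ $$G_{\bar\zeta}(s,0)=\begin{cases}\dfrac{1-|G(s,0)|^4}{4}\,\big(\overline{\phi_1}(s)+i\,\overline{\phi_2}(s)\big),&k=1,\\[2mm]\dfrac{1-|G(s,0)|^4}{2(k-1)\beta_3(s)}\,\big(\overline{\phi_1}(s)+i\,\overline{\phi_2}(s)\big),&k\ne1,\end{cases}$$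 where $\phi_1-i\phi_2$ never vanishes on $I$, and $G(s,0)=-\frac{\phi_1(s)+i\phi_2(s)}{\phi_3(s)}$ wherever $\phi_3(s)\ne0$. It is the unique solution: if $\mathcal U'\subseteq\mathcal U$ is open, connected and contains $I$, every $C^2$ solution $G'$ on $\mathcal U'$ with $|G'|\ne 1$ equals $G$ on $\mathcal U'$. 2. $\psi$ is a conformal $[\varphi_k,\vec e_3]$-minimal immersion with $\psi(s,0)=\beta(s)$ for $s\in I$. It has Gauss map $G$, that is, $(\psi_1-i\psi_2)_\zeta\neq0$ and $G=(\psi_3)_\zeta/(\psi_1-i\psi_2)_\zeta$, and $$N=\Big(\frac{-2G}{1+|G|^2},\frac{1-|G|^2}{1+|G|^2}\Big)\in\mathbb C\times\mathbb R=\mathbb R^3$$ is a unit normal field of $\psi$ with $N(s,0)=V(s)$ for $s\in I$. 3. For each $s_0\in I$, with real parts of line integrals taken from $s_0$ to $\zeta$ along an arbitrary $C^1$ path in $\mathcal U$: if $k=1$, then $\psi=\beta(s_0)+\psi_1$ with $$\psi_1=4\,\mathrm{Re}\Big(\int\frac{\overline G_\zeta(1-G^2)}{1-|G|^4}d\zeta,\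 \int i\,\frac{\overline G_\zeta(1+G^2)}{1-|G|^4}d\zeta,\ 2\int\frac{\overline G_\zeta\,G}{1-|G|^4}d\zeta\Big);$$ if $k\neq1$, then $\psi=(\beta_1(s_0),\beta_2(s_0),0)+\frac{(k-1)\,\beta_3(s_0)}{2k}\,\psi_k$ with $\Gamma=\exp\big(4(k-1)\,\mathrm{Re}\int\frac{\overline G_\zeta\,G}{1-|G|^4}d\zeta\big)$ and $$\psi_k=\Big(4k\,\mathrm{Re}\int\frac{\overline G_\zeta(1-G^2)}{1-|G|^4}\Gamma\,d\zeta,\ 4k\,\mathrm{Re}\int i\,\frac{\overline G_\zeta(1+G^2)}{1-|G|^4}\Gamma\,d\zeta,\ \frac{2k}{k-1}\Gamma\Big).$$ 4. The surface is unique: if $X:S\to\mathbb R^3$ is any $[\varphi_k,\vec e_3]$-minimal immersion of a smooth (Hausdorff) surface $S$, and $\gamma:I\to S$ is continuous with $X\circ\gamma=\beta$ and $V(s)$ normal to $X$ at $\gamma(s)$ for all $s\in I$, then there are an open set $W$ with $I\subset W\subseteq\mathcal U$ and a local diffeomorphism $h:W\to S$ with $h(s,0)=\gamma(s)$ for $s\in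 I$ and $X\circ h=\psi$ on $W$. -/

import Mathlib

open scoped Manifold ContDiff

noncomputable section

namespace WeightedMinimal

/-- Euclidean three-space. -/
abbrev E3 : Type := EuclideanSpace ℝ (Fin 3)

/-! ### Mean curvature of immersed surfaces -/

/-- The partial derivative in `u`, where `u + iv` is the variable in the parameter plane `ℂ`. -/
def partialU (X : ℂ → E3) (p : ℂ) : E3 := fderiv ℝ X p 1

/-- The partial derivative in `v`, where `u + iv` is the variable in the parameter plane `ℂ`. -/
def partialV (X : ℂ → E3) (p : ℂ) : E3 := fderiv ℝ X p Complex.I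

/-- The component of `x` orthogonal to the tangent plane of `X` at `p`. -/
def normalPart (X : ℂ → E3) (p : ℂ) (x : E3) : E3 :=
  ((fderiv ℝ X p).toLinearMap.range)ᗮ.starProjection x

/-- The mean curvature vector `g^{ij} (X_{ij})^⊥` (trace of the vector-valued second
fundamental form, not divided by two) of a parametrized surface. -/
def meanCurvatureVector (X : ℂ → E3) (p : ℂ) : E3 :=
  let E : ℝ := inner ℝ (partialU X p) (partialU X p)
  let F : ℝ := inner ℝ (partialU X p) (partialV X p)
  let G : ℝ := inner ℝ (partialV X p) (partialV X p)
  (E * G - F ^ 2)⁻¹ • normalPart X p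
    (G • partialU (partialU X) p - (2 * F) • partialV (partialU X) p
      + E • partialV (partialV X) p)

/-- The third vector of the canonical basis. -/
def e3 : E3 := !₂[0, 0, 1]

/-- `X` is a smooth immersion of the open set `Ω` of the plane into `ℝ² × J` whose mean curvature
vector is the normal part of the gradient of `x ↦ φ x₃`. -/
structure IsMinimalOn (φ : ℝ → ℝ) (J : Set ℝ) (X : ℂ → E3) (Ω : Set ℂ) : Prop where
  smooth : ContDiffOn ℝ ∞ X Ω
  immersion : ∀ p ∈ Ω, Function.Injective (fderiv ℝ X p)
  mem : ∀ p ∈ Ω, X p 2 ∈ J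
  mean_curvature : ∀ p ∈ Ω,
    meanCurvatureVector X p = normalPart X p (deriv φ (X p 2) • e3)

/-- `X` is a `[φ, e₃]`-minimal immersion of the smooth surface `S` into `ℝ² × J`
(the plane is modelled by `ℂ`, regarded as a real vector space). -/
def IsMinimalImmersion (φ : ℝ → ℝ) (J : Set ℝ) {S : Type*} [TopologicalSpace S]
    [ChartedSpace ℂ S] (X : S → E3) : Prop :=
  ∀ p : S, IsMinimalOn φ J (X ∘ (chartAt ℂ p).symm) (chartAt ℂ p).target

/-! ### The weights `φ_k` and the Cauchy problem -/

/-- `φ₁(z) = z`, and `φ_k(z) = 2/(k-1) log z` for `k ≠ 1`. -/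
def weight (k : ℝ) (z : ℝ) : ℝ :=
  open Classical in if k = 1 then z else 2 / (k - 1) * Real.log z

/-- The interval on which `φ_k` is defined: `ℝ` if `k = 1`, and `]0, ∞[` otherwise. -/
def weightDomain (k : ℝ) : Set ℝ := {z | k ≠ 1 → 0 < z}

/-- Stereographic projection of the unit sphere from the south pole (where it is not defined)
to the plane `ℂ`. -/
def stereoSouth (x : E3) : ℂ := ⟨x 0, x 1⟩ / ((1 + x 2 : ℝ) : ℂ)

/-- Björling data: a regular analytic curve `β` and an analytic unit field `V` along it. -/
structure IsBjorlingData (k : ℝ) (I : Set ℝ) (β V : ℝ → E3) : Prop where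
  analytic_curve : AnalyticOnNhd ℝ β I
  regular : ∀ s ∈ I, deriv β s ≠ 0
  analytic_field : AnalyticOnNhd ℝ V I
  unit : ∀ s ∈ I, ‖V s‖ = 1
  orthogonal : ∀ s ∈ I, inner ℝ (deriv β s) (V s) = 0
  ne_south : ∀ s ∈ I, V s ≠ -e3
  stereo_lt : ∀ s ∈ I, ‖stereoSouth (V s)‖ < 1
  height : ∀ s ∈ I, β s 2 ∈ weightDomain k

/-- The immersed `[φ_k, e₃]`-minimal surface `X : S → ℝ³` contains the curve `β`, traced on `S` by
the curve `γ`, and `V` is normal to it along `β`. -/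
structure SolvesCauchyProblem (k : ℝ) (I : Set ℝ) (β V : ℝ → E3) {S : Type*} [TopologicalSpace S]
    [ChartedSpace ℂ S] (X : S → E3) (γ : ℝ → S) : Prop where
  minimal : IsMinimalImmersion (weight k) (weightDomain k) X
  continuous_lift : ContinuousOn γ I
  contains : ∀ s ∈ I, X (γ s) = β s
  normal : ∀ s ∈ I, ∀ w : TangentSpace 𝓘(ℝ, ℂ) (γ s),
    inner ℝ (V s) (mfderiv 𝓘(ℝ, ℂ) 𝓘(ℝ, E3) X (γ s) w) = 0

/-! ### The complex equation of the Gauss map -/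

/-- The Wirtinger operator `∂_ζ = (∂_u - i ∂_v) / 2`. -/
def dz (f : ℂ → ℂ) (z : ℂ) : ℂ := (fderiv ℝ f z 1 - Complex.I * fderiv ℝ f z Complex.I) / 2

/-- The Wirtinger operator `∂_ζ̄ = (∂_u + i ∂_v) / 2`. -/
def dzbar (f : ℂ → ℂ) (z : ℂ) : ℂ := (fderiv ℝ f z 1 + Complex.I * fderiv ℝ f z Complex.I) / 2

/-- The complex conjugate of a function. -/
def conjFun (f : ℂ → ℂ) (z : ℂ) : ℂ := starRingEnd ℂ (f z)

/-- `φ(s) = (β'(s) - i β'(s) ∧ V(s)) / 2`. -/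
def phi (β V : ℝ → E3) (s : ℝ) (j : Fin 3) : ℂ :=
  ((deriv β s j : ℂ)
    - Complex.I * (crossProduct (deriv β s).ofLp (V s).ofLp j : ℂ)) / 2

/-- The initial value `φ₃ / (φ₁ - i φ₂)`. -/
def initialGauss (β V : ℝ → E3) (s : ℝ) : ℂ :=
  phi β V s 2 / (phi β V s 0 - Complex.I * phi β V s 1)

/-- The initial value of `G_ζ̄`. -/
def initialGaussDzbar (k : ℝ) (β V : ℝ → E3) (s : ℝ) : ℂ :=
  open Classical in
  (if k = 1 then (1 - (‖initialGauss β V s‖ : ℂ) ^ 4) / 4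
    else (1 - (‖initialGauss β V s‖ : ℂ) ^ 4) / (2 * ((k : ℂ) - 1) * (β s 2 : ℂ)))
  * (starRingEnd ℂ (phi β V s 0) + Complex.I * starRingEnd ℂ (phi β V s 1))

/-- `G` is a solution of class `C²` on `U` of the Cauchy problem for the Gauss map. -/
structure IsGaussSolution (k : ℝ) (I : Set ℝ) (β V : ℝ → E3) (U : Set ℂ) (G : ℂ → ℂ) :
    Prop where
  contDiffOn : ContDiffOn ℝ 2 G U
  norm_ne_one : ∀ z ∈ U, ‖G z‖ ≠ 1
  equation : ∀ z ∈ U,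
    dzbar (dz G) z
      + 2 * ((‖G z‖ : ℂ) ^ 2 * dz G z * dzbar G z / (1 - (‖G z‖ : ℂ) ^ 4)) * conjFun G z
      + 2 * (k : ℂ) * ((‖dzbar G z‖ : ℂ) ^ 2 / (1 - (‖G z‖ : ℂ) ^ 4)) * G z = 0
  initial : ∀ s ∈ I, G (s : ℂ) = initialGauss β V s
  initial_dzbar : ∀ s ∈ I, dzbar G (s : ℂ) = initialGaussDzbar k β V s

/-! ### The representation formulas -/

/-- `P(ζ) = Re ∫_{ζ₀}^ζ f dζ` on `U`, the integral being along any `C¹` path in `U`. -/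
def IsReIntegral (U : Set ℂ) (ζ₀ : ℂ) (f : ℂ → ℂ) (P : ℂ → ℝ) : Prop :=
  ∀ ζ ∈ U, ∀ c : ℝ → ℂ, ContDiff ℝ 1 c → c 0 = ζ₀ → c 1 = ζ →
    (∀ t ∈ Set.Icc (0 : ℝ) 1, c t ∈ U) →
    P ζ = (∫ t in (0 : ℝ)..1, f (c t) * deriv c t).re

/-- The factor `(conj G)_ζ / (1 - |G|⁴)`. -/
def density (G : ℂ → ℂ) (z : ℂ) : ℂ := dz (conjFun G) z / (1 - (‖G z‖ : ℂ) ^ 4)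

/-- The representation formula for `k = 1`. -/
def IsTranslatingRep (U : Set ℂ) (ζ₀ : ℂ) (G : ℂ → ℂ) (Y : ℂ → E3) : Prop :=
  ∃ P₁ P₂ P₃ : ℂ → ℝ,
    IsReIntegral U ζ₀ (fun z => density G z * (1 - G z ^ 2)) P₁ ∧
    IsReIntegral U ζ₀ (fun z => Complex.I * (density G z * (1 + G z ^ 2))) P₂ ∧
    IsReIntegral U ζ₀ (fun z => density G z * G z) P₃ ∧
    ∀ ζ ∈ U, Y ζ = !₂[4 * P₁ ζ, 4 * P₂ ζ, 4 * (2 * P₃ ζ)]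

/-- The representation formula for `k ≠ 0, 1`. -/
def IsSingularRep (k : ℝ) (U : Set ℂ) (ζ₀ : ℂ) (G : ℂ → ℂ) (Y : ℂ → E3) : Prop :=
  ∃ P₁ P₂ P₃ Γ : ℂ → ℝ,
    IsReIntegral U ζ₀ (fun z => density G z * G z) P₃ ∧
    (∀ ζ ∈ U, Γ ζ = Real.exp (4 * (k - 1) * P₃ ζ)) ∧
    IsReIntegral U ζ₀ (fun z => density G z * (1 - G z ^ 2) * (Γ z : ℂ)) P₁ ∧
    IsReIntegral U ζ₀ (fun z => Complex.I * (density G z * (1 + G z ^ 2)) * (Γ z : ℂ)) P₂ ∧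
    ∀ ζ ∈ U, Y ζ = !₂[4 * k * P₁ ζ, 4 * k * P₂ ζ, 2 * k / (k - 1) * Γ ζ]

/-- `X` is conformal on `U`. -/
def IsConformalOn (X : ℂ → E3) (U : Set ℂ) : Prop :=
  ∀ p ∈ U, inner ℝ (partialU X p) (partialU X p) = (inner ℝ (partialV X p) (partialV X p) : ℝ) ∧
    (inner ℝ (partialU X p) (partialV X p) : ℝ) = 0

/-- The `j`-th coordinate of `X` as a complex-valued function. -/
def coord (X : ℂ → E3) (j : Fin 3) (z : ℂ) : ℂ := (X z j : ℂ)

/-- The unit vector `(-2w, 1 - |w|²) / (1 + |w|²)` of `ℂ × ℝ = ℝ³`. -/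
def unitNormal (w : ℂ) : E3 :=
  (1 + ‖w‖ ^ 2)⁻¹ • !₂[-2 * w.re, -2 * w.im, 1 - ‖w‖ ^ 2]

/-- `G` is the Gauss map of the conformal immersion `X` on `U`: it is the quotient
`X³_ζ / (X¹_ζ - i X²_ζ)`, and it encodes the unit normal of `X`. -/
def IsGaussMapOn (X : ℂ → E3) (G : ℂ → ℂ) (U : Set ℂ) : Prop :=
  ∀ p ∈ U, dz (coord X 0) p - Complex.I * dz (coord X 1) p ≠ 0 ∧
    G p = dz (coord X 2) p / (dz (coord X 0) p - Complex.I * dz (coord X 1) p) ∧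
    ∀ w : ℂ, (inner ℝ (fderiv ℝ X p w) (unitNormal (G p)) : ℝ) = 0

/-- The neighbourhood `{s + it : s ∈ I, |t| < ε(s)}` of `I` in `ℂ`. -/
def strip (I : Set ℝ) (ε : ℝ → ℝ) : Set ℂ := {z | z.re ∈ I ∧ |z.im| < ε z.re}

end WeightedMinimal

end

/-! In a conformal parameter `ζ` a `[φ, e₃]`-minimal surface satisfies the semilinear elliptic
system `ψ_ζζ̄ = (φ̇/2)(⟨ψ_ζ, ψ_ζ̄⟩ e₃ - ψ³_ζ̄ ψ_ζ - ψ³_ζ ψ_ζ̄)`, and the Björling data prescribe `ψ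
= β` and `ψ_ζ = φ` on the real axis. The theorem is therefore a Cauchy problem: existence rests on
analyticity, uniqueness on a Carleman estimate that needs only finite differentiability.

Existence. Treat `ζ` and `ζ̄` as independent complex variables. The first order system for `(ψ_ζ,
ψ_ζ̄, ψ)` becomes an integral equation along coordinate segments that start on the diagonal. Pulled
back to the unit square it reads `U = D(p) + (p₁ - p₂) N(U)` in a Banach algebra of continuous
functions. The nonlinear term is switched off on the diagonal, so the inverse function theorem
solves it holomorphically in `p` (`exists_analytic_fixedPoint`). Local uniqueness of the fixed point
shows that the solutions on different squares are restrictions of one function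
(`exists_complexified`). Restriction to `(z, z̄)` gives `exists_local_solution`; the solution is
real because its conjugate solves the same Cauchy problem. The quadratic form `⟨ψ_ζ, ψ_ζ⟩` satisfies
a linear Cauchy–Riemann equation and vanishes on the axis, hence everywhere, so `ψ` is conformal.
Local solutions agree on overlaps and glue to a strip.

Uniqueness. The operator `∂_ζ̄` has an `L¹` Poincaré inequality, and the weight `|z - a|⁻ⁿ` is the
modulus of a holomorphic function, so the inequality survives the weight with a constant independent
of `n`. Letting `n` grow gives unique continuation from a point (`eq_zero_on_ball_of_dbar_le`).
Extension by zero across the real axis gives it from the axis (`eventually_eq_zero_of_dbar_le`), and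
factoring the Laplacian through `∂_ζ` and `∂_ζ̄` carries it to `|Δh| ≤ C (|h| + |Dh|)`, hence to
differences of solutions of semilinear equations.

The Gauss map. Isotropy gives `ψ_ζ = (η/2)(1 - G², i(1 + G²), 2G)` with `η = (ψ₁ - iψ₂)_ζ`, and the
system gives `G_ζ̄ = (φ̇/4) η̄ (1 - |G|⁴)`. Differentiating once more and using `φ̈ = -((k-1)/2)
φ̇²` yields the equation of `G`. Conjugating yields `Ḡ_ζ / (1 - |G|⁴) = φ̇ η / 4`, which expresses
`ψ_ζ` through `G` and is the source of the representation formulas.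

Uniqueness of the surface. After a change of parameter any competing surface is a normal graph `ψ +
fN` over `ψ`, with `f` and `Df` zero on the axis. The minimal surface equation is Lipschitz in the
`2`-jet, so `|Δf| ≤ C (|f| + |Df|)` and `f = 0` (`eventually_eq_zero_of_normal_graph`). The local
changes of parameter fit together because immersions are locally injective and the surface is
Hausdorff. -/

noncomputable section

namespace WeightedMinimal

open MeasureTheory Set Filter Topology

/-! ### A Cauchy–Pompeiu inequality -/

section Pompeiu

variable {E : Type*} [NormedAddCommGroup E] [NormedSpace ℂ E]

/-- Twice the operator `∂_ζ̄`, for vector-valued functions. -/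
def dbar (f : ℂ → E) (z : ℂ) : E := fderiv ℝ f z 1 + Complex.I • fderiv ℝ f z Complex.I

/-- Twice the operator `∂_ζ`, for vector-valued functions. -/
def dhol (f : ℂ → E) (z : ℂ) : E := fderiv ℝ f z 1 - Complex.I • fderiv ℝ f z Complex.I

/-- The Cauchy–Riemann operator in the frame rotated by `θ` is `e^{-iθ}` times the one in the
standard frame. -/
theorem fderiv_polar_combination (L : ℂ →L[ℝ] E) (θ : ℝ) :
    L (Real.cos θ + Real.sin θ * Complex.I)
      + Complex.I • L (Complex.I * (Real.cos θ + Real.sin θ * Complex.I))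
      = ((Real.cos θ : ℂ) - Real.sin θ * Complex.I) • (L 1 + Complex.I • L Complex.I) := by
  generalize Real.cos θ = c
  generalize Real.sin θ = s
  have h1 : ((c : ℂ) + s * Complex.I)
      = c • (1 : ℂ) + s • Complex.I := by simp
  have h2 : Complex.I * ((c : ℂ) + s * Complex.I)
      = c • Complex.I - s • (1 : ℂ) := by
    simp only [Complex.real_smul, mul_one]
    linear_combination (s : ℂ) * Complex.I_mul_I
  rw [h2, h1, map_add, map_sub, map_smul, map_smul, map_smul, map_smul]
  have h3 : ∀ (r : ℝ) (x : E), r • x = (r : ℂ) • x := fun r x => (Complex.coe_smul r x).symm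
  simp only [h3]
  have hI := Complex.I_mul_I
  match_scalars
  · ring
  · linear_combination (s : ℂ) * hI

/-- In polar coordinates `e^{-iθ}` times `dbar f` is `∂_r f + (i/r) ∂_θ f`. The radial term
integrates to `-f 0` on each ray, and the angular term to zero on each circle by periodicity. -/
theorem integral_polar_dbar [CompleteSpace E] {f : ℂ → E} (hf : ContDiff ℝ 1 f) {R : ℝ}
    (hR : 0 < R) (hsupp : ∀ z, R ≤ ‖z‖ → f z = 0) :
    ∫ r in (0:ℝ)..R, ∫ θ in (-Real.pi)..Real.pi,
      ((Real.cos θ : ℂ) - Real.sin θ * Complex.I) •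
        dbar f (r * (Real.cos θ + Real.sin θ * Complex.I)) = -((2 * Real.pi) • f 0) := by
  have hcont : Continuous (fderiv ℝ f) := hf.continuous_fderiv one_ne_zero
  have hd : ∀ z, HasFDerivAt f (fderiv ℝ f z) z := fun z =>
    (hf.differentiable one_ne_zero z).hasFDerivAt
  set A : ℝ → ℝ → E := fun r θ => fderiv ℝ f (r * (Real.cos θ + Real.sin θ * Complex.I))
    (Real.cos θ + Real.sin θ * Complex.I) with hA
  set B : ℝ → ℝ → E := fun r θ => fderiv ℝ f (r * (Real.cos θ + Real.sin θ * Complex.I))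
    (Complex.I * (Real.cos θ + Real.sin θ * Complex.I)) with hB
  have hAc : Continuous (Function.uncurry A) := by
    apply Continuous.clm_apply
    · exact hcont.comp (by fun_prop)
    · fun_prop
  have hBc : Continuous (Function.uncurry B) := by
    apply Continuous.clm_apply
    · exact hcont.comp (by fun_prop)
    · fun_prop
  have hAI : ∀ θ, ∫ r in (0:ℝ)..R, A r θ = - f 0 := by
    intro θ
    have : ∀ r ∈ uIcc 0 R, HasDerivAt
        (fun r : ℝ => f (r * (Real.cos θ + Real.sin θ * Complex.I))) (A r θ) r := by
      intro r _
      have h := (hd (r * (Real.cos θ + Real.sin θ * Complex.I))).comp_hasDerivAt r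
        ((Complex.ofRealCLM.hasDerivAt (x := r)).mul_const
          (Real.cos θ + Real.sin θ * Complex.I : ℂ))
      simpa [hA, Function.comp_def] using h
    rw [intervalIntegral.integral_eq_sub_of_hasDerivAt this]
    · rw [hsupp]
      · simp
      · have : ‖(Real.cos θ + Real.sin θ * Complex.I : ℂ)‖ = 1 := by
          rw [Complex.ofReal_cos, Complex.ofReal_sin, ← Complex.exp_mul_I]
          exact Complex.norm_exp_ofReal_mul_I θ
        rw [norm_mul, this, Complex.norm_real, Real.norm_eq_abs, abs_of_pos hR, mul_one]
    · exact (hAc.comp (by fun_prop : Continuous fun r => (r, θ))).intervalIntegrable _ _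
  have hBI : ∀ r : ℝ, r ≠ 0 → ∫ θ in (-Real.pi)..Real.pi, B r θ = 0 := by
    intro r hr
    have : ∀ θ ∈ uIcc (-Real.pi) Real.pi, HasDerivAt
        (fun θ : ℝ => f (r * (Real.cos θ + Real.sin θ * Complex.I))) (r • B r θ) θ := by
      intro θ _
      have hc : HasDerivAt (fun θ : ℝ => (r : ℂ) * (Real.cos θ + Real.sin θ * Complex.I))
          (r * (-Real.sin θ + Real.cos θ * Complex.I) : ℂ) θ := by
        have h1 := (Real.hasDerivAt_cos θ).ofReal_comp
        have h2 := (Real.hasDerivAt_sin θ).ofReal_comp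
        simpa using (h1.add (h2.mul_const Complex.I)).const_mul (r : ℂ)
      have h := (hd (r * (Real.cos θ + Real.sin θ * Complex.I))).comp_hasDerivAt θ hc
      convert! h using 1
      rw [hB]
      simp only
      rw [← map_smul]
      congr 1
      rw [Complex.real_smul]
      linear_combination (r * Real.sin θ : ℂ) * Complex.I_mul_I
    have h := intervalIntegral.integral_eq_sub_of_hasDerivAt this
      ((continuous_const.smul
        (hBc.comp (by fun_prop : Continuous fun θ => (r, θ)))).intervalIntegrable _ _)
    rw [intervalIntegral.integral_smul] at h
    simpa [hr] using h
  have hsum : ∀ r θ : ℝ, ((Real.cos θ : ℂ) - Real.sin θ * Complex.I) •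
        dbar f (r * (Real.cos θ + Real.sin θ * Complex.I)) = A r θ + Complex.I • B r θ :=
    fun r θ => (fderiv_polar_combination _ θ).symm
  simp_rw [hsum]
  have hAcr : ∀ r, IntervalIntegrable (fun θ => A r θ) volume (-Real.pi) Real.pi := fun r =>
    (hAc.comp (by fun_prop : Continuous fun θ => (r, θ))).intervalIntegrable _ _
  have : ∀ r : ℝ, r ∈ uIoc 0 R → ∫ θ in (-Real.pi)..Real.pi, (A r θ + Complex.I • B r θ)
      = ∫ θ in (-Real.pi)..Real.pi, A r θ := by
    intro r hr
    rw [uIoc_of_le hR.le] at hr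
    have hIB : IntervalIntegrable (fun θ => Complex.I • B r θ) volume (-Real.pi) Real.pi :=
      (continuous_const.smul
        (hBc.comp (by fun_prop : Continuous fun θ => (r, θ)))).intervalIntegrable _ _
    rw [intervalIntegral.integral_add (hAcr r) hIB,
      intervalIntegral.integral_smul, hBI r hr.1.ne', smul_zero, add_zero]
  rw [intervalIntegral.integral_congr_ae (ae_of_all _ this)]
  rw [MeasureTheory.intervalIntegral_intervalIntegral_swap]
  · simp_rw [hAI]
    rw [intervalIntegral.integral_const, smul_neg]
    congr 2
    ring
  · rw [uIoc_of_le hR.le, uIoc_of_le (by linarith [Real.pi_pos])]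
    exact (hAc.continuousOn.integrableOn_compact (isCompact_Icc.prod isCompact_Icc)).mono_set
      (prod_mono Ioc_subset_Icc_self Ioc_subset_Icc_self)

/-- Take norms in the polar identity; the Jacobian `r` of polar coordinates cancels the kernel
`|z|⁻¹`. -/
theorem enorm_le_lintegral_dbar_zero [CompleteSpace E] {f : ℂ → E} (hf : ContDiff ℝ 1 f)
    (hsupp : HasCompactSupport f) :
    ENNReal.ofReal (2 * Real.pi) * ‖f 0‖ₑ ≤ ∫⁻ z, ‖dbar f z‖ₑ * ‖z‖ₑ⁻¹ := by
  obtain ⟨R, hR, hRs⟩ : ∃ R > 0, ∀ z, R ≤ ‖z‖ → f z = 0 := by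
    obtain ⟨R, hR⟩ := hsupp.isCompact.isBounded.subset_ball 0
    refine ⟨max R 1, by positivity, fun z hz => ?_⟩
    by_contra h
    have := hR (subset_tsupport f (Function.mem_support.2 h))
    rw [mem_ball_zero_iff] at this
    exact absurd (le_trans (le_max_left _ _) hz) (not_le.2 this)
  have h0 := integral_polar_dbar hf hR hRs
  have h1 : ENNReal.ofReal (2 * Real.pi) * ‖f 0‖ₑ = ‖-((2 * Real.pi) • f 0)‖ₑ := by
    rw [enorm_neg, enorm_smul, Real.enorm_eq_ofReal (by positivity)]
  rw [h1, ← h0, intervalIntegral.integral_of_le hR.le]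
  simp_rw [intervalIntegral.integral_of_le (by linarith [Real.pi_pos] : -Real.pi ≤ Real.pi)]
  refine (enorm_integral_le_lintegral_enorm _).trans ?_
  refine (lintegral_mono fun r => enorm_integral_le_lintegral_enorm _).trans ?_
  have hcd : Continuous (dbar f) := by
    have := hf.continuous_fderiv one_ne_zero
    unfold dbar
    fun_prop
  rw [← Complex.lintegral_comp_polarCoord_symm, show polarCoord.target = Ioi (0:ℝ) ×ˢ Ioo (-Real.pi) Real.pi from rfl]
  have hm : Measurable (fun p : ℝ × ℝ =>
      ENNReal.ofReal p.1 • (‖dbar f (Complex.polarCoord.symm p)‖ₑ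
        * ‖Complex.polarCoord.symm p‖ₑ⁻¹)) := by
    simp only [Complex.polarCoord_symm_apply]
    have : Measurable fun p : ℝ × ℝ =>
      (p.1 : ℂ) * (Real.cos p.2 + Real.sin p.2 * Complex.I) := by fun_prop
    exact (ENNReal.measurable_ofReal.comp measurable_fst).smul
      ((hcd.enorm.measurable.comp this).mul this.enorm.inv)
  rw [Measure.volume_eq_prod, setLIntegral_prod _ hm.aemeasurable]
  refine le_trans ?_ (lintegral_mono_set (s := Ioc 0 R) Ioc_subset_Ioi_self)
  refine setLIntegral_mono' measurableSet_Ioc fun r hr => ?_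
  rw [← restrict_Ioo_eq_restrict_Ioc]
  refine setLIntegral_mono' measurableSet_Ioo fun θ _ => ?_
  have hn : ‖(Real.cos θ + Real.sin θ * Complex.I : ℂ)‖ = 1 := by
    rw [Complex.ofReal_cos, Complex.ofReal_sin, ← Complex.exp_mul_I]
    exact Complex.norm_exp_ofReal_mul_I θ
  have hn' : ‖(Real.cos θ - Real.sin θ * Complex.I : ℂ)‖ = 1 := by
    have := Complex.norm_exp_ofReal_mul_I (-θ)
    rw [Complex.exp_mul_I, ← Complex.ofReal_cos, ← Complex.ofReal_sin] at this
    simpa [sub_eq_add_neg] using this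
  rw [Complex.polarCoord_symm_apply, enorm_smul]
  have e1 : ‖(Real.cos θ - Real.sin θ * Complex.I : ℂ)‖ₑ = 1 := by
    rw [← ofReal_norm, hn', ENNReal.ofReal_one]
  have e2 : ‖(r * (Real.cos θ + Real.sin θ * Complex.I) : ℂ)‖ₑ = ENNReal.ofReal r := by
    rw [← ofReal_norm, norm_mul, hn, mul_one, Complex.norm_real, Real.norm_eq_abs,
      abs_of_pos hr.1]
  rw [e1, one_mul, e2, smul_eq_mul, mul_left_comm, ENNReal.mul_inv_cancel, mul_one]
  · simpa using hr.1
  · exact ENNReal.ofReal_ne_top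

theorem lintegral_ball_inv_enorm_le (a : ℂ) {ρ : ℝ} (hρ : 0 ≤ ρ) :
    ∫⁻ z in Metric.ball a ρ, ‖z - a‖ₑ⁻¹ ≤ ENNReal.ofReal (2 * Real.pi * ρ) := by
  have h1 : ∫⁻ z in Metric.ball a ρ, ‖z - a‖ₑ⁻¹
      = ∫⁻ z, (Metric.ball (0:ℂ) ρ).indicator (fun z => ‖z‖ₑ⁻¹) z := by
    rw [← lintegral_indicator measurableSet_ball,
      ← lintegral_sub_right_eq_self
        ((Metric.ball (0:ℂ) ρ).indicator (fun z => ‖z‖ₑ⁻¹)) a]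
    congr 1
    ext z
    simp [indicator, dist_eq_norm]
  rw [h1, ← Complex.lintegral_comp_polarCoord_symm, show polarCoord.target = Ioi (0:ℝ) ×ˢ Ioo (-Real.pi) Real.pi from rfl]
  calc _ ≤ ∫⁻ p in Ioi (0:ℝ) ×ˢ Ioo (-Real.pi) Real.pi,
        (Ioo (0:ℝ) ρ ×ˢ Ioo (-Real.pi) Real.pi).indicator (fun _ => 1) p := by
        refine setLIntegral_mono' (measurableSet_Ioi.prod measurableSet_Ioo) fun p hp => ?_
        have hn : ‖Complex.polarCoord.symm p‖ = p.1 := by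
          rw [Complex.norm_polarCoord_symm, abs_of_pos hp.1]
        by_cases h : p.1 < ρ
        · rw [indicator_of_mem (by rw [mem_ball_zero_iff, hn]; exact h),
            indicator_of_mem (show p ∈ Ioo (0:ℝ) ρ ×ˢ Ioo (-Real.pi) Real.pi from ⟨⟨hp.1, h⟩, hp.2⟩)]
          rw [← ofReal_norm, hn, smul_eq_mul, ENNReal.mul_inv_cancel]
          · simpa using hp.1
          · exact ENNReal.ofReal_ne_top
        · rw [indicator_of_notMem (by rw [mem_ball_zero_iff, hn]; exact h)]
          simp
    _ ≤ ∫⁻ p, (Ioo (0:ℝ) ρ ×ˢ Ioo (-Real.pi) Real.pi).indicator (fun _ => 1) p :=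
        setLIntegral_le_lintegral _ _
    _ = volume (Ioo (0:ℝ) ρ ×ˢ Ioo (-Real.pi) Real.pi) := by
        rw [lintegral_indicator (measurableSet_Ioo.prod measurableSet_Ioo)]; simp
    _ = _ := by
        rw [Measure.volume_eq_prod, Measure.prod_prod, Real.volume_Ioo, Real.volume_Ioo,
          ← ENNReal.ofReal_mul (by linarith)]
        congr 1; ring

theorem enorm_le_lintegral_dbar [CompleteSpace E] {f : ℂ → E} (hf : ContDiff ℝ 1 f)
    (hsupp : HasCompactSupport f) (a : ℂ) :
    ENNReal.ofReal (2 * Real.pi) * ‖f a‖ₑ ≤ ∫⁻ z, ‖dbar f z‖ₑ * ‖z - a‖ₑ⁻¹ := by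
  have h := enorm_le_lintegral_dbar_zero (f := fun z => f (z + a))
    (hf.comp (contDiff_id.add contDiff_const))
    (hsupp.comp_homeomorph (Homeomorph.addRight a))
  rw [zero_add] at h
  refine h.trans_eq ?_
  rw [← lintegral_add_right_eq_self (fun z => ‖dbar f z‖ₑ * ‖z - a‖ₑ⁻¹) a]
  congr 1
  ext z
  simp [dbar, fderiv_comp_add_right]

/-- A Poincaré inequality in `L¹` for the operator `∂_ζ̄`. -/
theorem lintegral_enorm_le_dbar [CompleteSpace E] {f : ℂ → E} (hf : ContDiff ℝ 1 f)
    {a : ℂ} {R : ℝ} (hR : 0 < R) (hsupp : tsupport f ⊆ Metric.ball a R) :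
    ∫⁻ z, ‖f z‖ₑ ≤ ENNReal.ofReal (2 * R) * ∫⁻ z, ‖dbar f z‖ₑ := by
  have hcs : HasCompactSupport f :=
    (isCompact_closedBall a R).of_isClosed_subset (isClosed_tsupport f)
      (hsupp.trans Metric.ball_subset_closedBall)
  have hcd : Continuous (dbar f) := by
    have := hf.continuous_fderiv one_ne_zero
    unfold dbar
    fun_prop
  have hz : ∀ z ∉ Metric.ball a R, f z = 0 := fun z hz => image_eq_zero_of_notMem_tsupport
    fun h => hz (hsupp h)
  have hdz : ∀ z ∉ Metric.ball a R, dbar f z = 0 := fun z hz => by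
    have : fderiv ℝ f z = 0 := by
      by_contra h
      exact hz (hsupp (support_fderiv_subset ℝ h))
    simp [dbar, this]
  have hpi : ENNReal.ofReal (2 * Real.pi) ≠ 0 := by
    simpa using Real.pi_pos
  rw [← ENNReal.mul_le_mul_iff_right hpi ENNReal.ofReal_ne_top]
  calc ENNReal.ofReal (2 * Real.pi) * ∫⁻ z, ‖f z‖ₑ
      = ∫⁻ z in Metric.ball a R, ENNReal.ofReal (2 * Real.pi) * ‖f z‖ₑ := by
        rw [lintegral_const_mul' _ _ ENNReal.ofReal_ne_top]
        congr 1
        rw [← lintegral_indicator measurableSet_ball]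
        congr 1; ext z
        by_cases h : z ∈ Metric.ball a R
        · rw [indicator_of_mem h]
        · rw [indicator_of_notMem h, hz z h, enorm_zero]
    -- Integrate the pointwise Cauchy–Pompeiu bound over the ball that contains the support and
    -- exchange the integrals. What remains is the integral of the kernel over that ball.
    _ ≤ ∫⁻ z in Metric.ball a R, ∫⁻ ζ, ‖dbar f ζ‖ₑ * ‖ζ - z‖ₑ⁻¹ :=
        lintegral_mono fun z => enorm_le_lintegral_dbar hf hcs z
    _ = ∫⁻ ζ, ∫⁻ z in Metric.ball a R, ‖dbar f ζ‖ₑ * ‖ζ - z‖ₑ⁻¹ := by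
        apply lintegral_lintegral_swap
        refine Measurable.aemeasurable ?_
        apply Measurable.mul
        · exact (hcd.comp continuous_snd).enorm.measurable
        · exact (measurable_snd.sub measurable_fst).enorm.inv
    _ ≤ ∫⁻ ζ, ‖dbar f ζ‖ₑ * ENNReal.ofReal (2 * Real.pi * (2 * R)) := by
        refine lintegral_mono fun ζ => ?_
        by_cases h : ζ ∈ Metric.ball a R
        · dsimp only
          rw [lintegral_const_mul _ (by fun_prop)]
          refine mul_le_mul_right ?_ _
          -- The ball about `a` of radius `R` lies in the ball about `ζ` of radius `2R`; this is the
          -- source of the factor `2R`.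
          refine le_trans ?_ (lintegral_ball_inv_enorm_le ζ (by linarith))
          simp_rw [enorm_sub_rev ζ]
          refine lintegral_mono_set fun z hz => ?_
          rw [Metric.mem_ball] at *
          linarith [dist_triangle_right z ζ a]
        · simp [hdz ζ h]
    _ = _ := by
        rw [lintegral_mul_const' _ _ ENNReal.ofReal_ne_top, ENNReal.ofReal_mul (by positivity)]
        ring

end Pompeiu

/-! ### A Carleman estimate and unique continuation -/

section UniqueContinuation

variable {E F : Type*} [NormedAddCommGroup E] [NormedSpace ℂ E] [NormedAddCommGroup F]
  [NormedSpace ℂ F]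

theorem continuous_dbar {f : ℂ → E} (hf : ContDiff ℝ 1 f) : Continuous (dbar f) := by
  have := hf.continuous_fderiv one_ne_zero
  unfold dbar
  fun_prop

theorem continuous_dhol {f : ℂ → E} (hf : ContDiff ℝ 1 f) : Continuous (dhol f) := by
  have := hf.continuous_fderiv one_ne_zero
  unfold dhol
  fun_prop

theorem _root_.Filter.EventuallyEq.dbar_eq {f g : ℂ → E} {z : ℂ} (h : f =ᶠ[𝓝 z] g) :
    dbar f z = dbar g z := by
  simp only [dbar, h.fderiv_eq]

theorem _root_.Filter.EventuallyEq.dhol_eq {f g : ℂ → E} {z : ℂ} (h : f =ᶠ[𝓝 z] g) :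
    dhol f z = dhol g z := by
  simp only [dhol, h.fderiv_eq]

/-- Multiplication by a holomorphic function commutes with `∂_ζ̄`, so a weight `|g|` costs nothing
in an estimate for `dbar`. -/
theorem dbar_smul_of_differentiableAt {g : ℂ → ℂ} {f : ℂ → E} {z : ℂ}
    (hg : DifferentiableAt ℂ g z) (hf : DifferentiableAt ℝ f z) :
    dbar (fun z => g z • f z) z = g z • dbar f z := by
  have h1 : HasFDerivAt g ((fderiv ℂ g z).restrictScalars ℝ) z :=
    hg.hasFDerivAt.restrictScalars ℝ
  have h2 := (h1.smul hf.hasFDerivAt).fderiv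
  have h3 : fderiv ℂ g z Complex.I = Complex.I * fderiv ℂ g z 1 := by
    rw [← smul_eq_mul, ← map_smul]; simp
  change fderiv ℝ (g • f) z 1 + Complex.I • fderiv ℝ (g • f) z Complex.I = _
  rw [h2]
  simp only [dbar, add_apply, smul_apply,
    ContinuousLinearMap.smulRight_apply, ContinuousLinearMap.coe_restrictScalars', h3]
  match_scalars <;> first | ring1 | linear_combination (fderiv ℂ g z 1) * Complex.I_mul_I

/-- This is the Carleman estimate. Apply the Poincaré inequality to `(z - a)⁻ⁿ w`, which is `C¹`
across the pole because `w` vanishes near `a`. The constant does not depend on `n`. -/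
theorem lintegral_weight_dbar_le [CompleteSpace E] {w : ℂ → E} (hw : ContDiff ℝ 1 w) {a : ℂ}
    {R : ℝ} (hR : 0 < R) (hsupp : tsupport w ⊆ Metric.ball a R) (h0 : w =ᶠ[𝓝 a] 0) (n : ℕ) :
    ∫⁻ z, ‖z - a‖ₑ⁻¹ ^ n * ‖w z‖ₑ
      ≤ ENNReal.ofReal (2 * R) * ∫⁻ z, ‖z - a‖ₑ⁻¹ ^ n * ‖dbar w z‖ₑ := by
  set g : ℂ → ℂ := fun z => ((z - a)⁻¹) ^ n with hg
  have hgz : ∀ z, z ≠ a → ‖g z‖ₑ = ‖z - a‖ₑ⁻¹ ^ n := by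
    intro z hz
    simp only [hg]
    rw [enorm_pow, enorm_inv (sub_ne_zero.2 hz)]
  have hgd : ∀ z, z ≠ a → DifferentiableAt ℂ g z := fun z hz =>
    ((differentiableAt_id.sub_const a).inv (sub_ne_zero.2 hz)).pow n
  have hgc : ∀ z, z ≠ a → ContDiffAt ℝ 1 g z := fun z hz =>
    ((contDiffAt_id.sub contDiffAt_const).inv (sub_ne_zero.2 hz)).pow n
  have hfa : (fun z => g z • w z) =ᶠ[𝓝 a] 0 := by
    filter_upwards [h0] with z hz
    simp [hz]
  have hf : ContDiff ℝ 1 fun z => g z • w z := by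
    rw [contDiff_iff_contDiffAt]
    intro z
    rcases eq_or_ne z a with rfl | hz
    · exact contDiffAt_const.congr_of_eventuallyEq hfa
    · exact (hgc z hz).smul hw.contDiffAt
  have key := lintegral_enorm_le_dbar hf hR
    ((tsupport_smul_subset_right g w).trans hsupp)
  have hw0 : w a = 0 := h0.self_of_nhds
  have hd0 : dbar w a = 0 := by
    rw [h0.dbar_eq]
    simp [dbar]
  have e1 : ∀ z, ‖z - a‖ₑ⁻¹ ^ n * ‖w z‖ₑ = ‖g z • w z‖ₑ := by
    intro z
    rcases eq_or_ne z a with rfl | hz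
    · simp [hw0]
    · rw [enorm_smul, hgz z hz]
  have e2 : ∀ z, ‖z - a‖ₑ⁻¹ ^ n * ‖dbar w z‖ₑ = ‖dbar (fun z => g z • w z) z‖ₑ := by
    intro z
    rcases eq_or_ne z a with rfl | hz
    · rw [hfa.dbar_eq, hd0]
      simp [dbar]
    · rw [dbar_smul_of_differentiableAt (hgd z hz) (hw.differentiable one_ne_zero z), enorm_smul,
        hgz z hz]
  simp_rw [e1, e2]
  exact key

theorem dbar_comp_conj {f : ℂ → E} (hf : Differentiable ℝ f) (z : ℂ) :
    dbar (fun z => f (starRingEnd ℂ z)) z = dhol f (starRingEnd ℂ z) := by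
  have h : HasFDerivAt (fun z => f (starRingEnd ℂ z))
      ((fderiv ℝ f (starRingEnd ℂ z)).comp (Complex.conjCLE : ℂ →L[ℝ] ℂ)) z :=
    (hf (starRingEnd ℂ z)).hasFDerivAt.comp z (Complex.conjCLE : ℂ →L[ℝ] ℂ).hasFDerivAt
  simp [dbar, dhol, h.fderiv, sub_eq_add_neg]

/-- Complex conjugation preserves Lebesgue measure and exchanges `dbar` with `dhol`. -/
theorem lintegral_weight_dhol_le [CompleteSpace E] {w : ℂ → E} (hw : ContDiff ℝ 1 w) {a : ℂ}
    {R : ℝ} (hR : 0 < R) (hsupp : tsupport w ⊆ Metric.ball a R) (h0 : w =ᶠ[𝓝 a] 0) (n : ℕ) :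
    ∫⁻ z, ‖z - a‖ₑ⁻¹ ^ n * ‖w z‖ₑ
      ≤ ENNReal.ofReal (2 * R) * ∫⁻ z, ‖z - a‖ₑ⁻¹ ^ n * ‖dhol w z‖ₑ := by
  have hconj : ∀ g : ℂ → ENNReal, ∫⁻ z, g (starRingEnd ℂ z) = ∫⁻ z, g z := fun g =>
    Complex.conjLIE.measurePreserving.lintegral_comp_emb
      Complex.conjLIE.toHomeomorph.measurableEmbedding g
  have hs : tsupport (fun z => w (starRingEnd ℂ z)) ⊆ Metric.ball (starRingEnd ℂ a) R := by
    intro z hz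
    have h1 := tsupport_comp_subset_preimage w Complex.continuous_conj hz
    have h2 := hsupp h1
    rw [Metric.mem_ball] at h2 ⊢
    rwa [← Complex.dist_conj_conj, Complex.conj_conj]
  have h := lintegral_weight_dbar_le (w := fun z => w (starRingEnd ℂ z))
    (hw.comp Complex.conjCLE.contDiff) (a := starRingEnd ℂ a) hR hs
    (by
      have : Tendsto (starRingEnd ℂ) (𝓝 (starRingEnd ℂ a)) (𝓝 a) := by
        simpa using Complex.continuous_conj.tendsto (starRingEnd ℂ a)
      exact this.eventually h0) n
  have hn : ∀ z : ℂ, ‖z - starRingEnd ℂ a‖ₑ = ‖starRingEnd ℂ z - a‖ₑ := fun z => by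
    rw [← ofReal_norm, ← ofReal_norm, ← Complex.norm_conj]; simp
  simp_rw [dbar_comp_conj (hw.differentiable one_ne_zero), hn] at h
  rwa [hconj fun z => ‖z - a‖ₑ⁻¹ ^ n * ‖w z‖ₑ, hconj fun z => ‖z - a‖ₑ⁻¹ ^ n * ‖dhol w z‖ₑ] at h

theorem contDiff_bump_smul {w : ℂ → E} {a : ℂ} {R : ℝ} (hw : ContDiffOn ℝ 1 w (Metric.ball a R))
    (χ : ContDiffBump a) (hχ : χ.rOut < R) : ContDiff ℝ 1 fun z => χ z • w z := by
  rw [contDiff_iff_contDiffAt]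
  intro z
  by_cases hz : z ∈ Metric.ball a R
  · exact χ.contDiffAt.smul (hw.contDiffAt (Metric.isOpen_ball.mem_nhds hz))
  · have : z ∉ tsupport χ := by
      rw [χ.tsupport_eq]
      intro h
      rw [Metric.mem_closedBall] at h
      exact hz (Metric.mem_ball.2 (h.trans_lt hχ))
    refine contDiffAt_const (c := (0 : E)).congr_of_eventuallyEq ?_
    filter_upwards [notMem_tsupport_iff_eventuallyEq.1 this] with y hy
    simp [hy]

theorem lintegral_enorm_ne_top {G : Type*} [NormedAddCommGroup G] {f : ℂ → G} (hf : Continuous f) (h : HasCompactSupport f) :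
    ∫⁻ z, ‖f z‖ₑ ≠ ⊤ := (hf.integrable_of_hasCompactSupport h).hasFiniteIntegral.ne

/-- Absorption: `2RC ≤ 1/2`, so half of `S` moves to the left, which is legitimate because `S` is
finite. -/
theorem le_of_le_mul_add_of_ne_top {S Q : ENNReal} {R C : ℝ} (hS : S ≠ ⊤) (hQ : Q ≠ ⊤)
    (hR : 0 < R) (hC : 0 ≤ C) (hRC : 4 * R * C ≤ 1)
    (h : S ≤ ENNReal.ofReal (2 * R) * (ENNReal.ofReal C * S + Q)) :
    S ≤ ENNReal.ofReal (4 * R) * Q := by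
  lift S to NNReal using hS
  lift Q to NNReal using hQ
  rw [ENNReal.ofReal, ENNReal.ofReal] at h
  rw [ENNReal.ofReal]
  norm_cast at h ⊢
  rw [← NNReal.coe_le_coe] at h ⊢
  push_cast at h ⊢
  rw [Real.coe_toNNReal _ (by positivity), Real.coe_toNNReal _ hC] at h
  rw [Real.coe_toNNReal _ (by positivity)]
  nlinarith [mul_le_mul_of_nonneg_right hRC S.coe_nonneg]

/-- Unique continuation from the centre of a small disk. -/
theorem eq_zero_on_ball_of_dbar_le [CompleteSpace E] [CompleteSpace F] {w₁ : ℂ → E} {w₂ : ℂ → F}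
    {a : ℂ} {R C : ℝ} (hw₁ : ContDiffOn ℝ 1 w₁ (Metric.ball a R))
    (hw₂ : ContDiffOn ℝ 1 w₂ (Metric.ball a R)) (h₁ : w₁ =ᶠ[𝓝 a] 0) (h₂ : w₂ =ᶠ[𝓝 a] 0)
    (hC : 0 ≤ C) (hRC : 4 * R * C ≤ 1)
    (hineq : ∀ z ∈ Metric.ball a R, ‖dbar w₁ z‖ + ‖dhol w₂ z‖ ≤ C * (‖w₁ z‖ + ‖w₂ z‖)) :
    ∀ z ∈ Metric.ball a R, w₁ z = 0 ∧ w₂ z = 0 := by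
  intro z₀ hz₀
  have hR : 0 < R := dist_nonneg.trans_lt (Metric.mem_ball.1 hz₀)
  -- The radii are nested as `|z₀ - a| < σ < ρ < ρ' < R`. The cutoff is `1` on the `ρ`-ball and
  -- supported in the closed `ρ'`-ball; the ratio `σ / ρ < 1` provides the decay.
  obtain ⟨σ, hσ1, hσR⟩ := exists_between (Metric.mem_ball.1 hz₀)
  have hσ0 : 0 < σ := dist_nonneg.trans_lt hσ1
  obtain ⟨ρ, hσρ, hρR⟩ := exists_between hσR
  obtain ⟨ρ', hρρ', hρ'R⟩ := exists_between hρR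
  have hρ0 : 0 < ρ := hσ0.trans hσρ
  let χ : ContDiffBump a := ⟨ρ, ρ', hρ0, hρρ'⟩
  set f₁ : ℂ → E := fun z => χ z • w₁ z with hf₁
  set f₂ : ℂ → F := fun z => χ z • w₂ z with hf₂
  have hc₁ : ContDiff ℝ 1 f₁ := contDiff_bump_smul hw₁ χ hρ'R
  have hc₂ : ContDiff ℝ 1 f₂ := contDiff_bump_smul hw₂ χ hρ'R
  have hχs : tsupport χ ⊆ Metric.ball a R := by
    rw [χ.tsupport_eq]
    exact Metric.closedBall_subset_ball hρ'R
  have hs₁ : tsupport f₁ ⊆ Metric.ball a R := (tsupport_smul_subset_left _ _).trans hχs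
  have hs₂ : tsupport f₂ ⊆ Metric.ball a R := (tsupport_smul_subset_left _ _).trans hχs
  have hcs₁ : HasCompactSupport f₁ := χ.hasCompactSupport.smul_right
  have hcs₂ : HasCompactSupport f₂ := χ.hasCompactSupport.smul_right
  have hf0₁ : f₁ =ᶠ[𝓝 a] 0 := by filter_upwards [h₁] with z hz; simp [hf₁, hz]
  have hf0₂ : f₂ =ᶠ[𝓝 a] 0 := by filter_upwards [h₂] with z hz; simp [hf₂, hz]
  have heq₁ : ∀ z ∈ Metric.ball a ρ, f₁ =ᶠ[𝓝 z] w₁ := fun z hz => by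
    filter_upwards [χ.eventuallyEq_one_of_mem_ball hz] with y hy
    simp [hf₁, hy]
  have heq₂ : ∀ z ∈ Metric.ball a ρ, f₂ =ᶠ[𝓝 z] w₂ := fun z hz => by
    filter_upwards [χ.eventuallyEq_one_of_mem_ball hz] with y hy
    simp [hf₂, hy]
  have hcd₁ := continuous_dbar hc₁
  have hcd₂ := continuous_dhol hc₂
  have hds₁ : HasCompactSupport (dbar f₁) := by
    refine (hcs₁.fderiv ℝ).mono' fun z hz => subset_tsupport _ fun h => hz ?_
    simp [dbar, h]
  have hds₂ : HasCompactSupport (dhol f₂) := by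
    refine (hcs₂.fderiv ℝ).mono' fun z hz => subset_tsupport _ fun h => hz ?_
    simp [dhol, h]
  set D : ENNReal := ∫⁻ z, (‖dbar f₁ z‖ₑ + ‖dhol f₂ z‖ₑ) with hD
  have hDtop : D ≠ ⊤ := by
    rw [hD, lintegral_add_left hcd₁.enorm.measurable]
    exact ENNReal.add_ne_top.2 ⟨(lintegral_enorm_ne_top hcd₁ hds₁),
      (lintegral_enorm_ne_top hcd₂ hds₂)⟩
  have hW : ∀ n, Measurable fun z : ℂ => ‖z - a‖ₑ⁻¹ ^ n := fun n => by fun_prop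
  have hm₁ := hc₁.continuous.enorm.measurable
  have hm₂ := hc₂.continuous.enorm.measurable
  have hm : Measurable fun z => ‖f₁ z‖ₑ + ‖f₂ z‖ₑ := hm₁.add hm₂
  have hWm : ∀ n, Measurable fun z : ℂ => ‖z - a‖ₑ⁻¹ ^ n * (‖f₁ z‖ₑ + ‖f₂ z‖ₑ) :=
    fun n => (hW n).mul hm
  have main : ∀ n : ℕ, ∫⁻ z in Metric.ball a σ, (‖f₁ z‖ₑ + ‖f₂ z‖ₑ)
      ≤ (ENNReal.ofReal (4 * R) * D) * (ENNReal.ofReal (σ / ρ)) ^ n := by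
    intro n
    set S : ENNReal := ∫⁻ z, ‖z - a‖ₑ⁻¹ ^ n * (‖f₁ z‖ₑ + ‖f₂ z‖ₑ) with hS
    -- Absorption needs `S` finite: the singularity of the weight sits where both functions vanish,
    -- so the weight is effectively bounded.
    have hStop : S ≠ ⊤ := by
      obtain ⟨δ, hδ, hδ'⟩ := Metric.eventually_nhds_iff_ball.1 (hf0₁.and hf0₂)
      have : S ≤ ∫⁻ z, (ENNReal.ofReal δ)⁻¹ ^ n * (‖f₁ z‖ₑ + ‖f₂ z‖ₑ) := by
        refine lintegral_mono fun z => ?_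
        by_cases hz : z ∈ Metric.ball a δ
        · have h1 : f₁ z = 0 := (hδ' z hz).1
          have h2 : f₂ z = 0 := (hδ' z hz).2
          simp [h1, h2]
        · dsimp only
          gcongr
          rw [← ofReal_norm]
          apply ENNReal.ofReal_le_ofReal
          rw [mem_ball_iff_norm, not_lt] at hz
          exact hz
      refine ne_top_of_le_ne_top ?_ this
      rw [lintegral_const_mul _ hm, lintegral_add_left hm₁]
      refine ENNReal.mul_ne_top (ENNReal.pow_ne_top ?_) (ENNReal.add_ne_top.2
        ⟨(lintegral_enorm_ne_top hc₁.continuous hcs₁),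
          (lintegral_enorm_ne_top hc₂.continuous hcs₂)⟩)
      simpa using hδ
    have e1 : S ≤ ENNReal.ofReal (2 * R) *
        ∫⁻ z, ‖z - a‖ₑ⁻¹ ^ n * (‖dbar f₁ z‖ₑ + ‖dhol f₂ z‖ₑ) := by
      rw [hS]
      simp_rw [mul_add]
      have k₁ : Measurable fun z : ℂ => ‖z - a‖ₑ⁻¹ ^ n * ‖f₁ z‖ₑ := (hW n).mul hm₁
      have k₂ : Measurable fun z : ℂ => ‖z - a‖ₑ⁻¹ ^ n * ‖dbar f₁ z‖ₑ :=
        (hW n).mul hcd₁.enorm.measurable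
      rw [lintegral_add_left k₁, lintegral_add_left k₂, mul_add]
      exact add_le_add (lintegral_weight_dbar_le hc₁ hR hs₁ hf0₁ n)
        (lintegral_weight_dhol_le hc₂ hR hs₂ hf0₂ n)
    -- On the `ρ`-ball the cutoff is invisible and the differential inequality applies. Outside it
    -- nothing is known about the cut-off functions, but the weight is at most `ρ⁻ⁿ`.
    have e2 : ∫⁻ z, ‖z - a‖ₑ⁻¹ ^ n * (‖dbar f₁ z‖ₑ + ‖dhol f₂ z‖ₑ)
        ≤ ENNReal.ofReal C * S + (ENNReal.ofReal ρ)⁻¹ ^ n * D := by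
      rw [hS, hD, ← lintegral_const_mul' _ _ ENNReal.ofReal_ne_top,
        ← lintegral_const_mul' _ _ (ENNReal.pow_ne_top (by simpa using hρ0)),
        ← lintegral_add_left ((hWm n).const_mul (ENNReal.ofReal C))]
      refine lintegral_mono fun z => ?_
      dsimp only
      by_cases hz : z ∈ Metric.ball a ρ
      · refine le_trans ?_ le_self_add
        rw [mul_left_comm]
        gcongr
        rw [(heq₁ z hz).dbar_eq, (heq₂ z hz).dhol_eq, (heq₁ z hz).eq_of_nhds,
          (heq₂ z hz).eq_of_nhds]
        simp_rw [← ofReal_norm]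
        rw [← ENNReal.ofReal_add (norm_nonneg _) (norm_nonneg _),
          ← ENNReal.ofReal_add (norm_nonneg _) (norm_nonneg _), ← ENNReal.ofReal_mul hC]
        exact ENNReal.ofReal_le_ofReal (hineq z (Metric.ball_subset_ball hρR.le hz))
      · refine le_trans ?_ le_add_self
        gcongr
        rw [← ofReal_norm]
        apply ENNReal.ofReal_le_ofReal
        rw [mem_ball_iff_norm, not_lt] at hz
        exact hz
    have e3 : S ≤ ENNReal.ofReal (4 * R) * ((ENNReal.ofReal ρ)⁻¹ ^ n * D) := by
      have hQ : (ENNReal.ofReal ρ)⁻¹ ^ n * D ≠ ⊤ :=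
        ENNReal.mul_ne_top (ENNReal.pow_ne_top (by simpa using hρ0)) hDtop
      exact le_of_le_mul_add_of_ne_top hStop hQ hR hC hRC (e1.trans (mul_le_mul_right e2 _))
    have e4 : (ENNReal.ofReal σ)⁻¹ ^ n * ∫⁻ z in Metric.ball a σ, (‖f₁ z‖ₑ + ‖f₂ z‖ₑ) ≤ S := by
      rw [← lintegral_const_mul' _ _ (ENNReal.pow_ne_top (by simpa using hσ0))]
      refine le_trans (setLIntegral_mono' measurableSet_ball fun z hz => ?_)
        (setLIntegral_le_lintegral (Metric.ball a σ) _)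
      gcongr
      rw [← ofReal_norm]
      apply ENNReal.ofReal_le_ofReal
      rw [mem_ball_iff_norm] at hz
      exact hz.le
    have hσn : ENNReal.ofReal σ ^ n * (ENNReal.ofReal σ)⁻¹ ^ n = 1 := by
      rw [← mul_pow, ENNReal.mul_inv_cancel (by simpa using hσ0) ENNReal.ofReal_ne_top, one_pow]
    calc ∫⁻ z in Metric.ball a σ, (‖f₁ z‖ₑ + ‖f₂ z‖ₑ)
        = ENNReal.ofReal σ ^ n * ((ENNReal.ofReal σ)⁻¹ ^ n *
            ∫⁻ z in Metric.ball a σ, (‖f₁ z‖ₑ + ‖f₂ z‖ₑ)) := by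
          rw [← mul_assoc, hσn, one_mul]
      _ ≤ ENNReal.ofReal σ ^ n * (ENNReal.ofReal (4 * R) * ((ENNReal.ofReal ρ)⁻¹ ^ n * D)) :=
          mul_le_mul_right (e4.trans e3) _
      _ = _ := by
          rw [ENNReal.ofReal_div_of_pos hρ0, div_eq_mul_inv, mul_pow]
          ring
  -- Let `n → ∞` in `main`; the left side does not depend on `n`.
  have hzero : ∫⁻ z in Metric.ball a σ, (‖f₁ z‖ₑ + ‖f₂ z‖ₑ) = 0 := by
    have hlt : ENNReal.ofReal (σ / ρ) < 1 := by
      rw [ENNReal.ofReal_lt_one, div_lt_one hρ0]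
      exact hσρ
    have ht := ENNReal.Tendsto.const_mul (a := ENNReal.ofReal (4 * R) * D)
      (ENNReal.tendsto_pow_atTop_nhds_zero_of_lt_one hlt)
      (Or.inr (ENNReal.mul_ne_top ENNReal.ofReal_ne_top hDtop))
    rw [mul_zero] at ht
    exact le_antisymm (ge_of_tendsto' ht main) bot_le
  have hz₀σ : z₀ ∈ Metric.ball a σ := hσ1
  have hz₀ρ : z₀ ∈ Metric.ball a ρ := hσ1.trans hσρ
  rw [← (heq₁ z₀ hz₀ρ).eq_of_nhds, ← (heq₂ z₀ hz₀ρ).eq_of_nhds]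
  have hae := (lintegral_eq_zero_iff hm).1 hzero
  have hE : EqOn f₁ 0 (Metric.ball a σ) := by
    refine Measure.eqOn_open_of_ae_eq (μ := volume) ?_ Metric.isOpen_ball
      hc₁.continuous.continuousOn continuousOn_const
    filter_upwards [hae] with z hz
    simpa using (add_eq_zero.1 hz).1
  have hF : EqOn f₂ 0 (Metric.ball a σ) := by
    refine Measure.eqOn_open_of_ae_eq (μ := volume) ?_ Metric.isOpen_ball
      hc₂.continuous.continuousOn continuousOn_const
    filter_upwards [hae] with z hz
    simpa using (add_eq_zero.1 hz).2
  exact ⟨hE hz₀σ, hF hz₀σ⟩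

end UniqueContinuation

/-! ### Unique continuation from the real axis -/

section UniqueContinuationAxis

variable {E F : Type*} [NormedAddCommGroup E] [NormedSpace ℂ E] [NormedAddCommGroup F]
  [NormedSpace ℂ F]

/-- The open half-plane `σ Im z > 0`. -/
def halfPlane (σ : ℝ) : Set ℂ := {z | 0 < σ * z.im}

theorem isOpen_halfPlane (σ : ℝ) : IsOpen (halfPlane σ) :=
  isOpen_lt continuous_const (by fun_prop)

theorem halfPlane_cases {σ : ℝ} (hσ : σ ≠ 0) (z : ℂ) :
    z ∈ halfPlane σ ∨ (halfPlane σ)ᶜ ∈ 𝓝 z ∨ z.im = 0 := by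
  rcases lt_trichotomy 0 (σ * z.im) with h | h | h
  · exact Or.inl h
  · exact Or.inr (Or.inr ((mul_eq_zero.1 h.symm).resolve_left hσ))
  · refine Or.inr (Or.inl ?_)
    filter_upwards [(isOpen_lt (by fun_prop : Continuous fun w : ℂ => σ * w.im)
      continuous_const).mem_nhds h] with w hw
    exact fun h' => lt_asymm hw h'

/-- A function that vanishes to first order on the axis may be replaced by zero on one side: the
truncation is dominated by `w`, hence still `o(|y|)` at axis points. -/
theorem hasFDerivAt_indicator_halfPlane {w : ℂ → E} {σ : ℝ} (hσ : σ ≠ 0) {z : ℂ}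
    (hw : DifferentiableAt ℝ w z) (h0 : z.im = 0 → w z = 0 ∧ fderiv ℝ w z = 0) :
    HasFDerivAt ((halfPlane σ).indicator w) ((halfPlane σ).indicator (fderiv ℝ w) z) z := by
  rcases halfPlane_cases hσ z with h | h | h
  · rw [indicator_of_mem h]
    refine hw.hasFDerivAt.congr_of_eventuallyEq ?_
    filter_upwards [(isOpen_halfPlane σ).mem_nhds h] with y hy
    rw [indicator_of_mem hy]
  · rw [indicator_of_notMem (mem_of_mem_nhds h)]
    refine (hasFDerivAt_const (0 : E) z).congr_of_eventuallyEq ?_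
    filter_upwards [h] with y hy
    rw [indicator_of_notMem hy]
  · have hz : z ∉ halfPlane σ := by simp [halfPlane, h]
    rw [indicator_of_notMem hz]
    have hd := hw.hasFDerivAt
    rw [(h0 h).2, hasFDerivAt_iff_isLittleO_nhds_zero] at hd
    rw [hasFDerivAt_iff_isLittleO_nhds_zero, indicator_of_notMem hz]
    refine (Asymptotics.IsBigO.of_bound 1 ?_).trans_isLittleO hd
    refine Eventually.of_forall fun y => ?_
    rw [(h0 h).1, one_mul]
    simpa using norm_indicator_le_norm_self w (z + y)

theorem contDiffOn_indicator_halfPlane {w : ℂ → E} {σ : ℝ} (hσ : σ ≠ 0) {U : Set ℂ}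
    (hU : IsOpen U) (hw : ContDiffOn ℝ 1 w U)
    (h0 : ∀ z ∈ U, z.im = 0 → w z = 0 ∧ fderiv ℝ w z = 0) :
    ContDiffOn ℝ 1 ((halfPlane σ).indicator w) U := by
  have hd : ∀ z ∈ U, HasFDerivAt ((halfPlane σ).indicator w)
      ((halfPlane σ).indicator (fderiv ℝ w) z) z := fun z hz =>
    hasFDerivAt_indicator_halfPlane hσ
      ((hw.differentiableOn one_ne_zero).differentiableAt (hU.mem_nhds hz)) (h0 z hz)
  have hc : ContinuousOn (fderiv ℝ w) U := hw.continuousOn_fderiv_of_isOpen hU le_rfl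
  have hone : (1 : WithTop ℕ∞) = 0 + 1 := by simp
  rw [hone, contDiffOn_succ_iff_fderiv_of_isOpen hU]
  refine ⟨fun z hz => (hd z hz).differentiableAt.differentiableWithinAt, by simp, ?_⟩
  rw [contDiffOn_zero]
  intro z hz
  refine ContinuousAt.continuousWithinAt ?_
  have hcz : ContinuousAt (fderiv ℝ w) z := hc.continuousAt (hU.mem_nhds hz)
  have heq : fderiv ℝ ((halfPlane σ).indicator w)
      =ᶠ[𝓝 z] (halfPlane σ).indicator (fderiv ℝ w) := by
    filter_upwards [hU.mem_nhds hz] with y hy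
    exact (hd y hy).fderiv
  refine ContinuousAt.congr ?_ heq.symm
  rcases halfPlane_cases hσ z with h | h | h
  · refine hcz.congr ?_
    filter_upwards [(isOpen_halfPlane σ).mem_nhds h] with y hy
    rw [indicator_of_mem hy]
  · refine (continuousAt_const (y := (0 : ℂ →L[ℝ] E))).congr ?_
    filter_upwards [h] with y hy
    rw [indicator_of_notMem hy]
  · have hzn : z ∉ halfPlane σ := by simp [halfPlane, h]
    rw [ContinuousAt, indicator_of_notMem hzn]
    rw [ContinuousAt, (h0 z hz h).2] at hcz
    exact squeeze_zero_norm (fun y => norm_indicator_le_norm_self _ _)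
      (by simpa using hcz.norm)

theorem clm_complex_ext {L : ℂ →L[ℝ] E} (h1 : L 1 = 0) (hI : L Complex.I = 0) : L = 0 := by
  ext z
  have : z = z.re • (1 : ℂ) + z.im • Complex.I := by simp [Complex.re_add_im]
  rw [this, map_add, map_smul, map_smul, h1, hI]
  simp

theorem fderiv_one_eq_zero_of_axis {w : ℂ → E} {t : ℝ} (hw : DifferentiableAt ℝ w t)
    (h0 : ∀ᶠ s : ℝ in 𝓝 t, w s = 0) : fderiv ℝ w t 1 = 0 := by
  have h1 : HasDerivAt (fun s : ℝ => w s) (fderiv ℝ w t 1) t := by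
    have := hw.hasFDerivAt.comp_hasDerivAt t (Complex.ofRealCLM.hasDerivAt (x := t))
    simpa [Function.comp_def] using this
  have h2 : HasDerivAt (fun s : ℝ => w s) 0 t :=
    (hasDerivAt_const t (0 : E)).congr_of_eventuallyEq h0
  exact h1.unique h2

/-- Unique continuation from the real axis. -/
theorem eventually_eq_zero_of_dbar_le [CompleteSpace E] [CompleteSpace F] {w₁ : ℂ → E}
    {w₂ : ℂ → F} {s : ℝ} {C : ℝ} (hw₁ : ContDiffAt ℝ 1 w₁ s) (hw₂ : ContDiffAt ℝ 1 w₂ s)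
    (h₁ : ∀ᶠ t : ℝ in 𝓝 s, w₁ t = 0) (h₂ : ∀ᶠ t : ℝ in 𝓝 s, w₂ t = 0)
    (hineq : ∀ᶠ z in 𝓝 (s : ℂ), ‖dbar w₁ z‖ + ‖dhol w₂ z‖ ≤ C * (‖w₁ z‖ + ‖w₂ z‖)) :
    w₁ =ᶠ[𝓝 (s : ℂ)] 0 ∧ w₂ =ᶠ[𝓝 (s : ℂ)] 0 := by
  wlog hC : 0 ≤ C generalizing C
  · refine this (C := |C|) ?_ (abs_nonneg C)
    filter_upwards [hineq] with z hz
    exact hz.trans (mul_le_mul_of_nonneg_right (le_abs_self C) (by positivity))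
  have hR₁ : ∀ᶠ z in 𝓝 (s : ℂ), z.im = 0 → w₁ z = 0 ∧ w₂ z = 0 := by
    have : Tendsto Complex.re (𝓝 (s : ℂ)) (𝓝 s) := by
      simpa using Complex.continuous_re.tendsto (s : ℂ)
    filter_upwards [this.eventually h₁, this.eventually h₂] with z hz1 hz2 hz
    have e : (z.re : ℂ) = z := Complex.ext rfl (by simp [hz])
    rw [e] at hz1 hz2
    exact ⟨hz1, hz2⟩
  obtain ⟨r, hr, hall⟩ := Metric.eventually_nhds_iff_ball.1 ((hR₁.and hineq).and
    ((hw₁.eventually (by simp)).and (hw₂.eventually (by simp))))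
  have hc₁ : ContDiffOn ℝ 1 w₁ (Metric.ball s r) := fun z hz =>
    (hall z hz).2.1.contDiffWithinAt
  have hc₂ : ContDiffOn ℝ 1 w₂ (Metric.ball s r) := fun z hz =>
    (hall z hz).2.2.contDiffWithinAt
  -- On the axis the tangential derivatives vanish with the functions, and the inequality forces
  -- `dbar w₁ = 0` and `dhol w₂ = 0`, so the normal derivatives vanish too.
  have hax : ∀ z ∈ Metric.ball (s : ℂ) r, z.im = 0 →
      (w₁ z = 0 ∧ fderiv ℝ w₁ z = 0) ∧ (w₂ z = 0 ∧ fderiv ℝ w₂ z = 0) := by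
    intro z hz him
    have e : z = (z.re : ℂ) := Complex.ext rfl (by simp [him])
    obtain ⟨z1, z2⟩ := (hall z hz).1.1 him
    have hnear : ∀ᶠ t : ℝ in 𝓝 z.re, w₁ t = 0 ∧ w₂ t = 0 := by
      have hcont : Tendsto (fun t : ℝ => (t : ℂ)) (𝓝 z.re) (𝓝 z) := by
        conv => rhs; rw [e]
        exact Complex.continuous_ofReal.tendsto z.re
      filter_upwards [hcont.eventually (Metric.isOpen_ball.mem_nhds hz)] with t ht
      exact (hall t ht).1.1 (Complex.ofReal_im t)
    have hd₁ := (hall z hz).2.1.differentiableAt one_ne_zero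
    have hd₂ := (hall z hz).2.2.differentiableAt one_ne_zero
    have hi := (hall z hz).1.2
    rw [z1, z2, norm_zero, norm_zero, add_zero, mul_zero] at hi
    have n1 : dbar w₁ z = 0 := norm_le_zero_iff.1 (by linarith [norm_nonneg (dhol w₂ z)])
    have n2 : dhol w₂ z = 0 := norm_le_zero_iff.1 (by linarith [norm_nonneg (dbar w₁ z)])
    have u1 : fderiv ℝ w₁ z 1 = 0 := by
      rw [e] at hd₁ ⊢
      exact fderiv_one_eq_zero_of_axis hd₁ (hnear.mono fun t ht => ht.1)
    have u2 : fderiv ℝ w₂ z 1 = 0 := by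
      rw [e] at hd₂ ⊢
      exact fderiv_one_eq_zero_of_axis hd₂ (hnear.mono fun t ht => ht.2)
    refine ⟨⟨z1, clm_complex_ext u1 ?_⟩, ⟨z2, clm_complex_ext u2 ?_⟩⟩
    · simpa [dbar, u1] using n1
    · simpa [dhol, u2] using n2
  obtain ⟨R, hR0, hRr, hRC⟩ : ∃ R > 0, 2 * R ≤ r ∧ 4 * R * C ≤ 1 := by
    refine ⟨min (r / 2) (1 / (4 * (C + 1))), by positivity, ?_, ?_⟩
    · linarith [min_le_left (r / 2) (1 / (4 * (C + 1)))]
    · have h := min_le_right (r / 2) (1 / (4 * (C + 1)))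
      have h2 : (1 / (4 * (C + 1))) * (4 * (C + 1)) = 1 := by field_simp
      have h3 : 0 < min (r / 2) (1 / (4 * (C + 1))) := by positivity
      nlinarith
  have key : ∀ σ : ℝ, |σ| = 1 → ∀ z ∈ Metric.ball (s : ℂ) (R / 2), z ∈ halfPlane σ →
      w₁ z = 0 ∧ w₂ z = 0 := by
    intro σ hσ z hz hzσ
    have hσ0 : σ ≠ 0 := by rintro rfl; simp at hσ
    -- The centre lies on the far side of the axis, where the truncated functions vanish
    -- identically. Its distance `R/2` from `s` makes the `R`-ball about it cover the `R/2`-ball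
    -- about `s`, and `2R ≤ r` keeps it in the good region.
    set a : ℂ := s - (σ * (R / 2) : ℝ) * Complex.I with ha
    have hda : dist (s : ℂ) a = R / 2 := by
      rw [dist_eq_norm, ha, sub_sub_cancel, norm_mul, Complex.norm_I, Complex.norm_real,
        Real.norm_eq_abs, abs_mul, hσ, abs_of_pos (by positivity)]
      ring
    have hsub : Metric.ball a R ⊆ Metric.ball (s : ℂ) r := by
      apply Metric.ball_subset_ball'
      rw [dist_comm, hda]
      linarith
    have haim : a ∉ closure (halfPlane σ) := by
      have : closure (halfPlane σ) ⊆ {z | 0 ≤ σ * z.im} :=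
        closure_minimal (fun z (hz : 0 < σ * z.im) => hz.le) (isClosed_le continuous_const (by fun_prop))
      intro h
      have h1 : 0 ≤ σ * a.im := this h
      have h2 : σ * σ = 1 := by rw [← abs_mul_abs_self, hσ, one_mul]
      have h3 : a.im = -(σ * (R / 2)) := by simp [ha]
      rw [h3] at h1
      nlinarith
    have hz1 : (halfPlane σ).indicator w₁ =ᶠ[𝓝 a] 0 := by
      filter_upwards [isClosed_closure.isOpen_compl.mem_nhds haim] with y hy
      rw [indicator_of_notMem fun h => hy (subset_closure h)]
      rfl
    have hz2 : (halfPlane σ).indicator w₂ =ᶠ[𝓝 a] 0 := by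
      filter_upwards [isClosed_closure.isOpen_compl.mem_nhds haim] with y hy
      rw [indicator_of_notMem fun h => hy (subset_closure h)]
      rfl
    have hza : z ∈ Metric.ball a R := by
      rw [Metric.mem_ball] at hz ⊢
      linarith [dist_triangle z (s : ℂ) a]
    have := eq_zero_on_ball_of_dbar_le (C := C) (R := R)
      ((contDiffOn_indicator_halfPlane hσ0 Metric.isOpen_ball hc₁
        fun y hy hy' => (hax y hy hy').1).mono hsub)
      ((contDiffOn_indicator_halfPlane hσ0 Metric.isOpen_ball hc₂
        fun y hy hy' => (hax y hy hy').2).mono hsub) hz1 hz2 hC hRC ?_ z hza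
    · rwa [indicator_of_mem hzσ, indicator_of_mem hzσ] at this
    · intro y hy
      have hyr := hsub hy
      have e1 := (hasFDerivAt_indicator_halfPlane hσ0
        ((hall y hyr).2.1.differentiableAt one_ne_zero) fun h => (hax y hyr h).1).fderiv
      have e2 := (hasFDerivAt_indicator_halfPlane hσ0
        ((hall y hyr).2.2.differentiableAt one_ne_zero) fun h => (hax y hyr h).2).fderiv
      rw [dbar, dhol, e1, e2]
      by_cases hyσ : y ∈ halfPlane σ
      · simp only [indicator_of_mem hyσ]
        exact (hall y hyr).1.2
      · simp [indicator_of_notMem hyσ]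
  have hfin : ∀ z ∈ Metric.ball (s : ℂ) (R / 2), w₁ z = 0 ∧ w₂ z = 0 := by
    intro z hz
    rcases lt_trichotomy z.im 0 with h | h | h
    · exact key (-1) (by simp) z hz (by simpa [halfPlane] using h)
    · exact (hall z (Metric.ball_subset_ball (by linarith) hz)).1.1 h
    · exact key 1 (by simp) z hz (by simpa [halfPlane] using h)
  have hb := Metric.ball_mem_nhds (s : ℂ) (by positivity : 0 < R / 2)
  constructor
  · filter_upwards [hb] with z hz using (hfin z hz).1
  · filter_upwards [hb] with z hz using (hfin z hz).2

/-! ### Second order inequalities -/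

/-- The Laplacian of a vector-valued function. -/
def lap (h : ℂ → E) (z : ℂ) : E :=
  fderiv ℝ (fun w => fderiv ℝ h w 1) z 1 + fderiv ℝ (fun w => fderiv ℝ h w Complex.I) z Complex.I

theorem norm_clm_complex_le (L : ℂ →L[ℝ] E) : ‖L‖ ≤ ‖L 1‖ + ‖L Complex.I‖ := by
  refine L.opNorm_le_bound (by positivity) fun z => ?_
  have hz : z = z.re • (1 : ℂ) + z.im • Complex.I := by simp [Complex.re_add_im]
  calc ‖L z‖ = ‖z.re • L 1 + z.im • L Complex.I‖ := by
        conv_lhs => rw [hz, map_add, map_smul, map_smul]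
    _ ≤ ‖z‖ * ‖L 1‖ + ‖z‖ * ‖L Complex.I‖ := by
        refine (norm_add_le _ _).trans ?_
        rw [norm_smul, norm_smul]
        gcongr
        · exact Complex.abs_re_le_norm z
        · exact Complex.abs_im_le_norm z
    _ = _ := by ring

theorem norm_fderiv_le_dhol_add_dbar (h : ℂ → E) (z : ℂ) :
    ‖fderiv ℝ h z‖ ≤ ‖dhol h z‖ + ‖dbar h z‖ := by
  refine (norm_clm_complex_le _).trans ?_
  have h1 : fderiv ℝ h z 1 = (2⁻¹ : ℂ) • (dhol h z + dbar h z) := by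
    simp only [dhol, dbar]; module
  have h2 : fderiv ℝ h z Complex.I = (2⁻¹ * Complex.I : ℂ) • (dhol h z - dbar h z) := by
    simp only [dhol, dbar]
    match_scalars <;> first | ring1 | linear_combination Complex.I_mul_I
  rw [h1, h2, norm_smul, norm_smul]
  have := norm_add_le (dhol h z) (dbar h z)
  have := norm_sub_le (dhol h z) (dbar h z)
  simp only [norm_mul, norm_inv, Complex.norm_I, Complex.norm_ofNat, mul_one]
  linarith

theorem fderiv_clm_apply_const {h : ℂ → E} {z : ℂ} (hh : ContDiffAt ℝ 2 h z) (v : ℂ) :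
    HasFDerivAt (fun w => fderiv ℝ h w v) ((fderiv ℝ (fderiv ℝ h) z).flip v) z := by
  have h1 : DifferentiableAt ℝ (fderiv ℝ h) z :=
    (hh.fderiv_right (m := 1) (by norm_num)).differentiableAt one_ne_zero
  have := h1.hasFDerivAt.clm_apply (hasFDerivAt_const v z)
  convert! this using 1
  ext x
  simp

theorem fderiv_fderiv_comm {h : ℂ → E} {z : ℂ} (hh : ContDiffAt ℝ 2 h z) (v w : ℂ) :
    fderiv ℝ (fun y => fderiv ℝ h y v) z w = fderiv ℝ (fun y => fderiv ℝ h y w) z v := by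
  rw [(fderiv_clm_apply_const hh v).fderiv, (fderiv_clm_apply_const hh w).fderiv]
  exact (hh.isSymmSndFDerivAt (by simp)).eq w v

/-- Both operators carry a factor two, so the product `4 ∂_ζ̄ ∂_ζ` is the Laplacian on the nose; the
mixed derivatives cancel by symmetry. -/
theorem dbar_dhol {h : ℂ → E} {z : ℂ} (hh : ContDiffAt ℝ 2 h z) :
    dbar (dhol h) z = lap h z := by
  have d1 := (fderiv_clm_apply_const hh 1).differentiableAt
  have d2 := (fderiv_clm_apply_const hh Complex.I).differentiableAt
  have e : fderiv ℝ (dhol h) z = fderiv ℝ (fun w => fderiv ℝ h w 1) z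
      - Complex.I • fderiv ℝ (fun w => fderiv ℝ h w Complex.I) z := by
    exact (d1.hasFDerivAt.sub (d2.hasFDerivAt.const_smul Complex.I)).fderiv
  rw [dbar, e, lap]
  simp only [sub_apply, smul_apply]
  rw [fderiv_fderiv_comm hh 1 Complex.I]
  match_scalars
  · ring
  · ring
  · linear_combination -Complex.I_mul_I

theorem dhol_dbar {h : ℂ → E} {z : ℂ} (hh : ContDiffAt ℝ 2 h z) :
    dhol (dbar h) z = lap h z := by
  have d1 := (fderiv_clm_apply_const hh 1).differentiableAt
  have d2 := (fderiv_clm_apply_const hh Complex.I).differentiableAt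
  have e : fderiv ℝ (dbar h) z = fderiv ℝ (fun w => fderiv ℝ h w 1) z
      + Complex.I • fderiv ℝ (fun w => fderiv ℝ h w Complex.I) z := by
    exact (d1.hasFDerivAt.add (d2.hasFDerivAt.const_smul Complex.I)).fderiv
  rw [dhol, e, lap]
  simp only [add_apply, smul_apply]
  rw [fderiv_fderiv_comm hh 1 Complex.I]
  match_scalars
  · ring
  · ring
  · linear_combination -Complex.I_mul_I

theorem contDiffAt_dhol {h : ℂ → E} {z : ℂ} {n m : WithTop ℕ∞} (hh : ContDiffAt ℝ n h z)
    (hmn : m + 1 ≤ n) : ContDiffAt ℝ m (dhol h) z := by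
  have := hh.fderiv_right (m := m) hmn
  exact (this.clm_apply contDiffAt_const).sub ((this.clm_apply contDiffAt_const).const_smul _)

theorem contDiffAt_dbar {h : ℂ → E} {z : ℂ} {n m : WithTop ℕ∞} (hh : ContDiffAt ℝ n h z)
    (hmn : m + 1 ≤ n) : ContDiffAt ℝ m (dbar h) z := by
  have := hh.fderiv_right (m := m) hmn
  exact (this.clm_apply contDiffAt_const).add ((this.clm_apply contDiffAt_const).const_smul _)

theorem dbar_prodMk {f : ℂ → E} {g : ℂ → F} {z : ℂ} (hf : DifferentiableAt ℝ f z)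
    (hg : DifferentiableAt ℝ g z) : dbar (fun z => (f z, g z)) z = (dbar f z, dbar g z) := by
  rw [dbar, (hf.hasFDerivAt.prodMk hg.hasFDerivAt).fderiv]
  rfl

/-- Reduction to first order: `dbar` acts on the pair `(h, dhol h)` and `dhol` on `dbar h`, and each
gives `dbar h` or the Laplacian. These are the unknowns `w₁` and `w₂` of the unique continuation
theorems. -/
theorem dbar_le_of_lap_le {h : ℂ → E} {z : ℂ} {C : ℝ} (hh : ContDiffAt ℝ 2 h z) (hC : 0 ≤ C)
    (hl : ‖lap h z‖ ≤ C * (‖h z‖ + ‖fderiv ℝ h z‖)) :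
    ‖dbar (fun z => (h z, dhol h z)) z‖ + ‖dhol (dbar h) z‖
      ≤ (1 + 4 * C) * (‖(h z, dhol h z)‖ + ‖dbar h z‖) := by
  rw [dbar_prodMk (hh.differentiableAt two_ne_zero)
    ((contDiffAt_dhol (m := 1) hh (by norm_num)).differentiableAt one_ne_zero),
    dbar_dhol hh, dhol_dbar hh]
  have h1 : ‖h z‖ ≤ ‖(h z, dhol h z)‖ := norm_fst_le (h z, dhol h z)
  have h2 : ‖dhol h z‖ ≤ ‖(h z, dhol h z)‖ := norm_snd_le (h z, dhol h z)
  have h3 := norm_fderiv_le_dhol_add_dbar h z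
  have h4 : ‖(dbar h z, lap h z)‖ ≤ ‖dbar h z‖ + ‖lap h z‖ :=
    max_le (by simp) (by simp)
  have h5 : ‖lap h z‖ ≤ C * (2 * ‖(h z, dhol h z)‖ + ‖dbar h z‖) :=
    hl.trans (mul_le_mul_of_nonneg_left (by linarith) hC)
  nlinarith [mul_nonneg hC (norm_nonneg (dbar h z)), norm_nonneg (h z, dhol h z)]

/-- Uniqueness in the Cauchy problem on the real axis for `|Δh| ≤ C (|h| + |Dh|)`. -/
theorem eventually_eq_zero_of_lap_le [CompleteSpace E] {h : ℂ → E} {s C : ℝ}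
    (hh : ContDiffAt ℝ 2 h s)
    (h0 : ∀ᶠ t : ℝ in 𝓝 s, h t = 0) (h1 : ∀ᶠ t : ℝ in 𝓝 s, fderiv ℝ h t = 0)
    (hineq : ∀ᶠ z in 𝓝 (s : ℂ), ‖lap h z‖ ≤ C * (‖h z‖ + ‖fderiv ℝ h z‖)) :
    h =ᶠ[𝓝 (s : ℂ)] 0 := by
  have hineq' : ∀ᶠ z in 𝓝 (s : ℂ), ‖lap h z‖ ≤ |C| * (‖h z‖ + ‖fderiv ℝ h z‖) :=
    hineq.mono fun z hz => hz.trans (mul_le_mul_of_nonneg_right (le_abs_self C) (by positivity))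
  have := (eventually_eq_zero_of_dbar_le (w₁ := fun z => (h z, dhol h z)) (w₂ := dbar h)
    (s := s) (C := 1 + 4 * |C|)
    ((hh.of_le (by norm_num)).prodMk (contDiffAt_dhol (m := 1) hh (by norm_num)))
    (contDiffAt_dbar (m := 1) hh (by norm_num))
    (by filter_upwards [h0, h1] with t ht ht'; simp [ht, dhol, ht'])
    (by filter_upwards [h1] with t ht'; simp [dbar, ht'])
    (by
      filter_upwards [hineq', hh.eventually (by simp)] with z hz hz'
      exact dbar_le_of_lap_le hz' (abs_nonneg C) hz)).1
  filter_upwards [this] with z hz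
  exact (Prod.mk.inj hz).1

/-- Weak unique continuation for `|Δh| ≤ C (|h| + |Dh|)`. -/
theorem eqOn_zero_of_lap_le [CompleteSpace E] {h : ℂ → E} {U : Set ℂ} (hU : IsOpen U)
    (hUc : IsPreconnected U) (hh : ContDiffOn ℝ 2 h U)
    (hineq : ∀ q ∈ U, h q = 0 → fderiv ℝ h q = 0 →
      ∃ C : ℝ, ∀ᶠ z in 𝓝 q, ‖lap h z‖ ≤ C * (‖h z‖ + ‖fderiv ℝ h z‖))
    {p : ℂ} (hp : p ∈ U) (hp0 : h =ᶠ[𝓝 p] 0) : EqOn h 0 U := by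
  have hcd : ∀ z ∈ U, ContDiffAt ℝ 2 h z := fun z hz => hh.contDiffAt (hU.mem_nhds hz)
  suffices hs : U ⊆ {z | h =ᶠ[𝓝 z] 0} from fun z hz => (hs hz).eq_of_nhds
  refine hUc.subset_of_closure_inter_subset (isOpen_setOfPred_eventually_nhds) ⟨p, hp, hp0⟩ ?_
  rintro q ⟨hqc, hqU⟩
  have hq0 : h q = 0 := by
    have hc : ContinuousAt h q := (hcd q hqU).continuousAt
    have hm := mem_closure_iff_frequently.1 hqc
    exact (tendsto_nhds_unique_of_frequently_eq hc tendsto_const_nhds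
      (hm.mono fun y hy => hy.eq_of_nhds))
  have hq1 : fderiv ℝ h q = 0 := by
    have hc : ContinuousAt (fderiv ℝ h) q :=
      ((hcd q hqU).fderiv_right (m := 1) (by norm_num)).continuousAt
    have hm := mem_closure_iff_frequently.1 hqc
    refine (tendsto_nhds_unique_of_frequently_eq hc (tendsto_const_nhds (x := 0))
      (hm.mono fun y hy => ?_))
    rw [Filter.EventuallyEq.fderiv_eq hy]
    simp
  -- It remains to see that the interior of the zero set is relatively closed. The inequality is
  -- required only at points where `h` and `Dh` vanish, which limit points of that interior satisfy
  -- by continuity.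
  obtain ⟨C, hC⟩ := hineq q hqU hq0 hq1
  obtain ⟨r, hr, hall⟩ := Metric.eventually_nhds_iff_ball.1
    (hC.and (hU.eventually_mem hqU))
  obtain ⟨R, hR0, hRr, hRC⟩ : ∃ R > 0, 2 * R ≤ r ∧ 4 * R * (1 + 4 * |C|) ≤ 1 := by
    refine ⟨min (r / 2) (1 / (4 * (1 + 4 * |C|))), by positivity, ?_, ?_⟩
    · linarith [min_le_left (r / 2) (1 / (4 * (1 + 4 * |C|)))]
    · have h := min_le_right (r / 2) (1 / (4 * (1 + 4 * |C|)))
      have h2 : (1 / (4 * (1 + 4 * |C|))) * (4 * (1 + 4 * |C|)) = 1 := by field_simp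
      have h3 : 0 < 1 + 4 * |C| := by positivity
      nlinarith
  -- `R` is chosen before `a`, so a ball of admissible radius about a nearby interior zero still
  -- contains `q`.
  obtain ⟨a, ha0, haq⟩ := Metric.mem_closure_iff.1 hqc R hR0
  have hsub : Metric.ball a R ⊆ Metric.ball q r :=
    Metric.ball_subset_ball' (by rw [dist_comm]; linarith)
  have hcda : ∀ z ∈ Metric.ball a R, ContDiffAt ℝ 2 h z := fun z hz =>
    hcd z (hall z (hsub hz)).2
  have ha0' : h =ᶠ[𝓝 a] 0 := ha0
  have hfd : ∀ᶠ y in 𝓝 a, fderiv ℝ h y = 0 := by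
    filter_upwards [ha0'.eventuallyEq_nhds] with y hy
    rw [hy.fderiv_eq]
    simp
  have key := eq_zero_on_ball_of_dbar_le (w₁ := fun z => (h z, dhol h z)) (w₂ := dbar h)
    (a := a) (R := R) (C := 1 + 4 * |C|)
    (fun z hz => (((hcda z hz).of_le (by norm_num)).prodMk
      (contDiffAt_dhol (m := 1) (hcda z hz) (by norm_num))).contDiffWithinAt)
    (fun z hz => (contDiffAt_dbar (m := 1) (hcda z hz) (by norm_num)).contDiffWithinAt)
    (by filter_upwards [ha0', hfd] with t ht ht'; simp [ht, dhol, ht'])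
    (by filter_upwards [hfd] with t ht'; simp [dbar, ht'])
    (by positivity) hRC
    (fun z hz => dbar_le_of_lap_le (hcda z hz) (abs_nonneg C)
      ((hall z (hsub hz)).1.trans
        (mul_le_mul_of_nonneg_right (le_abs_self C) (by positivity))))
  have hqa : q ∈ Metric.ball a R := by rwa [Metric.mem_ball]
  filter_upwards [Metric.isOpen_ball.mem_nhds hqa] with z hz
  exact (Prod.mk.inj (key z hz).1).1

end UniqueContinuationAxis

/-! ### Analytic dependence on parameters of a fixed point -/

section FixedPoint

variable {X : Type*} [NormedAddCommGroup X] [NormedSpace ℂ X]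

/-- The shear `(p, v) ↦ (p, v - K p)`. -/
def shearEquiv {P : Type*} [NormedAddCommGroup P] [NormedSpace ℂ P] (K : P →L[ℂ] X) :
    (P × X) ≃L[ℂ] (P × X) :=
  ContinuousLinearEquiv.equivOfInverse
    ((ContinuousLinearMap.fst ℂ P X).prod
      (ContinuousLinearMap.snd ℂ P X - K.comp (ContinuousLinearMap.fst ℂ P X)))
    ((ContinuousLinearMap.fst ℂ P X).prod
      (ContinuousLinearMap.snd ℂ P X + K.comp (ContinuousLinearMap.fst ℂ P X)))
    (fun x => by simp) (fun x => by simp)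

/-- At `(s, s)` the coefficient of `N` vanishes, so the derivative of the equation in the unknown is
the identity whatever `N` is. The map `(p, v) ↦ (p, v - D p - (p₁ - p₂) N v)` then has a shear as
derivative and the analytic inverse function theorem applies. The uniqueness clause is used later to
compare different squares. -/
theorem exists_analytic_fixedPoint [CompleteSpace X] {D : ℂ × ℂ → X} {N : X → X} {s : ℂ}
    (hD : ContDiffAt ℂ ω D (s, s)) (hN : ContDiffAt ℂ ω N (D (s, s))) :
    ∃ U : ℂ × ℂ → X, ContDiffAt ℂ ω U (s, s) ∧ U (s, s) = D (s, s) ∧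
      (∀ᶠ p in 𝓝 (s, s), U p = D p + (p.1 - p.2) • N (U p)) ∧
      ∀ᶠ q in 𝓝 ((s, s), D (s, s)), q.2 = D q.1 + (q.1.1 - q.1.2) • N q.2 → q.2 = U q.1 := by
  set q₀ : (ℂ × ℂ) × X := ((s, s), D (s, s)) with hq₀
  let Θ : (ℂ × ℂ) × X → (ℂ × ℂ) × X :=
    fun q => (q.1, q.2 - (D q.1 + (q.1.1 - q.1.2) • N q.2))
  have hDq : ContDiffAt ℂ ω (fun q : (ℂ × ℂ) × X => D q.1) q₀ := hD.comp q₀ contDiffAt_fst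
  have hNq : ContDiffAt ℂ ω (fun q : (ℂ × ℂ) × X => N q.2) q₀ := hN.comp q₀ contDiffAt_snd
  have hΘ : ContDiffAt ℂ ω Θ q₀ := by
    refine contDiffAt_fst.prodMk (contDiffAt_snd.sub (hDq.add (ContDiffAt.smul ?_ hNq)))
    fun_prop
  let K : (ℂ × ℂ) →L[ℂ] X := fderiv ℂ D (s, s) +
    (ContinuousLinearMap.fst ℂ ℂ ℂ - ContinuousLinearMap.snd ℂ ℂ ℂ).smulRight (N (D (s, s)))
  have hω : (ω : WithTop ℕ∞) ≠ 0 := by simp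
  have hΘ' : HasFDerivAt Θ (shearEquiv K : ((ℂ × ℂ) × X) →L[ℂ] (ℂ × ℂ) × X) q₀ := by
    have h1 : HasFDerivAt (fun q : (ℂ × ℂ) × X => q.1) (ContinuousLinearMap.fst ℂ (ℂ × ℂ) X) q₀ :=
      hasFDerivAt_fst
    have h2 : HasFDerivAt (fun q : (ℂ × ℂ) × X => q.2) (ContinuousLinearMap.snd ℂ (ℂ × ℂ) X) q₀ :=
      hasFDerivAt_snd
    have h3 := (hD.differentiableAt hω).hasFDerivAt.comp q₀ h1
    have h4 := (hN.differentiableAt hω).hasFDerivAt.comp q₀ h2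
    have h5 : HasFDerivAt (fun q : (ℂ × ℂ) × X => q.1.1 - q.1.2)
        ((ContinuousLinearMap.fst ℂ ℂ ℂ - ContinuousLinearMap.snd ℂ ℂ ℂ).comp
          (ContinuousLinearMap.fst ℂ (ℂ × ℂ) X)) q₀ :=
      (hasFDerivAt_fst.comp q₀ h1).sub (hasFDerivAt_snd.comp q₀ h1)
    have h6 := h1.prodMk (h2.sub (h3.add (h5.smul h4)))
    refine h6.congr_fderiv ?_
    ext x <;> simp [shearEquiv, K, hq₀, sub_eq_add_neg]
  have hq₁ : Θ q₀ = ((s, s), 0) := by simp [Θ, hq₀]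
  set Λ := hΘ.localInverse hΘ' hω with hΛ
  have hΛc : ContDiffAt ℂ ω Λ ((s, s), 0) := hq₁ ▸ hΘ.to_localInverse hΘ' hω
  have hΛ0 : Λ ((s, s), 0) = q₀ := hq₁ ▸ hΘ.localInverse_apply_image hΘ' hω
  have hr : ∀ᶠ y in 𝓝 ((s, s), (0 : X)), Θ (Λ y) = y :=
    hq₁ ▸ (hΘ.hasStrictFDerivAt' hΘ' hω).eventually_right_inverse
  have hl : ∀ᶠ q in 𝓝 q₀, Λ (Θ q) = q := (hΘ.hasStrictFDerivAt' hΘ' hω).eventually_left_inverse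
  have hin : ContDiffAt ℂ ω (fun p : ℂ × ℂ => (p, (0 : X))) (s, s) :=
    contDiffAt_id.prodMk contDiffAt_const
  refine ⟨fun p => (Λ (p, 0)).2, ?_, ?_, ?_, ?_⟩
  · exact contDiffAt_snd.comp (s, s) (ContDiffAt.comp (s, s) hΛc hin)
  · simp [hΛ0, hq₀]
  · filter_upwards [hin.continuousAt.eventually hr] with p hp
    have e1 : (Λ (p, 0)).1 = p := congrArg Prod.fst hp
    have e2 := congrArg Prod.snd hp
    simp only [Θ, e1] at e2
    exact sub_eq_zero.1 e2
  · filter_upwards [hl] with q hq heq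
    have : Θ q = (q.1, 0) := by
      simp only [Θ]
      rw [← heq, sub_self]
    rw [this] at hq
    exact (congrArg Prod.snd hq).symm

end FixedPoint

/-! ### Power series in the algebra of continuous functions on a square -/

section Square

/-- The closed unit square. -/
abbrev Square : Type := unitInterval × unitInterval

/-- The Banach algebra of continuous functions on the unit square. -/
abbrev SqAlg : Type := C(Square, ℂ)

/-- A scalar power series with geometrically bounded coefficients is analytic on every such Banach
algebra. It is used for `ℂ` and for `SqAlg` with the same coefficients. -/
theorem contDiffAt_ofScalarsSum {A : Type*} [NormedCommRing A] [NormedAlgebra ℂ A]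
    [NormOneClass A] [CompleteSpace A] {d : ℕ → ℂ} {C r : ℝ} (hr : 0 < r)
    (hd : ∀ n, ‖d n‖ ≤ C / r ^ n) :
    ContDiffAt ℂ ω (FormalMultilinearSeries.ofScalarsSum (E := A) d) 0 ∧
      ∀ᶠ g in 𝓝 (0 : A),
        HasSum (fun n => d n • g ^ n) (FormalMultilinearSeries.ofScalarsSum (E := A) d g) := by
  set p := FormalMultilinearSeries.ofScalars A d with hp
  have hrad : 0 < p.radius := by
    lift r to NNReal using hr.le
    have h := p.le_radius_of_bound C (r := r) fun n => by
      rw [hp, FormalMultilinearSeries.ofScalars_norm]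
      have := hd n
      rwa [le_div_iff₀ (by positivity)] at this
    exact lt_of_lt_of_le (by exact_mod_cast hr) h
  refine ⟨(p.hasFPowerSeriesOnBall hrad).hasFPowerSeriesAt.analyticAt.contDiffAt, ?_⟩
  filter_upwards [Metric.eball_mem_nhds (0 : A) hrad] with g hg
  have := p.hasSum hg
  simp_rw [hp, FormalMultilinearSeries.ofScalars_apply_eq] at this
  exact this

/-- Insert complex numbers, or continuous functions on the square, into the Taylor series of `f` at
`s`. Evaluation at a point is continuous and linear and respects powers, so it passes through the
series. This makes the initial data analytic in the parameter as an element of `SqAlg`. -/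
theorem exists_series_extension {f : ℝ → ℂ} {s : ℝ} (hf : AnalyticAt ℝ f s) :
    ∃ (e : ℂ → ℂ) (e' : SqAlg → SqAlg), ContDiffAt ℂ ω e' 0 ∧
      (∀ᶠ g in 𝓝 (0 : SqAlg), ∀ t, e' g t = e (g t)) ∧ AnalyticAt ℂ e 0 ∧
      ∀ᶠ t : ℝ in 𝓝 s, f t = e ((t : ℂ) - s) := by
  obtain ⟨p, hp⟩ := hf
  have hrad := hp.radius_pos
  obtain ⟨r, hr0, hr⟩ := ENNReal.lt_iff_exists_nnreal_btwn.1 hrad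
  have hr0' : 0 < r := by exact_mod_cast hr0
  obtain ⟨C, -, hC⟩ := p.norm_le_div_pow_of_pos_of_lt_radius hr0' hr
  set d : ℕ → ℂ := fun n => p.coeff n with hd
  have hdb : ∀ n, ‖d n‖ ≤ C / (r : ℝ) ^ n := fun n => by
    simpa [hd] using hC n
  obtain ⟨hA1, hA2⟩ := contDiffAt_ofScalarsSum (A := SqAlg) (NNReal.coe_pos.2 hr0') hdb
  obtain ⟨hB1, hB2⟩ := contDiffAt_ofScalarsSum (A := ℂ) (NNReal.coe_pos.2 hr0') hdb
  refine ⟨FormalMultilinearSeries.ofScalarsSum (E := ℂ) d,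
    FormalMultilinearSeries.ofScalarsSum (E := SqAlg) d, hA1, ?_, hB1.analyticAt, ?_⟩
  · filter_upwards [hA2] with g hg t
    have h := (ContinuousMap.evalCLM ℂ t).hasSum hg
    have h2 := h.tsum_eq
    simp only [ContinuousMap.evalCLM_apply] at h2
    rw [← h2, FormalMultilinearSeries.ofScalars_sum_eq]
    simp
  · have hcont : Tendsto (fun t : ℝ => (t : ℂ) - s) (𝓝 s) (𝓝 0) := by
      have : Continuous fun t : ℝ => (t : ℂ) - s := by fun_prop
      simpa using this.tendsto s
    filter_upwards [hp.eventually_hasSum_sub, hcont.eventually hB2] with t ht ht2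
    refine ht.unique ?_
    convert! ht2 using 2 with n
    rw [FormalMultilinearSeries.apply_eq_pow_smul_coeff, smul_eq_mul, mul_comm,
      ← Complex.ofReal_sub, ← Complex.ofReal_pow, Complex.real_smul]

/-- The function of `t` obtained from `g` by freezing the first variable. -/
def sliceFun (g : SqAlg) (σ : unitInterval) (t : ℝ) : ℂ := g (σ, projIcc 0 1 zero_le_one t)

theorem continuous_sliceFun (g : SqAlg) (σ : unitInterval) : Continuous (sliceFun g σ) := by
  unfold sliceFun
  exact g.continuous.comp (continuous_const.prodMk continuous_projIcc)

/-- The primitive `(σ, τ) ↦ ∫_σ^τ g(σ, t) dt` as a continuous function. -/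
def primitiveMap (g : SqAlg) : SqAlg where
  toFun p := ∫ t in (p.1 : ℝ)..p.2, sliceFun g p.1 t
  continuous_toFun := by
    have hc : Continuous (Function.uncurry fun (p : Square) t => sliceFun g p.1 t) := by
      unfold sliceFun Function.uncurry
      exact g.continuous.comp ((continuous_fst.comp continuous_fst).prodMk
        (continuous_projIcc.comp continuous_snd))
    have h1 := intervalIntegral.continuous_parametric_intervalIntegral_of_continuous
      (μ := volume) (a₀ := 0) hc
      (s := fun p : Square => (p.2 : ℝ)) (by fun_prop)
    have h2 := intervalIntegral.continuous_parametric_intervalIntegral_of_continuous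
      (μ := volume) (a₀ := 0) hc
      (s := fun p : Square => (p.1 : ℝ)) (by fun_prop)
    refine (h1.sub h2).congr fun p => ?_
    exact intervalIntegral.integral_interval_sub_left
      ((continuous_sliceFun g p.1).intervalIntegrable _ _)
      ((continuous_sliceFun g p.1).intervalIntegrable _ _)

/-- `primitiveMap` as a continuous linear map. -/
def primitiveCLM : SqAlg →L[ℂ] SqAlg :=
  LinearMap.mkContinuous
    { toFun := primitiveMap
      map_add' := fun f g => by
        ext p
        exact intervalIntegral.integral_add ((continuous_sliceFun f p.1).intervalIntegrable _ _)
          ((continuous_sliceFun g p.1).intervalIntegrable _ _)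
      map_smul' := fun c f => by
        ext p
        exact intervalIntegral.integral_smul c _ } 1 (fun g => by
    rw [one_mul, ContinuousMap.norm_le _ (norm_nonneg g)]
    intro p
    have h := intervalIntegral.norm_integral_le_of_norm_le_const (a := (p.1 : ℝ)) (b := p.2)
      (f := sliceFun g p.1) (C := ‖g‖) fun t _ => g.norm_coe_le_norm _
    refine h.trans (mul_le_of_le_one_right (norm_nonneg g) ?_)
    rw [abs_le]
    constructor <;> linarith [p.1.2.1, p.1.2.2, p.2.2.1, p.2.2.2])

theorem primitiveCLM_apply (g : SqAlg) (p : Square) :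
    primitiveCLM g p = ∫ t in (p.1 : ℝ)..p.2, sliceFun g p.1 t := rfl

/-- Composition with the reflection in the diagonal. -/
def swapCLM : SqAlg →L[ℂ] SqAlg :=
  ContinuousLinearMap.mk
    { toFun := fun g => g.comp ⟨Prod.swap, continuous_swap⟩
      map_add' := fun _ _ => rfl
      map_smul' := fun _ _ => rfl } (ContinuousMap.continuous_precomp _)

theorem swapCLM_apply (g : SqAlg) (p : Square) : swapCLM g p = g (p.2, p.1) := rfl

/-- The convex combination `(1 - θ) τ + θ σ`. -/
def mixI (r : Square) (θ : unitInterval) : unitInterval :=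
  ⟨r.2 + (r.1 - r.2) * θ, by
    have h1 := r.1.2.1; have h2 := r.1.2.2; have h3 := r.2.2.1; have h4 := r.2.2.2
    have h5 := θ.2.1; have h6 := θ.2.2
    constructor <;> nlinarith⟩

theorem continuous_mixI (r : Square) : Continuous (mixI r) := by
  unfold mixI
  fun_prop

/-- The affine map of the square to itself which sends its diagonal to the segment of the
diagonal from `(τ, τ)` to `(σ, σ)`. -/
def mixSq (r : Square) : C(Square, Square) where
  toFun p := (mixI r p.1, mixI r p.2)
  continuous_toFun := by
    have := continuous_mixI r
    fun_prop

/-- The affine substitution `t ↦ τ + (σ - τ) t`. The factor `σ - τ` is the ratio between the side of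
the small square and that of the large one. -/
theorem primitiveCLM_comp_mixSq (g : SqAlg) (r p : Square) :
    ((r.1 : ℝ) - r.2 : ℂ) * primitiveCLM (g.comp (mixSq r)) p = primitiveCLM g (mixSq r p) := by
  rw [primitiveCLM_apply, primitiveCLM_apply]
  have h := intervalIntegral.smul_integral_comp_add_mul (a := (p.1 : ℝ)) (b := p.2)
    (sliceFun g (mixI r p.1)) ((r.1 : ℝ) - r.2) r.2
  rw [Complex.real_smul] at h
  push_cast at h
  refine Eq.trans ?_ h
  congr 1
  refine intervalIntegral.integral_congr fun t ht => ?_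
  have ht' : t ∈ Icc (0 : ℝ) 1 := by
    refine (uIcc_subset_Icc p.1.2 p.2.2) ht
  simp only [sliceFun, ContinuousMap.comp_apply]
  congr 1
  simp only [mixSq, ContinuousMap.coe_mk]
  congr 1
  rw [projIcc_of_mem zero_le_one ht']
  exact (projIcc_val zero_le_one (mixI r ⟨t, ht'⟩)).symm

end Square

/-! ### The complexified Cauchy problem -/

section Complexified

/-- The derivative `φ̇_k` of the weight, in an arbitrary algebra. -/
def speed (k : ℝ) {R : Type*} [CommRing R] [Algebra ℂ R] (c : R) : R :=
  open Classical in if k = 1 then 1 else ((2 / (k - 1) : ℝ) : ℂ) • Ring.inverse c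

/-- The right-hand side of the equation `ψ_ζζ̄ = (φ̇/2) (⟨ψ_ζ, ψ_ζ̄⟩ e₃ - ψ³_ζ̄ ψ_ζ - ψ³_ζ ψ_ζ̄)` of
conformal `[φ, e₃]`-minimal surfaces, in an arbitrary algebra. -/
def force {R : Type*} [CommRing R] [Algebra ℂ R] (q : R) (a b : Fin 3 → R) (j : Fin 3) : R :=
  (2⁻¹ : ℂ) • (q * ((if j = 2 then ∑ i, a i * b i else 0) - b 2 * a j - a 2 * b j))

/-- The state space: three vectors `ψ_ζ`, `ψ_ζ̄`, `ψ` with entries in an algebra. -/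
abbrev State (R : Type*) : Type _ := Fin 3 × Fin 3 → R

/-- `force` as a function of the state. -/
def stateForce (k : ℝ) {R : Type*} [CommRing R] [Algebra ℂ R] (U : State R) (j : Fin 3) : R :=
  force (speed k (U (2, 2))) (fun i => U (0, i)) (fun i => U (1, i)) j

theorem inverse_apply {c : SqAlg} (hc : IsUnit c) (t : Square) :
    Ring.inverse c t = Ring.inverse (c t) := by
  have h := congrArg (fun g : SqAlg => g t) (Ring.inverse_mul_cancel c hc)
  simp only [ContinuousMap.mul_apply, ContinuousMap.one_apply] at h
  rw [Ring.inverse_eq_inv']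
  exact eq_inv_of_mul_eq_one_left h

theorem speed_apply {k : ℝ} {c : SqAlg} (hc : k ≠ 1 → IsUnit c) (t : Square) :
    speed k c t = speed k (c t) := by
  unfold speed
  split_ifs with h
  · rfl
  · rw [ContinuousMap.smul_apply, inverse_apply (hc h)]

theorem stateForce_apply {k : ℝ} {U : State SqAlg} (hU : k ≠ 1 → IsUnit (U (2, 2))) (j : Fin 3)
    (t : Square) : stateForce k U j t = stateForce k (fun i => U i t) j := by
  unfold stateForce force
  rw [ContinuousMap.smul_apply, ContinuousMap.mul_apply, speed_apply hU]
  split_ifs <;> simp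

/-- `Ring.inverse` is analytic at units, which is why `speed` is phrased with it rather than with a
pointwise inverse. -/
theorem contDiffAt_speed {k : ℝ} {c : SqAlg} (hc : k ≠ 1 → IsUnit c) :
    ContDiffAt ℂ ω (speed k : SqAlg → SqAlg) c := by
  unfold speed
  split_ifs with h
  · exact contDiffAt_const
  · obtain ⟨v, rfl⟩ := hc h
    exact (contDiffAt_ringInverse ℂ v).const_smul _

theorem contDiffAt_stateForce {k : ℝ} {U : State SqAlg} (hU : k ≠ 1 → IsUnit (U (2, 2)))
    (j : Fin 3) : ContDiffAt ℂ ω (fun U : State SqAlg => stateForce k U j) U := by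
  have hp : ∀ i, ContDiffAt ℂ ω (fun U : State SqAlg => U i) U := fun i =>
    (contDiff_apply ℂ SqAlg i).contDiffAt
  have hs : ContDiffAt ℂ ω (fun U : State SqAlg => speed k (U (2, 2))) U :=
    ContDiffAt.comp (g := speed k) U (contDiffAt_speed hU) (hp (2, 2))
  unfold stateForce force
  refine ContDiffAt.const_smul _ (ContDiffAt.mul ?_ (((?_ : ContDiffAt _ _ _ _).sub
    ((hp _).mul (hp _))).sub ((hp _).mul (hp _))))
  · exact hs
  · split_ifs
    · exact ContDiffAt.sum fun i _ => (hp _).mul (hp _)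
    · exact contDiffAt_const

/-- The integral operator of the complexified Cauchy problem. -/
def pathOp (k : ℝ) (U : State SqAlg) (i : Fin 3 × Fin 3) : SqAlg :=
  if i.1 = 0 then primitiveCLM (stateForce k U i.2)
  else if i.1 = 1 then swapCLM (primitiveCLM (swapCLM (stateForce k U i.2)))
  else primitiveCLM (U (1, i.2))

theorem contDiffAt_pathOp {k : ℝ} {U : State SqAlg} (hU : k ≠ 1 → IsUnit (U (2, 2))) :
    ContDiffAt ℂ ω (pathOp k) U := by
  rw [contDiffAt_pi]
  intro i
  unfold pathOp
  split_ifs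
  · exact primitiveCLM.contDiff.contDiffAt.comp U (contDiffAt_stateForce hU _)
  · exact swapCLM.contDiff.contDiffAt.comp U (primitiveCLM.contDiff.contDiffAt.comp U
      (swapCLM.contDiff.contDiffAt.comp U (contDiffAt_stateForce hU _)))
  · exact primitiveCLM.contDiff.contDiffAt.comp U (contDiff_apply ℂ SqAlg _).contDiffAt

/-- The parametrization of the square with corners given by `p`. -/
def paramPt (p : ℂ × ℂ) (θ : unitInterval) : ℂ := p.2 + (p.1 - p.2) * θ

/-- The first (if `b` is false) or second coordinate in the square, minus `s`. -/
def paramFun (s : ℂ) (b : Prop) (p : ℂ × ℂ) : SqAlg :=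
  (p.2 - s) • (1 : SqAlg) + (p.1 - p.2) •
    (open Classical in if b then (⟨fun r => ((r.2 : ℝ) : ℂ), by fun_prop⟩ : SqAlg)
      else ⟨fun r => ((r.1 : ℝ) : ℂ), by fun_prop⟩)

theorem paramFun_apply (s : ℂ) (b : Prop) [Decidable b] (p : ℂ × ℂ) (r : Square) :
    paramFun s b p r = paramPt p (if b then r.2 else r.1) - s := by
  unfold paramFun paramPt
  split_ifs <;> simp <;> ring

/-- A subsegment of a segment is parametrized by the composed affine map. Together with
`primitiveCLM_comp_mixSq` this makes the integral equation invariant under passing to subsquares. -/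
theorem paramPt_mixI (p : ℂ × ℂ) (r : Square) (θ : unitInterval) :
    paramPt (paramPt p r.1, paramPt p r.2) θ = paramPt p (mixI r θ) := by
  simp only [paramPt, mixI]
  push_cast
  ring

theorem paramPt_mem_ball {p : ℂ × ℂ} {s : ℂ} {δ : ℝ} (hp : p ∈ Metric.ball (s, s) δ)
    (θ : unitInterval) : paramPt p θ ∈ Metric.ball s δ := by
  rw [Metric.mem_ball, Prod.dist_eq, max_lt_iff] at hp
  have := (convex_ball s δ) (Metric.mem_ball.2 hp.1) (Metric.mem_ball.2 hp.2)
    (a := θ) (b := 1 - θ) θ.2.1 (by linarith [θ.2.2]) (by ring)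
  convert! this using 1
  simp only [paramPt, Complex.real_smul]
  push_cast
  ring

/-- Put `u_p(σ, τ) = u(p₂ + (p₁ - p₂)σ, p₂ + (p₁ - p₂)τ)`. Integrating the system from the diagonal
turns it into `u_p = D p + (p₁ - p₂) pathOp u_p` on the fixed square, which is solved
holomorphically in `p`. The solution of the system is then read off at the corner `(1, 0)`. -/
theorem exists_complexified (k : ℝ) (f : Fin 3 × Fin 3 → ℝ → ℂ) (s : ℝ)
    (hf : ∀ i, AnalyticAt ℝ (f i) s) (hc : k ≠ 1 → f (2, 2) s ≠ 0) :
    ∃ u : ℂ × ℂ → State ℂ, ContDiffAt ℂ ω u ((s : ℂ), (s : ℂ)) ∧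
      (∀ᶠ t : ℝ in 𝓝 s, u (t, t) = fun i => f i t) ∧
      ∀ᶠ p in 𝓝 ((s : ℂ), (s : ℂ)), ∀ j,
        fderiv ℂ u p (0, 1) (0, j) = stateForce k (u p) j ∧
        fderiv ℂ u p (1, 0) (1, j) = stateForce k (u p) j ∧
        fderiv ℂ u p (0, 1) (2, j) = u p (1, j) := by
  choose e e' he' hev he hfe using fun i => exists_series_extension (hf i)
  -- The datum is taken at the diagonal end of the segment of integration: it depends on the second
  -- coordinate for the components integrated horizontally, and on the first coordinate for the
  -- others.
  set D : ℂ × ℂ → State SqAlg := fun p i => e' i (paramFun s (i.1 = 1) p) with hD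
  have hpar0 : ∀ b, paramFun (s : ℂ) b ((s : ℂ), (s : ℂ)) = 0 := fun b => by
    unfold paramFun
    ext r
    split_ifs <;> simp
  have hparc : ∀ b, ContDiff ℂ ω (paramFun (s : ℂ) b) := fun b => by
    unfold paramFun
    fun_prop
  have hDc : ContDiffAt ℂ ω D ((s : ℂ), (s : ℂ)) := by
    rw [contDiffAt_pi]
    intro i
    refine ContDiffAt.comp _ ?_ (hparc _).contDiffAt
    rw [hpar0]
    exact he' i
  have hDp : ∀ᶠ p in 𝓝 ((s : ℂ), (s : ℂ)), ∀ i r,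
      D p i r = e i (paramPt p (if i.1 = 1 then r.2 else r.1) - s) := by
    rw [eventually_all]
    intro i
    have hcont : Tendsto (paramFun (s : ℂ) (i.1 = 1)) (𝓝 ((s : ℂ), (s : ℂ))) (𝓝 0) := by
      have := (hparc (i.1 = 1)).continuous.tendsto ((s : ℂ), (s : ℂ))
      rwa [hpar0] at this
    filter_upwards [hcont.eventually (hev i)] with p hp r
    rw [← paramFun_apply]
    exact hp r
  have hes : ∀ i, e i 0 = f i s := fun i => by
    rw [(hfe i).self_of_nhds, sub_self]
  have hD0 : ∀ i r, D ((s : ℂ), (s : ℂ)) i r = f i s := by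
    intro i r
    rw [hDp.self_of_nhds, ← hes]
    congr 1
    simp [paramPt]
  have hunit : k ≠ 1 → IsUnit (D ((s : ℂ), (s : ℂ)) (2, 2)) := by
    intro hk
    have : D ((s : ℂ), (s : ℂ)) (2, 2) = algebraMap ℂ SqAlg (f (2, 2) s) := by
      ext r
      rw [hD0]
      rfl
    rw [this]
    exact (IsUnit.mk0 _ (hc hk)).map (algebraMap ℂ SqAlg)
  obtain ⟨U, hUc, hU0, hUeq, hUuniq⟩ :=
    exists_analytic_fixedPoint hDc (contDiffAt_pathOp hunit)
  have hUnear : ∀ᶠ V in 𝓝 (D ((s : ℂ), (s : ℂ))), k ≠ 1 → IsUnit (V (2, 2)) := by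
    by_cases hk : k = 1
    · simp [hk]
    · have hcont : ContinuousAt (fun V : State SqAlg => V (2, 2)) (D ((s : ℂ), (s : ℂ))) :=
        (continuous_apply _).continuousAt
      filter_upwards [hcont.eventually (Units.isOpen.mem_nhds (hunit hk))] with V hV _
      exact hV
  obtain ⟨ρ₁, hρ₁, huniq⟩ := Metric.eventually_nhds_iff_ball.1 hUuniq
  obtain ⟨ρ₂, hρ₂, hunits⟩ := Metric.eventually_nhds_iff_ball.1 hUnear
  set ρ := min ρ₁ ρ₂ with hρ
  have hρ0 : 0 < ρ := lt_min hρ₁ hρ₂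
  have hUcl : ∀ᶠ p in 𝓝 ((s : ℂ), (s : ℂ)), dist (U p) (D ((s : ℂ), (s : ℂ))) < ρ := by
    have := hUc.continuousAt
    rw [ContinuousAt, hU0] at this
    exact this.eventually (Metric.ball_mem_nhds _ hρ0)
  -- `paramPt p` sends `1` to `p.1` and `0` to `p.2`, so the corner `(1, 0)` corresponds to the
  -- point `p` itself.
  set u : ℂ × ℂ → State ℂ := fun p i => U p i (1, 0) with hu
  have huc : ContDiffAt ℂ ω u ((s : ℂ), (s : ℂ)) := by
    rw [contDiffAt_pi]
    intro i
    exact ((ContinuousMap.evalCLM ℂ ((1, 0) : Square)).contDiff.contDiffAt.comp _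
      (contDiffAt_pi.1 hUc i))
  obtain ⟨δ₁, hδ₁, hball₁⟩ := Metric.eventually_nhds_iff_ball.1 ((hDp.and hUeq).and
    (hUcl.and (huc.eventually (by simp))))
  set δ := min δ₁ ρ₁ with hδ
  have hδ0 : 0 < δ := lt_min hδ₁ hρ₁
  have hball := fun p (hp : p ∈ Metric.ball ((s : ℂ), (s : ℂ)) δ) =>
    hball₁ p (Metric.ball_subset_ball (min_le_left _ _) hp)
  have hpt : ∀ p ∈ Metric.ball ((s : ℂ), (s : ℂ)) δ, ∀ r : Square,
      (paramPt p r.1, paramPt p r.2) ∈ Metric.ball ((s : ℂ), (s : ℂ)) δ := by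
    intro p hp r
    rw [Metric.mem_ball, Prod.dist_eq, max_lt_iff]
    exact ⟨paramPt_mem_ball hp r.1, paramPt_mem_ball hp r.2⟩
  -- self-similarity of the fixed points
  have hself : ∀ p ∈ Metric.ball ((s : ℂ), (s : ℂ)) δ, ∀ r : Square, ∀ i,
      U (paramPt p r.1, paramPt p r.2) i = (U p i).comp (mixSq r) := by
    intro p hp r
    obtain ⟨⟨hDp1, hUp⟩, hUd, -⟩ := hball p hp
    set p' : ℂ × ℂ := (paramPt p r.1, paramPt p r.2) with hp'
    have hp'm : p' ∈ Metric.ball ((s : ℂ), (s : ℂ)) δ := hpt p hp r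
    obtain ⟨⟨hDp', -⟩, -, -⟩ := hball p' hp'm
    set V : State SqAlg := fun i => (U p i).comp (mixSq r) with hV
    have hVd : dist V (D ((s : ℂ), (s : ℂ))) < ρ := by
      refine lt_of_le_of_lt ?_ hUd
      rw [dist_pi_le_iff dist_nonneg]
      intro i
      rw [ContinuousMap.dist_le dist_nonneg]
      intro t
      rw [hD0, ← hD0 i (mixSq r t)]
      exact (ContinuousMap.dist_apply_le_dist (mixSq r t)).trans (dist_le_pi_dist _ _ i)
    have hunU := hunits (U p) (Metric.mem_ball.2 (hUd.trans_le (min_le_right _ _)))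
    have hunV := hunits V (Metric.mem_ball.2 (hVd.trans_le (min_le_right _ _)))
    have hsf : ∀ j, stateForce k V j = (stateForce k (U p) j).comp (mixSq r) := by
      intro j
      ext t
      rw [stateForce_apply hunV, ContinuousMap.comp_apply, stateForce_apply hunU]
      rfl
    have hdiff : p'.1 - p'.2 = (p.1 - p.2) * ((r.1 : ℝ) - (r.2 : ℝ) : ℂ) := by
      simp only [hp', paramPt]; ring
    -- The restriction of a fixed point to a subsquare solves the equation of that subsquare: the
    -- ratio produced by rescaling the integrals turns `p.1 - p.2` into `p'.1 - p'.2`. It is no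
    -- farther from the base state than `U p`, so local uniqueness applies.
    have hfix : V = D p' + (p'.1 - p'.2) • pathOp k V := by
      ext i t
      have h1 := congrArg (fun W : State SqAlg => W i (mixSq r t)) hUp
      simp only [Pi.add_apply, Pi.smul_apply, ContinuousMap.add_apply,
        ContinuousMap.smul_apply, smul_eq_mul] at h1 ⊢
      have h2 : D p i (mixSq r t) = D p' i t := by
        rw [hDp1, hDp']
        congr 2
        split_ifs
        · exact (paramPt_mixI p r t.2).symm
        · exact (paramPt_mixI p r t.1).symm
      have h3 : pathOp k (U p) i (mixSq r t) = ((r.1 : ℝ) - (r.2 : ℝ) : ℂ) * pathOp k V i t := by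
        unfold pathOp
        split_ifs with hi0 hi1
        · rw [hsf]
          exact (primitiveCLM_comp_mixSq _ r t).symm
        · rw [hsf, swapCLM_apply, swapCLM_apply]
          exact (primitiveCLM_comp_mixSq (swapCLM (stateForce k (U p) i.2)) r (t.2, t.1)).symm
        · exact (primitiveCLM_comp_mixSq _ r t).symm
      calc V i t = U p i (mixSq r t) := rfl
        _ = _ := by rw [h1, h2, h3, hdiff]; ring
    have hVU := huniq (p', V) (by
      rw [Metric.mem_ball, Prod.dist_eq, max_lt_iff]
      exact ⟨(Metric.mem_ball.1 hp'm).trans_le (min_le_right _ _),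
        hVd.trans_le (min_le_left _ _)⟩) hfix
    intro i
    exact (congrFun hVU i).symm
  have hval : ∀ p ∈ Metric.ball ((s : ℂ), (s : ℂ)) δ, ∀ r : Square, ∀ i,
      u (paramPt p r.1, paramPt p r.2) i = U p i r := by
    intro p hp r i
    simp only [hu]
    rw [hself p hp r i, ContinuousMap.comp_apply]
    congr 1
    ext <;> simp [mixSq, mixI]
  -- Differentiate the integral equation along a segment at an interior point of the square. Both
  -- sides carry the factor `p.1 - p.2`, which is cancelled; this needs a nondegenerate square.
  have hder : ∀ p ∈ Metric.ball ((s : ℂ), (s : ℂ)) δ, p.1 ≠ p.2 → ∀ r : Square,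
      0 < (r.1 : ℝ) → (r.1 : ℝ) < 1 → 0 < (r.2 : ℝ) → (r.2 : ℝ) < 1 → ∀ j,
        fderiv ℂ u (paramPt p r.1, paramPt p r.2) (0, 1) (0, j)
          = stateForce k (u (paramPt p r.1, paramPt p r.2)) j ∧
        fderiv ℂ u (paramPt p r.1, paramPt p r.2) (1, 0) (1, j)
          = stateForce k (u (paramPt p r.1, paramPt p r.2)) j ∧
        fderiv ℂ u (paramPt p r.1, paramPt p r.2) (0, 1) (2, j)
          = u (paramPt p r.1, paramPt p r.2) (1, j) := by
    intro p hp hne r h10 h11 h20 h21 j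
    obtain ⟨⟨hDp1, hUp⟩, hUd, -⟩ := hball p hp
    obtain ⟨-, -, hup'⟩ := hball _ (hpt p hp r)
    have hunU := hunits (U p) (Metric.mem_ball.2 (hUd.trans_le (min_le_right _ _)))
    have hdu := (hup'.differentiableAt (by simp)).hasFDerivAt
    have hsfu : ∀ j, stateForce k (U p) j r
        = stateForce k (u (paramPt p r.1, paramPt p r.2)) j := by
      intro j
      rw [stateForce_apply hunU]
      congr 1
      ext i
      exact (hval p hp r i).symm
    have hne' : p.1 - p.2 ≠ 0 := sub_ne_zero.2 hne
    have hproj : ∀ θ : unitInterval, projIcc 0 1 zero_le_one (θ : ℝ) = θ := projIcc_val _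
    -- derivative along a vertical or horizontal segment
    have hline : ∀ (v w : ℂ × ℂ) (i : Fin 3 × Fin 3) (θ : ℝ),
        v + (θ : ℂ) • w = (paramPt p r.1, paramPt p r.2) →
        HasDerivAt (fun x : ℝ => u (v + (x : ℂ) • w) i)
          (fderiv ℂ u (paramPt p r.1, paramPt p r.2) w i) θ := by
      intro v w i θ hvw
      have h1 : HasDerivAt (fun x : ℝ => v + (x : ℂ) • w) w θ := by
        have := (Complex.ofRealCLM.hasDerivAt (x := θ)).smul_const w
        simpa using this.const_add v
      have h2 := (hvw ▸ hdu).restrictScalars ℝ |>.comp_hasDerivAt θ h1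
      rw [← hvw]
      simpa using (hasDerivAt_pi.1 h2 i)
    have hvert : ∀ (i : Fin 3 × Fin 3) (g : SqAlg), i.1 ≠ 1 → pathOp k (U p) i = primitiveCLM g →
        fderiv ℂ u (paramPt p r.1, paramPt p r.2) (0, 1) i = g r := by
      intro i g hi hg
      have h1 := hline (paramPt p r.1, p.2) (0, p.1 - p.2) i r.2 (by
        simp [paramPt, mul_comm])
      have hprim : HasDerivAt (fun τ : ℝ => ∫ t in (r.1 : ℝ)..τ, sliceFun g r.1 t)
          (g r) r.2 := by
        have := (continuous_sliceFun g r.1).integral_hasStrictDerivAt (r.1 : ℝ) (r.2 : ℝ)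
        simpa [sliceFun, hproj] using this.hasDerivAt
      have h2 : HasDerivAt (fun x : ℝ => u ((paramPt p r.1, p.2) + (x : ℂ) • (0, p.1 - p.2)) i)
          ((p.1 - p.2) * g r) r.2 := by
        refine ((hprim.const_mul (p.1 - p.2)).const_add
          (e i (paramPt p r.1 - s))).congr_of_eventuallyEq ?_
        filter_upwards [Ioo_mem_nhds h20 h21] with τ hτ
        have := hval p hp (r.1, ⟨τ, hτ.1.le, hτ.2.le⟩) i
        rw [show ((paramPt p r.1, p.2) + (τ : ℂ) • ((0 : ℂ), p.1 - p.2) : ℂ × ℂ)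
          = (paramPt p r.1, paramPt p ⟨τ, hτ.1.le, hτ.2.le⟩) by simp [paramPt, mul_comm], this,
          hUp]
        simp only [Pi.add_apply, Pi.smul_apply, ContinuousMap.add_apply,
          ContinuousMap.smul_apply, smul_eq_mul, hDp1, if_neg hi, hg, primitiveCLM_apply]
      have h3 := h1.unique h2
      rw [show ((0 : ℂ), p.1 - p.2) = (p.1 - p.2) • ((0 : ℂ), (1 : ℂ)) by simp, map_smul] at h3
      exact mul_left_cancel₀ hne' h3
    have hhor : ∀ (i : Fin 3 × Fin 3) (g : SqAlg), i.1 = 1 →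
        pathOp k (U p) i = swapCLM (primitiveCLM (swapCLM g)) →
        fderiv ℂ u (paramPt p r.1, paramPt p r.2) (1, 0) i = g r := by
      intro i g hi hg
      have h1 := hline (p.2, paramPt p r.2) (p.1 - p.2, 0) i r.1 (by
        simp [paramPt, mul_comm])
      have hprim : HasDerivAt (fun τ : ℝ => ∫ t in (r.2 : ℝ)..τ, sliceFun (swapCLM g) r.2 t)
          (g r) r.1 := by
        have := (continuous_sliceFun (swapCLM g) r.2).integral_hasStrictDerivAt (r.2 : ℝ) (r.1 : ℝ)
        simpa [sliceFun, hproj, swapCLM_apply] using this.hasDerivAt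
      have h2 : HasDerivAt (fun x : ℝ => u ((p.2, paramPt p r.2) + (x : ℂ) • (p.1 - p.2, 0)) i)
          ((p.1 - p.2) * g r) r.1 := by
        refine ((hprim.const_mul (p.1 - p.2)).const_add
          (e i (paramPt p r.2 - s))).congr_of_eventuallyEq ?_
        filter_upwards [Ioo_mem_nhds h10 h11] with τ hτ
        have := hval p hp (⟨τ, hτ.1.le, hτ.2.le⟩, r.2) i
        rw [show ((p.2, paramPt p r.2) + (τ : ℂ) • (p.1 - p.2, (0 : ℂ)) : ℂ × ℂ)
          = (paramPt p ⟨τ, hτ.1.le, hτ.2.le⟩, paramPt p r.2) by simp [paramPt, mul_comm], this,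
          hUp]
        simp only [Pi.add_apply, Pi.smul_apply, ContinuousMap.add_apply,
          ContinuousMap.smul_apply, smul_eq_mul, hDp1, if_pos hi, hg, primitiveCLM_apply,
          swapCLM_apply (primitiveCLM _)]
      have h3 := h1.unique h2
      rw [show (p.1 - p.2, (0 : ℂ)) = (p.1 - p.2) • ((1 : ℂ), (0 : ℂ)) by simp, map_smul] at h3
      exact mul_left_cancel₀ hne' h3
    refine ⟨?_, ?_, ?_⟩
    · rw [← hsfu]
      exact hvert (0, j) _ (by simp) (by simp [pathOp])
    · rw [← hsfu]
      exact hhor (1, j) _ rfl (by simp [pathOp])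
    · rw [hval p hp r (1, j)]
      exact hvert (2, j) _ (by simp) (by simp [pathOp])
  refine ⟨u, huc, ?_, ?_⟩
  · have hcont : Tendsto (fun t : ℝ => ((t : ℂ), (t : ℂ))) (𝓝 s) (𝓝 ((s : ℂ), (s : ℂ))) := by
      have : Continuous fun t : ℝ => ((t : ℂ), (t : ℂ)) := by fun_prop
      exact this.tendsto s
    filter_upwards [hcont.eventually (hDp.and hUeq), eventually_all.2 hfe] with t ht ht2
    ext i
    simp only [hu]
    rw [ht.2]
    simp only [sub_self, Pi.add_apply, Pi.smul_apply, ContinuousMap.add_apply,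
      ContinuousMap.smul_apply, smul_eq_mul, zero_mul, add_zero]
    rw [ht.1, ht2]
    congr 1
    simp [paramPt]
  · filter_upwards [Metric.ball_mem_nhds ((s : ℂ), (s : ℂ)) (by positivity : 0 < δ / 4)]
      with q hq
    rw [Metric.mem_ball, Prod.dist_eq, max_lt_iff] at hq
    obtain ⟨hq1, hq2⟩ := hq
    simp only [dist_eq_norm] at hq1 hq2
    -- Every `q` near the base point is an interior point of a nondegenerate square. A diagonal
    -- point is the midpoint of an auxiliary square; otherwise the segment from `q.2` to `q.1` is
    -- extended so that it becomes the middle third.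
    by_cases hne : q.1 = q.2
    · set p : ℂ × ℂ := (q.1 + (δ / 4 : ℝ), q.1 - (δ / 4 : ℝ)) with hp
      have hn : ‖((δ / 4 : ℝ) : ℂ)‖ = δ / 4 := by
        rw [Complex.norm_real, Real.norm_eq_abs, abs_of_pos (by positivity)]
      have hpm : p ∈ Metric.ball ((s : ℂ), (s : ℂ)) δ := by
        rw [Metric.mem_ball, Prod.dist_eq, max_lt_iff]
        simp only [dist_eq_norm, hp]
        constructor
        · rw [show q.1 + ((δ / 4 : ℝ) : ℂ) - s = (q.1 - s) + ((δ / 4 : ℝ) : ℂ) by ring]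
          linarith [norm_add_le (q.1 - s) ((δ / 4 : ℝ) : ℂ)]
        · rw [show q.1 - ((δ / 4 : ℝ) : ℂ) - s = (q.1 - s) - ((δ / 4 : ℝ) : ℂ) by ring]
          linarith [norm_sub_le (q.1 - s) ((δ / 4 : ℝ) : ℂ)]
      have hpne : p.1 ≠ p.2 := by
        intro h
        have h2 : ((δ / 4 : ℝ) : ℂ) = 0 := by
          simp only [hp] at h
          linear_combination h / 2
        rw [h2, norm_zero] at hn
        linarith
      let θ : unitInterval := ⟨1 / 2, by norm_num, by norm_num⟩
      have hθ : paramPt p θ = q.1 := by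
        simp only [paramPt, hp, θ]
        push_cast
        ring
      have := hder p hpm hpne (θ, θ) (by norm_num [θ]) (by norm_num [θ]) (by norm_num [θ])
        (by norm_num [θ])
      simp only [hθ] at this
      rwa [show (q.1, q.1) = q from Prod.ext rfl hne] at this
    · set p : ℂ × ℂ := (2 * q.1 - q.2, 2 * q.2 - q.1) with hp
      have hpm : p ∈ Metric.ball ((s : ℂ), (s : ℂ)) δ := by
        rw [Metric.mem_ball, Prod.dist_eq, max_lt_iff]
        simp only [dist_eq_norm, hp]
        constructor
        · rw [show 2 * q.1 - q.2 - s = 2 * (q.1 - s) - (q.2 - s) by ring]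
          have := norm_sub_le (2 * (q.1 - s)) (q.2 - s)
          rw [norm_mul, Complex.norm_ofNat] at this
          linarith
        · rw [show 2 * q.2 - q.1 - s = 2 * (q.2 - s) - (q.1 - s) by ring]
          have := norm_sub_le (2 * (q.2 - s)) (q.1 - s)
          rw [norm_mul, Complex.norm_ofNat] at this
          linarith
      have hpne : p.1 ≠ p.2 := by
        intro h
        simp only [hp] at h
        exact hne (by linear_combination h / 3)
      let θ₁ : unitInterval := ⟨2 / 3, by norm_num, by norm_num⟩
      let θ₂ : unitInterval := ⟨1 / 3, by norm_num, by norm_num⟩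
      have hθ₁ : paramPt p θ₁ = q.1 := by
        simp only [paramPt, hp, θ₁]
        push_cast
        ring
      have hθ₂ : paramPt p θ₂ = q.2 := by
        simp only [paramPt, hp, θ₂]
        push_cast
        ring
      have := hder p hpm hpne (θ₁, θ₂) (by norm_num [θ₁]) (by norm_num [θ₁]) (by norm_num [θ₂])
        (by norm_num [θ₂])
      simpa only [hθ₁, hθ₂] using this

end Complexified

/-! ### Wirtinger derivatives and restriction to `(z, z̄)` -/

section Wirtinger

theorem dz_eq_dhol (f : ℂ → ℂ) (z : ℂ) : dz f z = dhol f z / 2 := rfl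

theorem dzbar_eq_dbar (f : ℂ → ℂ) (z : ℂ) : dzbar f z = dbar f z / 2 := rfl

theorem _root_.Filter.EventuallyEq.dz_eq {f g : ℂ → ℂ} {z : ℂ} (h : f =ᶠ[𝓝 z] g) :
    dz f z = dz g z := by
  simp only [dz, h.fderiv_eq]

theorem _root_.Filter.EventuallyEq.dzbar_eq {f g : ℂ → ℂ} {z : ℂ} (h : f =ᶠ[𝓝 z] g) :
    dzbar f z = dzbar g z := by
  simp only [dzbar, h.fderiv_eq]

/-- The real-linear embedding `z ↦ (z, z̄)`. -/
def diagConj : ℂ →L[ℝ] ℂ × ℂ :=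
  (ContinuousLinearMap.id ℝ ℂ).prod (Complex.conjCLE : ℂ →L[ℝ] ℂ)

theorem diagConj_apply (z : ℂ) : diagConj z = (z, starRingEnd ℂ z) := rfl

theorem hasFDerivAt_comp_diagConj {E : Type*} [NormedAddCommGroup E] [NormedSpace ℂ E]
    {g : ℂ × ℂ → E} {z : ℂ} (hg : DifferentiableAt ℂ g (diagConj z)) :
    HasFDerivAt (fun z => g (diagConj z))
      (((fderiv ℂ g (diagConj z)).restrictScalars ℝ).comp diagConj) z :=
  (hg.hasFDerivAt.restrictScalars ℝ).comp z diagConj.hasFDerivAt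

/-- On the totally real plane of points `(z, z̄)` the two complex partial derivatives become the two
Wirtinger derivatives. -/
theorem dz_comp_diagConj {g : ℂ × ℂ → ℂ} {z : ℂ} (hg : DifferentiableAt ℂ g (diagConj z)) :
    dz (fun z => g (diagConj z)) z = fderiv ℂ g (diagConj z) (1, 0) ∧
    dzbar (fun z => g (diagConj z)) z = fderiv ℂ g (diagConj z) (0, 1) := by
  have e1 : diagConj 1 = ((1 : ℂ), (0 : ℂ)) + (0, 1) := by simp [diagConj_apply]
  have e2 : diagConj Complex.I = Complex.I • ((1 : ℂ), (0 : ℂ)) - Complex.I • (0, 1) := by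
    simp [diagConj_apply]
  simp only [dz, dzbar, (hasFDerivAt_comp_diagConj hg).fderiv, ContinuousLinearMap.comp_apply,
    ContinuousLinearMap.coe_restrictScalars', e1, e2, map_add, map_sub, map_smul, smul_eq_mul]
  constructor
  · linear_combination (-(fderiv ℂ g (diagConj z) (1, 0)) + fderiv ℂ g (diagConj z) (0, 1)) / 2
      * Complex.I_mul_I
  · linear_combination ((fderiv ℂ g (diagConj z) (1, 0)) - fderiv ℂ g (diagConj z) (0, 1)) / 2
      * Complex.I_mul_I

end Wirtinger

/-! ### Compatibility of the complexified derivatives -/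

section Closedness

theorem fderiv_comm_of_contDiffAt {E : Type*} [NormedAddCommGroup E] [NormedSpace ℂ E]
    {g : ℂ × ℂ → E} {p : ℂ × ℂ} (hg : ContDiffAt ℂ ω g p) (v w : ℂ × ℂ) :
    fderiv ℂ (fun q => fderiv ℂ g q v) p w = fderiv ℂ (fun q => fderiv ℂ g q w) p v := by
  have hd : DifferentiableAt ℂ (fderiv ℂ g) p :=
    (hg.fderiv_right (m := 1) le_top).differentiableAt one_ne_zero
  have key : ∀ v : ℂ × ℂ, HasFDerivAt (fun q => fderiv ℂ g q v) ((fderiv ℂ (fderiv ℂ g) p).flip v) p := by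
    intro v
    have := hd.hasFDerivAt.clm_apply (hasFDerivAt_const v p)
    convert! this using 1
    ext <;> simp
  rw [(key v).fderiv, (key w).fderiv]
  exact (hg.isSymmSndFDerivAt (by simp)).eq w v

/-- A holomorphic function near the diagonal point `(s, s)` with vanishing second partial
derivative which vanishes on the real diagonal is zero. -/
theorem eventually_eq_zero_of_partial_eq_zero {e : ℂ × ℂ → ℂ} {s : ℝ}
    (he : ContDiffAt ℂ ω e ((s : ℂ), (s : ℂ)))
    (h1 : ∀ᶠ p in 𝓝 ((s : ℂ), (s : ℂ)), fderiv ℂ e p (0, 1) = 0)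
    (h0 : ∀ᶠ t : ℝ in 𝓝 s, e (t, t) = 0) : ∀ᶠ p in 𝓝 ((s : ℂ), (s : ℂ)), e p = 0 := by
  have hdiag : ContDiffAt ℂ ω (fun x : ℂ => e (x, x)) s :=
    ContDiffAt.comp (s : ℂ) he (contDiffAt_id.prodMk contDiffAt_id)
  -- The identity theorem in one variable passes from the real to the complex diagonal; from there
  -- `e` is constant along the second variable.
  have hz : ∀ᶠ x in 𝓝 (s : ℂ), e (x, x) = 0 := by
    refine (AnalyticAt.frequently_eq_iff_eventually_eq hdiag.analyticAt
      (analyticAt_const (v := (0 : ℂ)))).1 ?_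
    have hcont : Tendsto (fun t : ℝ => (t : ℂ)) (𝓝[≠] s) (𝓝[≠] (s : ℂ)) := by
      refine tendsto_nhdsWithin_of_tendsto_nhds_of_eventually_within _
        ((Complex.continuous_ofReal.tendsto s).mono_left nhdsWithin_le_nhds) ?_
      filter_upwards [self_mem_nhdsWithin] with t ht h
      exact ht (Complex.ofReal_injective h)
    exact hcont.frequently (h0.filter_mono nhdsWithin_le_nhds).frequently
  obtain ⟨δ, hδ, hball⟩ := Metric.eventually_nhds_iff_ball.1 (h1.and (he.eventually (by simp)))
  have hz' : ∀ᶠ p : ℂ × ℂ in 𝓝 ((s : ℂ), (s : ℂ)), e (p.1, p.1) = 0 :=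
    (continuous_fst.tendsto ((s : ℂ), (s : ℂ))).eventually hz
  filter_upwards [hz', Metric.ball_mem_nhds _ hδ] with p hp hpb
  rw [Metric.mem_ball, Prod.dist_eq, max_lt_iff] at hpb
  have hmem : ∀ y ∈ Metric.ball (s : ℂ) δ, (p.1, y) ∈ Metric.ball ((s : ℂ), (s : ℂ)) δ := by
    intro y hy
    rw [Metric.mem_ball, Prod.dist_eq, max_lt_iff]
    exact ⟨hpb.1, hy⟩
  have hd : ∀ y ∈ Metric.ball (s : ℂ) δ, HasDerivAt (fun y => e (p.1, y)) 0 y := by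
    intro y hy
    obtain ⟨h2, h3⟩ := hball _ (hmem y hy)
    have h4 : HasDerivAt (fun y : ℂ => (p.1, y)) ((0 : ℂ), (1 : ℂ)) y :=
      (hasDerivAt_const y p.1).prodMk (hasDerivAt_id y)
    have h5 := (h3.differentiableAt (by simp)).hasFDerivAt.comp_hasDerivAt y h4
    rwa [h2] at h5
  have := Metric.isOpen_ball.is_const_of_deriv_eq_zero (convex_ball (s : ℂ) δ).isPreconnected
    (fun y hy => (hd y hy).differentiableAt.differentiableWithinAt)
    (fun y hy => (hd y hy).deriv) (x := p.2) (y := p.1) hpb.2 hpb.1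
  exact this.trans hp

end Closedness

/-! ### Uniqueness for semilinear equations -/

section SemilinearUniqueness

variable {E : Type*} [NormedAddCommGroup E] [NormedSpace ℂ E]

theorem lap_sub {h₁ h₂ : ℂ → E} {z : ℂ} (hh₁ : ContDiffAt ℝ 2 h₁ z) (hh₂ : ContDiffAt ℝ 2 h₂ z) :
    lap (fun z => h₁ z - h₂ z) z = lap h₁ z - lap h₂ z := by
  have key : ∀ v, fderiv ℝ (fun w => fderiv ℝ (fun z => h₁ z - h₂ z) w v) z
      = fderiv ℝ (fun w => fderiv ℝ h₁ w v) z - fderiv ℝ (fun w => fderiv ℝ h₂ w v) z := by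
    intro v
    rw [← fderiv_fun_sub (fderiv_clm_apply_const hh₁ v).differentiableAt
      (fderiv_clm_apply_const hh₂ v).differentiableAt]
    refine Filter.EventuallyEq.fderiv_eq ?_
    filter_upwards [hh₁.eventually (by simp), hh₂.eventually (by simp)] with w hw₁ hw₂
    rw [fderiv_fun_sub (hw₁.differentiableAt two_ne_zero) (hw₂.differentiableAt two_ne_zero)]
    rfl
  simp only [lap, key, sub_apply]
  abel

/-- The difference of two solutions of `Δh = 𝓕(h, Dh)` with the same `1`-jet at `q` satisfies a
linear differential inequality near `q`. -/
theorem exists_lap_sub_le {𝓕 : E × (ℂ →L[ℝ] E) → E} {h₁ h₂ : ℂ → E} {q : ℂ}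
    (hh₁ : ContDiffAt ℝ 2 h₁ q) (hh₂ : ContDiffAt ℝ 2 h₂ q) (h0 : h₁ q = h₂ q)
    (h1 : fderiv ℝ h₁ q = fderiv ℝ h₂ q) (h𝓕 : ContDiffAt ℝ 1 𝓕 (h₁ q, fderiv ℝ h₁ q))
    (he₁ : ∀ᶠ z in 𝓝 q, lap h₁ z = 𝓕 (h₁ z, fderiv ℝ h₁ z))
    (he₂ : ∀ᶠ z in 𝓝 q, lap h₂ z = 𝓕 (h₂ z, fderiv ℝ h₂ z)) :
    ∃ C : ℝ, ∀ᶠ z in 𝓝 q, ‖lap (fun z => h₁ z - h₂ z) z‖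
      ≤ C * (‖h₁ z - h₂ z‖ + ‖fderiv ℝ (fun z => h₁ z - h₂ z) z‖) := by
  -- Both `1`-jets stay in the neighbourhood `t` of their common value at `q`, so the Lipschitz
  -- constant of `𝓕` there serves as `C`.
  obtain ⟨K, t, ht, hK⟩ := h𝓕.exists_lipschitzOnWith
  have c₁ : ContinuousAt (fun z => (h₁ z, fderiv ℝ h₁ z)) q :=
    hh₁.continuousAt.prodMk (hh₁.fderiv_right (m := 1) (by norm_num)).continuousAt
  have c₂ : ContinuousAt (fun z => (h₂ z, fderiv ℝ h₂ z)) q :=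
    hh₂.continuousAt.prodMk (hh₂.fderiv_right (m := 1) (by norm_num)).continuousAt
  have ht₂ : t ∈ 𝓝 (h₂ q, fderiv ℝ h₂ q) := by rwa [← h0, ← h1]
  refine ⟨K, ?_⟩
  filter_upwards [c₁.eventually ht, c₂.eventually ht₂, he₁, he₂, hh₁.eventually (by simp),
    hh₂.eventually (by simp)] with z m₁ m₂ e₁ e₂ d₁ d₂
  rw [lap_sub d₁ d₂, e₁, e₂, fderiv_fun_sub (d₁.differentiableAt two_ne_zero)
    (d₂.differentiableAt two_ne_zero)]
  have := hK.dist_le_mul _ m₁ _ m₂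
  rw [dist_eq_norm, dist_eq_norm, Prod.mk_sub_mk] at this
  refine this.trans (mul_le_mul_of_nonneg_left ?_ K.coe_nonneg)
  rw [Prod.norm_def]
  exact max_le (by simp) (by simp)

theorem fderiv_eq_zero_of_dhol_dbar {h : ℂ → E} {z : ℂ} (h1 : dhol h z = 0) (h2 : dbar h z = 0) :
    fderiv ℝ h z = 0 := by
  have := norm_fderiv_le_dhol_add_dbar h z
  rw [h1, h2, norm_zero, add_zero] at this
  exact norm_le_zero_iff.1 this

/-- Uniqueness in the Cauchy problem for `Δh = 𝓕(h, Dh)` near a point of the real axis. -/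
theorem eventually_eq_of_lap_eq [CompleteSpace E] {𝓕 : E × (ℂ →L[ℝ] E) → E} {h₁ h₂ : ℂ → E}
    {s : ℝ} (hh₁ : ContDiffAt ℝ 2 h₁ s) (hh₂ : ContDiffAt ℝ 2 h₂ s)
    (h0 : ∀ᶠ t : ℝ in 𝓝 s, h₁ t = h₂ t) (h1 : ∀ᶠ t : ℝ in 𝓝 s, fderiv ℝ h₁ t = fderiv ℝ h₂ t)
    (h𝓕 : ContDiffAt ℝ 1 𝓕 (h₁ s, fderiv ℝ h₁ s))
    (he₁ : ∀ᶠ z in 𝓝 (s : ℂ), lap h₁ z = 𝓕 (h₁ z, fderiv ℝ h₁ z))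
    (he₂ : ∀ᶠ z in 𝓝 (s : ℂ), lap h₂ z = 𝓕 (h₂ z, fderiv ℝ h₂ z)) :
    h₁ =ᶠ[𝓝 (s : ℂ)] h₂ := by
  obtain ⟨C, hC⟩ := exists_lap_sub_le hh₁ hh₂ h0.self_of_nhds h1.self_of_nhds h𝓕 he₁ he₂
  have hcont : Tendsto (fun t : ℝ => (t : ℂ)) (𝓝 s) (𝓝 (s : ℂ)) :=
    Complex.continuous_ofReal.tendsto s
  have := eventually_eq_zero_of_lap_le (hh₁.sub hh₂)
    (h0.mono fun t ht => by simp [ht]) (by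
      filter_upwards [h1, hcont.eventually (hh₁.eventually (by simp)),
        hcont.eventually (hh₂.eventually (by simp))] with t ht d₁ d₂
      have := fderiv_fun_sub (d₁.differentiableAt two_ne_zero) (d₂.differentiableAt two_ne_zero)
      rw [ht, sub_self] at this
      exact this) hC
  filter_upwards [this] with z hz
  exact sub_eq_zero.1 hz

end SemilinearUniqueness

/-! ### Local real solutions of the conformal surface equation -/

section RealSolution

/-- The nonlinearity of the equation of conformal surfaces, as a function of the `1`-jet. -/
def surfaceForce (k : ℝ) (J : (Fin 3 → ℂ) × (ℂ →L[ℝ] (Fin 3 → ℂ))) : Fin 3 → ℂ := fun j =>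
  4 * force (speed k (J.1 2)) (fun i => (J.2 1 i - Complex.I * J.2 Complex.I i) / 2)
    (fun i => (J.2 1 i + Complex.I * J.2 Complex.I i) / 2) j

theorem contDiffAt_surfaceForce {k : ℝ} {J : (Fin 3 → ℂ) × (ℂ →L[ℝ] (Fin 3 → ℂ))}
    (hJ : k ≠ 1 → J.1 2 ≠ 0) : ContDiffAt ℝ 1 (surfaceForce k) J := by
  have h1 : ∀ i, ContDiffAt ℝ 1 (fun J : (Fin 3 → ℂ) × (ℂ →L[ℝ] (Fin 3 → ℂ)) => J.1 i) J :=
    fun i => by fun_prop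
  have h2 : ∀ w i, ContDiffAt ℝ 1
      (fun J : (Fin 3 → ℂ) × (ℂ →L[ℝ] (Fin 3 → ℂ)) => J.2 w i) J := fun w i =>
    contDiffAt_pi.1 (contDiffAt_snd.clm_apply contDiffAt_const) i
  have ha : ∀ i, ContDiffAt ℝ 1 (fun J : (Fin 3 → ℂ) × (ℂ →L[ℝ] (Fin 3 → ℂ)) =>
      (J.2 1 i - Complex.I * J.2 Complex.I i) / 2) J := fun i =>
    ((h2 1 i).sub (contDiffAt_const.mul (h2 Complex.I i))).div_const 2
  have hb : ∀ i, ContDiffAt ℝ 1 (fun J : (Fin 3 → ℂ) × (ℂ →L[ℝ] (Fin 3 → ℂ)) =>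
      (J.2 1 i + Complex.I * J.2 Complex.I i) / 2) J := fun i =>
    ((h2 1 i).add (contDiffAt_const.mul (h2 Complex.I i))).div_const 2
  have hs : ContDiffAt ℝ 1 (fun J : (Fin 3 → ℂ) × (ℂ →L[ℝ] (Fin 3 → ℂ)) => speed k (J.1 2)) J := by
    unfold speed
    split_ifs with h
    · exact contDiffAt_const
    · simp only [Ring.inverse_eq_inv', smul_eq_mul]
      exact contDiffAt_const.mul ((h1 2).inv (hJ h))
  rw [contDiffAt_pi]
  intro j
  unfold surfaceForce force
  simp only [smul_eq_mul]
  refine contDiffAt_const.mul (contDiffAt_const.mul (hs.mul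
    (((?_ : ContDiffAt _ _ _ _).sub ((hb _).mul (ha _))).sub ((ha _).mul (hb _)))))
  split_ifs
  · exact ContDiffAt.sum fun i _ => (ha i).mul (hb i)
  · exact contDiffAt_const

theorem dhol_apply {h : ℂ → Fin 3 → ℂ} {z : ℂ} (hh : DifferentiableAt ℝ h z) (j : Fin 3) :
    dhol h z j = 2 * dz (fun z => h z j) z ∧ dbar h z j = 2 * dzbar (fun z => h z j) z := by
  have : fderiv ℝ (fun z => h z j) z = (ContinuousLinearMap.proj j).comp (fderiv ℝ h z) :=
    (hasFDerivAt_pi'.1 hh.hasFDerivAt j).fderiv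
  simp only [dhol, dbar, dz, dzbar, this, ContinuousLinearMap.comp_apply,
    ContinuousLinearMap.proj_apply, Pi.sub_apply, Pi.add_apply, Pi.smul_apply, smul_eq_mul]
  constructor <;> ring

theorem lap_apply {h : ℂ → Fin 3 → ℂ} {z : ℂ} (hh : ContDiffAt ℝ 2 h z) (j : Fin 3) :
    lap h z j = 4 * dzbar (dz (fun z => h z j)) z := by
  rw [← dbar_dhol hh]
  have h1 := (contDiffAt_dhol (m := 1) hh (by norm_num)).differentiableAt one_ne_zero
  rw [(dhol_apply h1 j).2]
  have : (fun z => dhol h z j) =ᶠ[𝓝 z] fun z => 2 * dz (fun z => h z j) z := by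
    filter_upwards [hh.eventually (by simp)] with w hw
    exact (dhol_apply (hw.differentiableAt two_ne_zero) j).1
  rw [this.dzbar_eq]
  have hd : DifferentiableAt ℝ (dz fun z => h z j) z := by
    have h2 : DifferentiableAt ℝ (fun z => dhol h z j) z := differentiableAt_pi.1 h1 j
    have h3 := (h2.congr_of_eventuallyEq this.symm).const_mul (2⁻¹ : ℂ)
    refine h3.congr_of_eventuallyEq (Eventually.of_forall fun w => ?_)
    simp
  simp only [dzbar]
  rw [fderiv_const_mul hd]
  simp only [smul_apply, smul_eq_mul]
  ring

theorem lap_eq_surfaceForce_iff {k : ℝ} {h : ℂ → Fin 3 → ℂ} {z : ℂ} (hh : ContDiffAt ℝ 2 h z) :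
    lap h z = surfaceForce k (h z, fderiv ℝ h z) ↔ ∀ j, dzbar (dz (fun z => h z j)) z =
      force (speed k (h z 2)) (fun i => dz (fun z => h z i) z)
        (fun i => dzbar (fun z => h z i) z) j := by
  have hd := hh.differentiableAt two_ne_zero
  have key : ∀ i, (fderiv ℝ h z 1 i - Complex.I * fderiv ℝ h z Complex.I i) / 2
      = dz (fun z => h z i) z ∧ (fderiv ℝ h z 1 i + Complex.I * fderiv ℝ h z Complex.I i) / 2
      = dzbar (fun z => h z i) z := by
    intro i
    have h1 := dhol_apply hd i
    simp only [dhol, dbar, Pi.sub_apply, Pi.add_apply, Pi.smul_apply, smul_eq_mul] at h1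
    exact ⟨by rw [h1.1]; ring, by rw [h1.2]; ring⟩
  rw [funext_iff]
  refine forall_congr' fun j => ?_
  rw [lap_apply hh, surfaceForce]
  simp only [(key _).1, (key _).2]
  exact mul_right_inj' (by norm_num)

theorem dz_conj_fun {f : ℂ → ℂ} (z : ℂ) :
    dz (fun z => starRingEnd ℂ (f z)) z = starRingEnd ℂ (dzbar f z) ∧
    dzbar (fun z => starRingEnd ℂ (f z)) z = starRingEnd ℂ (dz f z) := by
  have : fderiv ℝ (fun z => starRingEnd ℂ (f z)) z
      = (Complex.conjCLE : ℂ →L[ℝ] ℂ).comp (fderiv ℝ f z) :=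
    Complex.conjCLE.comp_fderiv
  have h2 : starRingEnd ℂ 2 = 2 := map_ofNat _ 2
  simp [dz, dzbar, this, sub_eq_add_neg, h2]

theorem dz_dzbar_comm {f : ℂ → ℂ} {z : ℂ} (hf : ContDiffAt ℝ 2 f z) :
    dz (dzbar f) z = dzbar (dz f) z := by
  have h1 := dbar_dhol hf
  have h2 := dhol_dbar hf
  have d1 := (contDiffAt_dhol (m := 1) hf (by norm_num)).differentiableAt one_ne_zero
  have d2 := (contDiffAt_dbar (m := 1) hf (by norm_num)).differentiableAt one_ne_zero
  have e1 : fderiv ℝ (dz f) z = (2⁻¹ : ℂ) • fderiv ℝ (dhol f) z := by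
    rw [← fderiv_const_smul d1]
    congr 1
    ext w
    rw [dz_eq_dhol, div_eq_inv_mul]
    rfl
  have e2 : fderiv ℝ (dzbar f) z = (2⁻¹ : ℂ) • fderiv ℝ (dbar f) z := by
    rw [← fderiv_const_smul d2]
    congr 1
    ext w
    rw [dzbar_eq_dbar, div_eq_inv_mul]
    rfl
  have h3 := h2.trans h1.symm
  simp only [dz, dzbar] at h3 ⊢
  change (fderiv ℝ (dzbar f) z 1 - Complex.I * fderiv ℝ (dzbar f) z Complex.I) / 2
    = (fderiv ℝ (dz f) z 1 + Complex.I * fderiv ℝ (dz f) z Complex.I) / 2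
  rw [e1, e2]
  simp only [dhol, dbar, smul_eq_mul] at h3
  simp only [smul_apply, smul_eq_mul]
  change fderiv ℝ (dbar f) z 1 - Complex.I * fderiv ℝ (dbar f) z Complex.I
    = fderiv ℝ (dhol f) z 1 + Complex.I * fderiv ℝ (dhol f) z Complex.I at h3
  linear_combination h3 / 4

/-- `force` is symmetric in its two vector arguments, so the conjugate of a solution solves the same
equation. This is the reality argument. -/
theorem conj_force {k : ℝ} (c : ℂ) (a b : Fin 3 → ℂ) (j : Fin 3) :
    starRingEnd ℂ (force (speed k c) a b j) = force (speed k (starRingEnd ℂ c))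
      (fun i => starRingEnd ℂ (b i)) (fun i => starRingEnd ℂ (a i)) j := by
  have hs : starRingEnd ℂ (speed k c) = speed k (starRingEnd ℂ c) := by
    have h2 : starRingEnd ℂ 2 = 2 := map_ofNat _ 2
    unfold speed
    split_ifs <;> simp [h2]
  unfold force
  simp only [smul_eq_mul, map_mul, map_sub, hs, map_inv₀, map_ofNat]
  split_ifs
  · simp only [map_sum, map_mul]
    rw [show (∑ x, (starRingEnd ℂ) (a x) * (starRingEnd ℂ) (b x))
      = ∑ x, (starRingEnd ℂ) (b x) * (starRingEnd ℂ) (a x) from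
        Finset.sum_congr rfl fun x _ => mul_comm _ _]
    ring
  · simp only [map_zero]
    ring

/-- Local existence for the Cauchy problem of the equation of conformal surfaces. -/
theorem exists_local_solution (k : ℝ) (a : Fin 3 → ℝ → ℂ) (c : Fin 3 → ℝ → ℝ) (s : ℝ)
    (ha : ∀ j, AnalyticAt ℝ (a j) s) (hc : ∀ j, AnalyticAt ℝ (c j) s)
    (hac : ∀ᶠ t in 𝓝 s, ∀ j, HasDerivAt (c j) (2 * (a j t).re) t) (hk : k ≠ 1 → c 2 s ≠ 0) :
    ∃ Ψ : ℂ → Fin 3 → ℝ, ContDiffAt ℝ ω Ψ s ∧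
      (∀ᶠ z in 𝓝 (s : ℂ), ∀ j, dzbar (dz fun z => (Ψ z j : ℂ)) z =
        force (speed k (Ψ z 2 : ℂ)) (fun i => dz (fun z => (Ψ z i : ℂ)) z)
          (fun i => dzbar (fun z => (Ψ z i : ℂ)) z) j) ∧
      ∀ᶠ t : ℝ in 𝓝 s, ∀ j, Ψ t j = c j t ∧ dz (fun z => (Ψ z j : ℂ)) t = a j t := by
  let f : Fin 3 × Fin 3 → ℝ → ℂ := fun i t =>
    if i.1 = 0 then a i.2 t else if i.1 = 1 then starRingEnd ℂ (a i.2 t) else (c i.2 t : ℂ)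
  have hf : ∀ i, AnalyticAt ℝ (f i) s := by
    intro i
    simp only [f]
    split_ifs
    · exact ha _
    · exact ((Complex.conjCLE : ℂ →L[ℝ] ℂ).analyticAt _).comp (ha _)
    · exact (Complex.ofRealCLM.analyticAt _).comp (hc _)
  obtain ⟨u, huc, huf, hueq⟩ := exists_complexified k f s hf (fun h => by simpa [f] using hk h)
  have hui : ∀ i, ContDiffAt ℂ ω (fun p => u p i) ((s : ℂ), (s : ℂ)) := fun i =>
    contDiffAt_pi.1 huc i
  have hfi : ∀ᶠ p in 𝓝 ((s : ℂ), (s : ℂ)), ∀ i v,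
      fderiv ℂ u p v i = fderiv ℂ (fun p => u p i) p v := by
    filter_upwards [huc.eventually (by simp)] with p hp i v
    rw [(hasFDerivAt_pi'.1 (hp.differentiableAt (by simp)).hasFDerivAt i).fderiv]
    rfl
  -- The integral system prescribes only the second partial derivative of the position. The defect
  -- of the first one is independent of the second variable, since both terms have derivative
  -- `stateForce`. It vanishes on the real diagonal because `c' = 2 Re a = a + ā`.
  have hclosed : ∀ j, ∀ᶠ p in 𝓝 ((s : ℂ), (s : ℂ)),
      fderiv ℂ (fun p => u p (2, j)) p (1, 0) = u p (0, j) := by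
    intro j
    set e : ℂ × ℂ → ℂ := fun p => fderiv ℂ (fun p => u p (2, j)) p (1, 0) - u p (0, j) with he
    have hc1 : ContDiffAt ℂ ω (fun p => fderiv ℂ (fun p => u p (2, j)) p (1, 0))
        ((s : ℂ), (s : ℂ)) :=
      ((hui (2, j)).fderiv_right (m := ω) (by simp)).clm_apply contDiffAt_const
    have hec : ContDiffAt ℂ ω e ((s : ℂ), (s : ℂ)) := hc1.sub (hui (0, j))
    have hez : ∀ᶠ p in 𝓝 ((s : ℂ), (s : ℂ)), e p = 0 := by
      refine eventually_eq_zero_of_partial_eq_zero hec ?_ ?_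
      · have h2 : ∀ᶠ p in 𝓝 ((s : ℂ), (s : ℂ)),
            fderiv ℂ (fun p => u p (2, j)) p (0, 1) = u p (1, j) := by
          filter_upwards [hueq, hfi] with p hp hp2
          rw [← hp2]
          exact (hp j).2.2
        filter_upwards [h2.eventually_nhds, hueq, hfi, (hui (2, j)).eventually (by simp),
          (hui (0, j)).eventually (by simp), hc1.eventually (by simp)]
          with p hp2 hp hpi hc2 hc0 hcc
        rw [he, fderiv_fun_sub (hcc.differentiableAt (by simp)) (hc0.differentiableAt (by simp)),
          sub_apply, fderiv_comm_of_contDiffAt hc2, Filter.EventuallyEq.fderiv_eq hp2,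
          ← hpi, ← hpi, (hp j).1, (hp j).2.1, sub_self]
      · have hcont : Tendsto (fun t : ℝ => ((t : ℂ), (t : ℂ))) (𝓝 s) (𝓝 ((s : ℂ), (s : ℂ))) := by
          have : Continuous fun t : ℝ => ((t : ℂ), (t : ℂ)) := by fun_prop
          exact this.tendsto s
        filter_upwards [huf.eventually_nhds, hac, hcont.eventually hueq, hcont.eventually hfi,
          hcont.eventually ((hui (2, j)).eventually (by simp))] with t ht hct hp hpi hd
        have h1 : HasDerivAt (fun t : ℝ => ((t : ℂ), (t : ℂ))) ((1 : ℂ), (1 : ℂ)) t :=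
          (Complex.ofRealCLM.hasDerivAt (x := t)).prodMk (Complex.ofRealCLM.hasDerivAt (x := t))
        have h2 := ((hd.differentiableAt (by simp)).hasFDerivAt.restrictScalars
          ℝ).comp_hasDerivAt t h1
        have h3 : HasDerivAt (fun t : ℝ => u (t, t) (2, j)) ((2 * (a j t).re : ℝ) : ℂ) t := by
          refine ((hct j).ofReal_comp).congr_of_eventuallyEq ?_
          filter_upwards [ht] with t' ht'
          rw [ht']
          simp [f]
        have h4 := h2.unique h3
        rw [ContinuousLinearMap.coe_restrictScalars',
          show ((1 : ℂ), (1 : ℂ)) = (1, 0) + (0, 1) by simp, map_add, ← hpi _ (0, 1),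
          (hp j).2.2, ht.self_of_nhds] at h4
        have h5 : ((2 * (a j t).re : ℝ) : ℂ) = a j t + starRingEnd ℂ (a j t) := by
          rw [Complex.add_conj]
        rw [h5] at h4
        simp only [he]
        rw [ht.self_of_nhds]
        have f0 : f (0, j) t = a j t := by simp [f]
        have f1 : f (1, j) t = starRingEnd ℂ (a j t) := by simp [f]
        simp only [f0, f1] at h4 ⊢
        linear_combination h4
    filter_upwards [hez] with p hp
    exact sub_eq_zero.1 hp
  have hι : Tendsto diagConj (𝓝 (s : ℂ)) (𝓝 ((s : ℂ), (s : ℂ))) := by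
    have := diagConj.continuous.tendsto (s : ℂ)
    simpa [diagConj_apply] using this
  set Φ : ℂ → Fin 3 → ℂ := fun z j => u (diagConj z) (2, j) with hΦ
  have hΦc : ContDiffAt ℝ ω Φ s := by
    have h1 : ContDiffAt ℝ ω u (diagConj (s : ℂ)) := by
      simpa [diagConj_apply] using huc.restrict_scalars ℝ
    have h2 : ContDiffAt ℝ ω (fun z => u (diagConj z)) s :=
      ContDiffAt.comp (s : ℂ) h1 diagConj.contDiff.contDiffAt
    rw [contDiffAt_pi] at h2 ⊢
    exact fun j => h2 (2, j)
  have hΦ2 : ContDiffAt ℝ 2 Φ s := hΦc.of_le le_top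
  have hjets : ∀ᶠ z in 𝓝 (s : ℂ), ∀ j, dz (fun z => Φ z j) z = u (diagConj z) (0, j) ∧
      dzbar (fun z => Φ z j) z = u (diagConj z) (1, j) := by
    filter_upwards [hι.eventually hueq, hι.eventually hfi, hι.eventually (eventually_all.2 hclosed),
      hι.eventually (eventually_all.2 fun i => (hui i).eventually (by simp))]
      with z hz hzi hzc hzd j
    have hd := (hzd (2, j)).differentiableAt (by simp : (ω : WithTop ℕ∞) ≠ 0)
    obtain ⟨h1, h2⟩ := dz_comp_diagConj hd
    exact ⟨h1.trans (hzc j), h2.trans (by rw [← hzi, (hz j).2.2])⟩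
  have hpde : ∀ᶠ z in 𝓝 (s : ℂ), ∀ j, dzbar (dz fun z => Φ z j) z =
      force (speed k (Φ z 2)) (fun i => dz (fun z => Φ z i) z)
        (fun i => dzbar (fun z => Φ z i) z) j := by
    filter_upwards [hι.eventually hueq, hι.eventually hfi, hjets.eventually_nhds,
      hι.eventually (eventually_all.2 fun i => (hui i).eventually (by simp))]
      with z hz hzi hzj hzd j
    have h1 : (dz fun z => Φ z j) =ᶠ[𝓝 z] fun z => u (diagConj z) (0, j) := by
      filter_upwards [hzj] with w hw using (hw j).1
    have hd := (hzd (0, j)).differentiableAt (by simp : (ω : WithTop ℕ∞) ≠ 0)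
    rw [h1.dzbar_eq, (dz_comp_diagConj hd).2, ← hzi, (hz j).1]
    simp only [(hzj.self_of_nhds _).1, (hzj.self_of_nhds _).2]
    rfl
  have hR : Tendsto (fun t : ℝ => (t : ℂ)) (𝓝 s) (𝓝 (s : ℂ)) :=
    Complex.continuous_ofReal.tendsto s
  have hΦax : ∀ᶠ t : ℝ in 𝓝 s, ∀ j, Φ t j = c j t ∧ dz (fun z => Φ z j) t = a j t ∧
      dzbar (fun z => Φ z j) t = starRingEnd ℂ (a j t) := by
    filter_upwards [huf, hR.eventually hjets] with t ht hj j
    rw [(hj j).1, (hj j).2]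
    have e : diagConj (t : ℂ) = ((t : ℂ), (t : ℂ)) := by simp [diagConj_apply]
    simp only [hΦ, e, ht]
    simp [f]
  -- reality
  set Φ' : ℂ → Fin 3 → ℂ := fun z j => starRingEnd ℂ (Φ z j) with hΦ'
  have hΦ'2 : ContDiffAt ℝ 2 Φ' s := by
    rw [contDiffAt_pi] at hΦ2 ⊢
    exact fun j => Complex.conjCLE.contDiff.contDiffAt.comp (s : ℂ) (hΦ2 j)
  -- The conjugate solution has the same value and the same derivative on the axis, where `c` is
  -- real and `Φ_ζ̄` is the conjugate of `Φ_ζ`.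
  have hreal : Φ =ᶠ[𝓝 (s : ℂ)] Φ' := by
    refine eventually_eq_of_lap_eq (𝓕 := surfaceForce k) hΦ2 hΦ'2 ?_ ?_ ?_ ?_ ?_
    · filter_upwards [hΦax] with t ht
      ext j
      simp [hΦ', (ht j).1]
    · filter_upwards [hΦax, hR.eventually (hΦ2.eventually (by simp)),
        hR.eventually (hΦ'2.eventually (by simp))] with t ht d1 d2
      have e1 := d1.differentiableAt two_ne_zero
      have e2 := d2.differentiableAt two_ne_zero
      rw [← sub_eq_zero, ← fderiv_fun_sub e1 e2]
      apply fderiv_eq_zero_of_dhol_dbar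
      · ext j
        have : dhol (fun z => Φ z - Φ' z) t = dhol Φ t - dhol Φ' t := by
          simp only [dhol, fderiv_fun_sub e1 e2, sub_apply]
          module
        rw [this, Pi.sub_apply, (dhol_apply e1 j).1, (dhol_apply e2 j).1, (ht j).2.1,
          (dz_conj_fun _).1, (ht j).2.2]
        simp
      · ext j
        have : dbar (fun z => Φ z - Φ' z) t = dbar Φ t - dbar Φ' t := by
          simp only [dbar, fderiv_fun_sub e1 e2, sub_apply]
          module
        rw [this, Pi.sub_apply, (dhol_apply e1 j).2, (dhol_apply e2 j).2, (ht j).2.2,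
          (dz_conj_fun _).2, (ht j).2.1]
        simp
    · refine contDiffAt_surfaceForce fun h => ?_
      simp only [(hΦax.self_of_nhds 2).1]
      simpa using hk h
    · filter_upwards [hpde, hΦ2.eventually (by simp)] with z hz hd
      exact (lap_eq_surfaceForce_iff hd).2 hz
    · filter_upwards [hpde, hΦ2.eventually (by simp), hΦ'2.eventually (by simp)] with z hz hd hd'
      refine (lap_eq_surfaceForce_iff hd').2 fun j => ?_
      have e1 : (dz fun z => Φ' z j) = fun z => starRingEnd ℂ (dzbar (fun z => Φ z j) z) :=
        funext fun w => (dz_conj_fun w).1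
      have hdj : ContDiffAt ℝ 2 (fun z => Φ z j) z := contDiffAt_pi.1 hd j
      have e2 : dz (dzbar fun z => Φ z j) z = dzbar (dz fun z => Φ z j) z := dz_dzbar_comm hdj
      rw [e1, (dz_conj_fun z).2, e2, hz j, conj_force]
      simp only [hΦ', (dz_conj_fun z).1, (dz_conj_fun z).2]
  have hre : ∀ᶠ z in 𝓝 (s : ℂ), (fun j => ((Φ z j).re : ℂ)) = Φ z := by
    filter_upwards [hreal] with z hz
    ext j
    exact Complex.conj_eq_iff_re.1 (congrFun hz j).symm
  have hrej : ∀ᶠ z in 𝓝 (s : ℂ), ∀ j,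
      (fun z => (((Φ z j).re : ℝ) : ℂ)) =ᶠ[𝓝 z] fun z => Φ z j := by
    filter_upwards [hre.eventually_nhds] with z hz j
    filter_upwards [hz] with w hw
    exact congrFun hw j
  refine ⟨fun z j => (Φ z j).re, ?_, ?_, ?_⟩
  · rw [contDiffAt_pi] at hΦc ⊢
    exact fun j => Complex.reCLM.contDiff.contDiffAt.comp (s : ℂ) (hΦc j)
  · filter_upwards [hpde, hrej.eventually_nhds] with z hz hj j
    have h1 : (dz fun z => (((Φ z j).re : ℝ) : ℂ)) =ᶠ[𝓝 z] dz fun z => Φ z j := by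
      filter_upwards [hj] with w hw using (hw j).dz_eq
    have h2 := hj.self_of_nhds
    rw [h1.dzbar_eq, hz j]
    simp only [(h2 _).dz_eq, (h2 _).dzbar_eq]
    congr 2
    exact (h2 2).eq_of_nhds.symm
  · filter_upwards [hΦax, hR.eventually hrej] with t ht hj j
    rw [(hj j).dz_eq, (ht j).2.1, (ht j).1]
    simp

end RealSolution

/-! ### Wirtinger derivatives and conformal solutions -/

/-- `f` is real differentiable at `z` with Wirtinger derivatives `a = f_ζ` and `b = f_ζ̄`. -/
def HasWirtingerAt (f : ℂ → ℂ) (a b z : ℂ) : Prop :=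
  HasFDerivAt f (a • (1 : ℂ →L[ℝ] ℂ) + b • (Complex.conjCLE : ℂ →L[ℝ] ℂ)) z

namespace HasWirtingerAt

variable {f g : ℂ → ℂ} {a b c d z : ℂ}

theorem dz_eq (h : HasWirtingerAt f a b z) : dz f z = a := by
  simp only [dz, h.fderiv, add_apply, smul_apply, one_apply_eq_self, smul_eq_mul,
    ContinuousLinearEquiv.coe_coe, Complex.conjCLE_apply, map_one, Complex.conj_I]
  linear_combination (-a + b) / 2 * Complex.I_mul_I

theorem dzbar_eq (h : HasWirtingerAt f a b z) : dzbar f z = b := by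
  simp only [dzbar, h.fderiv, add_apply, smul_apply, one_apply_eq_self, smul_eq_mul,
    ContinuousLinearEquiv.coe_coe, Complex.conjCLE_apply, map_one, Complex.conj_I]
  linear_combination (a - b) / 2 * Complex.I_mul_I

theorem of_differentiableAt (h : DifferentiableAt ℝ f z) :
    HasWirtingerAt f (dz f z) (dzbar f z) z := by
  have := h.hasFDerivAt
  unfold HasWirtingerAt
  convert this using 1
  rw [← sub_eq_zero]
  refine clm_complex_ext ?_ ?_
  · simp only [dz, dzbar, sub_apply, add_apply, smul_apply, one_apply_eq_self,
      smul_eq_mul, ContinuousLinearEquiv.coe_coe, Complex.conjCLE_apply, map_one]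
    ring
  · simp only [dz, dzbar, sub_apply, add_apply, smul_apply, one_apply_eq_self,
      smul_eq_mul, ContinuousLinearEquiv.coe_coe, Complex.conjCLE_apply, Complex.conj_I]
    linear_combination (-fderiv ℝ f z Complex.I) * Complex.I_mul_I

theorem congr_deriv (h : HasWirtingerAt f a b z) (ha : a = c) (hb : b = d) :
    HasWirtingerAt f c d z := ha ▸ hb ▸ h

theorem of_hasFDerivAt {L : ℂ →L[ℝ] ℂ} (h : HasFDerivAt f L z)
    (hL : ∀ w, L w = a * w + b * starRingEnd ℂ w) : HasWirtingerAt f a b z := by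
  have : L = a • (1 : ℂ →L[ℝ] ℂ) + b • (Complex.conjCLE : ℂ →L[ℝ] ℂ) :=
    ContinuousLinearMap.ext fun w => by simp [hL]
  rw [HasWirtingerAt, ← this]
  exact h

theorem const (c : ℂ) : HasWirtingerAt (fun _ => c) 0 0 z :=
  of_hasFDerivAt (hasFDerivAt_const (𝕜 := ℝ) c z) fun w => by simp

theorem add (hf : HasWirtingerAt f a b z) (hg : HasWirtingerAt g c d z) :
    HasWirtingerAt (fun z => f z + g z) (a + c) (b + d) z :=
  of_hasFDerivAt (HasFDerivAt.add hf hg) fun w => by simp; ring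

theorem mul (hf : HasWirtingerAt f a b z) (hg : HasWirtingerAt g c d z) :
    HasWirtingerAt (fun z => f z * g z) (a * g z + f z * c) (b * g z + f z * d) z :=
  of_hasFDerivAt (HasFDerivAt.mul hf hg) fun w => by simp; ring

theorem const_mul (c : ℂ) (hf : HasWirtingerAt f a b z) :
    HasWirtingerAt (fun z => c * f z) (c * a) (c * b) z :=
  ((const c).mul hf).congr_deriv (by ring) (by ring)

theorem sub (hf : HasWirtingerAt f a b z) (hg : HasWirtingerAt g c d z) :
    HasWirtingerAt (fun z => f z - g z) (a - c) (b - d) z := by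
  simpa [sub_eq_add_neg] using hf.add (hg.const_mul (-1))

theorem pow_two (hf : HasWirtingerAt f a b z) :
    HasWirtingerAt (fun z => f z ^ 2) (2 * f z * a) (2 * f z * b) z := by
  simp only [sq]
  exact (hf.mul hf).congr_deriv (by ring) (by ring)

theorem star (hf : HasWirtingerAt f a b z) :
    HasWirtingerAt (fun z => starRingEnd ℂ (f z)) (starRingEnd ℂ b) (starRingEnd ℂ a) z :=
  of_hasFDerivAt ((Complex.conjCLE : ℂ →L[ℝ] ℂ).hasFDerivAt.comp z hf) fun w => by
    simp [add_comm]

theorem inv (hf : HasWirtingerAt f a b z) (h0 : f z ≠ 0) :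
    HasWirtingerAt (fun z => (f z)⁻¹) (-a / f z ^ 2) (-b / f z ^ 2) z :=
  of_hasFDerivAt (((hasFDerivAt_inv (𝕜 := ℂ) h0).restrictScalars ℝ).comp z hf) fun w => by
    simp; ring

theorem div (hf : HasWirtingerAt f a b z) (hg : HasWirtingerAt g c d z) (h0 : g z ≠ 0) :
    HasWirtingerAt (fun z => f z / g z) ((a * g z - f z * c) / g z ^ 2)
      ((b * g z - f z * d) / g z ^ 2) z := by
  simp only [div_eq_mul_inv]
  refine (hf.mul (hg.inv h0)).congr_deriv ?_ ?_ <;> field_simp <;> ring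

end HasWirtingerAt

theorem contDiffAt_dz {f : ℂ → ℂ} {z : ℂ} {n m : WithTop ℕ∞} (hf : ContDiffAt ℝ n f z)
    (hmn : m + 1 ≤ n) : ContDiffAt ℝ m (dz f) z := by
  have : dz f = fun z => dhol f z / 2 := funext fun z => dz_eq_dhol f z
  rw [this]
  exact (contDiffAt_dhol hf hmn).div_const 2

theorem contDiffAt_coord {X : ℂ → E3} {z : ℂ} {n : WithTop ℕ∞} (hX : ContDiffAt ℝ n X z)
    (j : Fin 3) : ContDiffAt ℝ n (coord X j) z :=
  Complex.ofRealCLM.contDiff.contDiffAt.comp z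
    ((EuclideanSpace.proj j : E3 →L[ℝ] ℝ).contDiff.contDiffAt.comp z hX)

theorem dzbar_coord (X : ℂ → E3) (j : Fin 3) (z : ℂ) :
    dzbar (coord X j) z = starRingEnd ℂ (dz (coord X j) z) := by
  rw [← (dz_conj_fun z).2]
  congr 1
  ext w
  simp [coord]

/-- The Gauss map of a conformal surface. -/
def gaussMap (ψ : ℂ → E3) (z : ℂ) : ℂ :=
  dz (coord ψ 2) z / (dz (coord ψ 0) z - Complex.I * dz (coord ψ 1) z)

/-- An analytic conformal parametrization satisfying the equation of `[φ_k, e₃]`-minimal surfaces,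
whose Gauss map takes values in the unit disc. -/
structure IsConformalSolution (k : ℝ) (ψ : ℂ → E3) (U : Set ℂ) : Prop where
  analytic : AnalyticOnNhd ℝ ψ U
  height : ∀ z ∈ U, ψ z 2 ∈ weightDomain k
  equation : ∀ z ∈ U, ∀ j, dzbar (dz (coord ψ j)) z =
    force (speed k (coord ψ 2 z)) (fun i => dz (coord ψ i) z)
      (fun i => starRingEnd ℂ (dz (coord ψ i) z)) j
  isotropic : ∀ z ∈ U, dz (coord ψ 0) z ^ 2 + dz (coord ψ 1) z ^ 2 + dz (coord ψ 2) z ^ 2 = 0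
  denom_ne_zero : ∀ z ∈ U, dz (coord ψ 0) z - Complex.I * dz (coord ψ 1) z ≠ 0
  norm_gaussMap_lt : ∀ z ∈ U, ‖gaussMap ψ z‖ < 1

/-- `ψ` has the Cauchy data prescribed by `β` and `V` on the real points of `U`. -/
def HasBjorlingAxis (β V : ℝ → E3) (ψ : ℂ → E3) (U : Set ℂ) : Prop :=
  ∀ t : ℝ, (t : ℂ) ∈ U → ψ t = β t ∧ ∀ j, dz (coord ψ j) t = phi β V t j

/-! ### The geometric Cauchy problem near a point of the curve -/

theorem crossProduct_apply (a b : Fin 3 → ℝ) :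
    crossProduct a b 0 = a 1 * b 2 - a 2 * b 1 ∧ crossProduct a b 1 = a 2 * b 0 - a 0 * b 2 ∧
      crossProduct a b 2 = a 0 * b 1 - a 1 * b 0 := by
  simp [cross_apply]

theorem inner_E3 (x y : E3) : inner ℝ x y = x 0 * y 0 + x 1 * y 1 + x 2 * y 2 := by
  simp [PiLp.inner_apply, Fin.sum_univ_three, mul_comm]

theorem norm_sq_E3 (x : E3) : ‖x‖ ^ 2 = x 0 ^ 2 + x 1 ^ 2 + x 2 ^ 2 := by
  simp [EuclideanSpace.norm_sq_eq, Fin.sum_univ_three]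

namespace IsBjorlingData

variable {k : ℝ} {I : Set ℝ} {β V : ℝ → E3} {s : ℝ}

theorem sum_sq (h : IsBjorlingData k I β V) (hs : s ∈ I) :
    V s 0 ^ 2 + V s 1 ^ 2 + V s 2 ^ 2 = 1 := by
  rw [← norm_sq_E3, h.unit s hs, one_pow]

theorem one_add_pos (h : IsBjorlingData k I β V) (hs : s ∈ I) : 0 < 1 + V s 2 := by
  have h1 := h.sum_sq hs
  rcases lt_or_ge (-1) (V s 2) with h2 | h2
  · linarith
  · exfalso
    have h3 : V s 2 = -1 := by nlinarith [sq_nonneg (V s 0), sq_nonneg (V s 1)]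
    have h0 : V s 0 = 0 := by nlinarith [sq_nonneg (V s 0), sq_nonneg (V s 1)]
    have h4 : V s 1 = 0 := by nlinarith [sq_nonneg (V s 0), sq_nonneg (V s 1)]
    apply h.ne_south s hs
    ext j
    fin_cases j <;> simp [e3, h0, h4, h3]

theorem inner_eq (h : IsBjorlingData k I β V) (hs : s ∈ I) :
    deriv β s 0 * V s 0 + deriv β s 1 * V s 1 + deriv β s 2 * V s 2 = 0 := by
  rw [← inner_E3]
  exact h.orthogonal s hs

theorem phi_isotropic (h : IsBjorlingData k I β V) (hs : s ∈ I) :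
    phi β V s 0 ^ 2 + phi β V s 1 ^ 2 + phi β V s 2 ^ 2 = 0 := by
  have h1 := h.sum_sq hs
  have h2 := h.inner_eq hs
  obtain ⟨c0, c1, c2⟩ := crossProduct_apply (deriv β s).ofLp (V s).ofLp
  simp only [phi, c0, c1, c2]
  apply Complex.ext
  · simp [sq]
    linear_combination (-(deriv β s 0 ^ 2 + deriv β s 1 ^ 2 + deriv β s 2 ^ 2) / 4) * h1
      + (deriv β s 0 * V s 0 + deriv β s 1 * V s 1 + deriv β s 2 * V s 2) / 4 * h2
  · simp [sq]
    ring

/-- Both parts of the identity follow from `|V| = 1` and `⟨β', V⟩ = 0`. After division it says that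
the initial Gauss map is minus the stereographic projection of `V`. -/
theorem phi_two_mul (h : IsBjorlingData k I β V) (hs : s ∈ I) :
    phi β V s 2 * ((1 + V s 2 : ℝ) : ℂ)
      = -(⟨V s 0, V s 1⟩ : ℂ) * (phi β V s 0 - Complex.I * phi β V s 1) := by
  have h1 := h.sum_sq hs
  have h2 := h.inner_eq hs
  obtain ⟨c0, c1, c2⟩ := crossProduct_apply (deriv β s).ofLp (V s).ofLp
  simp only [phi, c0, c1, c2]
  apply Complex.ext
  · simp
    linear_combination (-(deriv β s 2) / 2) * h1 + (1 + V s 2) / 2 * h2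
  · simp
    ring

/-- If the denominator vanished, `phi_two_mul` would give `φ₃ = 0` because `V` avoids the south
pole, and all components of `β'` would be zero. -/
theorem phi_denom_ne_zero (h : IsBjorlingData k I β V) (hs : s ∈ I) :
    phi β V s 0 - Complex.I * phi β V s 1 ≠ 0 := by
  intro h0
  have h1 := h.phi_two_mul hs
  have hp := h.one_add_pos hs
  rw [h0, mul_zero, mul_eq_zero] at h1
  have h2 : phi β V s 2 = 0 := h1.resolve_right (Complex.ofReal_ne_zero.2 hp.ne')
  obtain ⟨c0, c1, c2⟩ := crossProduct_apply (deriv β s).ofLp (V s).ofLp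
  simp only [phi, c0, c1, c2, Complex.ext_iff] at h0 h2
  simp at h0 h2
  apply h.regular s hs
  have b2 : deriv β s 2 = 0 := h2.1
  have b0 : deriv β s 0 * (1 + V s 2) = 0 := by linear_combination 2 * h0.1 + V s 0 * b2
  have b1 : deriv β s 1 * (1 + V s 2) = 0 := by linear_combination -2 * h0.2 + V s 1 * b2
  have b0 := (mul_eq_zero.1 b0).resolve_right hp.ne'
  have b1 := (mul_eq_zero.1 b1).resolve_right hp.ne'
  ext j
  fin_cases j <;> simp [b0, b1, b2]

theorem initialGauss_eq (h : IsBjorlingData k I β V) (hs : s ∈ I) :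
    initialGauss β V s = -stereoSouth (V s) := by
  have hp : ((1 + V s 2 : ℝ) : ℂ) ≠ 0 := Complex.ofReal_ne_zero.2 (h.one_add_pos hs).ne'
  rw [initialGauss, stereoSouth, ← neg_div, div_eq_div_iff (h.phi_denom_ne_zero hs) hp,
    h.phi_two_mul hs]

theorem norm_initialGauss_lt (h : IsBjorlingData k I β V) (hs : s ∈ I) :
    ‖initialGauss β V s‖ < 1 := by
  rw [h.initialGauss_eq hs, norm_neg]
  exact h.stereo_lt s hs

theorem initialGauss_eq_neg (h : IsBjorlingData k I β V) (hs : s ∈ I) (h3 : phi β V s 2 ≠ 0) :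
    initialGauss β V s = -((phi β V s 0 + Complex.I * phi β V s 1) / phi β V s 2) := by
  rw [initialGauss, ← neg_div, div_eq_div_iff (h.phi_denom_ne_zero hs) h3]
  linear_combination h.phi_isotropic hs - phi β V s 1 ^ 2 * Complex.I_sq

theorem unitNormal_initialGauss (h : IsBjorlingData k I β V) (hs : s ∈ I) :
    unitNormal (initialGauss β V s) = V s := by
  have hp := h.one_add_pos hs
  have h1 := h.sum_sq hs
  have hre : (initialGauss β V s).re = -(V s 0 / (1 + V s 2)) := by
    rw [h.initialGauss_eq hs, stereoSouth, Complex.neg_re, Complex.div_ofReal_re]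
  have him : (initialGauss β V s).im = -(V s 1 / (1 + V s 2)) := by
    rw [h.initialGauss_eq hs, stereoSouth, Complex.neg_im, Complex.div_ofReal_im]
  have hn : ‖initialGauss β V s‖ ^ 2 = (1 - V s 2) / (1 + V s 2) := by
    rw [Complex.sq_norm, Complex.normSq_apply, hre, him]
    field_simp
    linear_combination h1
  have hq : (1 + (1 - V s 2) / (1 + V s 2))⁻¹ = (1 + V s 2) / 2 := by
    field_simp
    ring
  ext j
  fin_cases j
  · simp [unitNormal, hn, hq, hre]; field_simp
  · simp [unitNormal, hn, hq, him]; field_simp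
  · simp [unitNormal, hn, hq]; field_simp; ring

end IsBjorlingData

theorem speed_of_one {c : ℂ} : speed 1 c = 1 := by simp [speed]

/-- The Hopf differential of a solution satisfies a linear Cauchy–Riemann equation. -/
theorem hasWirtingerAt_isotropic {p : Fin 3 → ℂ → ℂ} {q z : ℂ}
    (hp : ∀ j, DifferentiableAt ℝ (p j) z)
    (heq : ∀ j, dzbar (p j) z = force q (fun i => p i z) (fun i => starRingEnd ℂ (p i z)) j) :
    dzbar (fun z => p 0 z ^ 2 + p 1 z ^ 2 + p 2 z ^ 2) z
      = -(q * starRingEnd ℂ (p 2 z)) * (p 0 z ^ 2 + p 1 z ^ 2 + p 2 z ^ 2) := by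
  have h := fun j => (HasWirtingerAt.of_differentiableAt (hp j)).pow_two
  rw [(((h 0).add (h 1)).add (h 2)).dzbar_eq]
  -- The terms `⟨p, p̄⟩ p₃` coming from the `e₃`-part and from the last part of the force cancel,
  -- leaving a multiple of the sum of squares.
  simp only [heq, force, smul_eq_mul, Fin.sum_univ_three]
  simp
  ring

/-- Local solution of the geometric Cauchy problem. -/
theorem exists_isConformalSolution {k : ℝ} {I : Set ℝ} {β V : ℝ → E3} (hI : IsOpen I)
    (h : IsBjorlingData k I β V) {s : ℝ} (hs : s ∈ I) :
    ∃ ψ : ℂ → E3, ∃ r > 0, IsConformalSolution k ψ (Metric.ball (s : ℂ) r) ∧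
      HasBjorlingAxis β V ψ (Metric.ball (s : ℂ) r) ∧
      ∀ t : ℝ, (t : ℂ) ∈ Metric.ball (s : ℂ) r → t ∈ I := by
  have hIs : I ∈ 𝓝 s := hI.mem_nhds hs
  have hcoord : ∀ {f : ℝ → E3} (j : Fin 3), AnalyticAt ℝ f s → AnalyticAt ℝ (fun t => f t j) s :=
    fun j hf => ((EuclideanSpace.proj j : E3 →L[ℝ] ℝ).analyticAt _).comp hf
  have hβa := h.analytic_curve s hs
  have hda : AnalyticAt ℝ (deriv β) s := hβa.deriv
  have hVa := h.analytic_field s hs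
  have hof : ∀ {f : ℝ → ℝ}, AnalyticAt ℝ f s → AnalyticAt ℝ (fun t => (f t : ℂ)) s :=
    fun hf => (Complex.ofRealCLM.analyticAt _).comp hf
  have hpa : ∀ j, AnalyticAt ℝ (fun t => phi β V t j) s := by
    intro j
    unfold phi
    refine (((hof (hcoord j hda)).sub (analyticAt_const.mul (hof ?_)))).div_const
    fin_cases j
    · simp only [Fin.zero_eta, (crossProduct_apply _ _).1]
      exact ((hcoord 1 hda).mul (hcoord 2 hVa)).sub ((hcoord 2 hda).mul (hcoord 1 hVa))
    · simp only [Fin.mk_one, (crossProduct_apply _ _).2.1]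
      exact ((hcoord 2 hda).mul (hcoord 0 hVa)).sub ((hcoord 0 hda).mul (hcoord 2 hVa))
    · simp only [Fin.reduceFinMk, (crossProduct_apply _ _).2.2]
      exact ((hcoord 0 hda).mul (hcoord 1 hVa)).sub ((hcoord 1 hda).mul (hcoord 0 hVa))
  obtain ⟨Ψ, hΨ, hΨeq, hΨax⟩ := exists_local_solution k (fun j t => phi β V t j)
    (fun j t => β t j) s hpa (fun j => hcoord j hβa)
    (by
      filter_upwards [hIs] with t ht j
      have h1 : HasDerivAt (fun t => β t j) (deriv β t j) t :=
        (EuclideanSpace.proj j : E3 →L[ℝ] ℝ).hasFDerivAt.comp_hasDerivAt t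
          (h.analytic_curve t ht).differentiableAt.hasDerivAt
      convert h1 using 1
      simp [phi]
      ring)
    (fun hk => (h.height s hs hk).ne')
  set ψ : ℂ → E3 := fun z => WithLp.toLp 2 (Ψ z) with hψ
  have hψc : ContDiffAt ℝ ω ψ s :=
    (PiLp.continuousLinearEquiv 2 ℝ (fun _ : Fin 3 => ℝ)).symm.contDiff.contDiffAt.comp _ hΨ
  have hco : ∀ j, coord ψ j = fun z => (Ψ z j : ℂ) := fun j => rfl
  have hψa : AnalyticAt ℝ ψ s := hψc.analyticAt
  have hpc : ∀ j, ContDiffAt ℝ ω (dz (coord ψ j)) s := fun j =>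
    contDiffAt_dz (contDiffAt_coord hψc j) (by simp)
  have heq : ∀ᶠ z in 𝓝 (s : ℂ), ∀ j, dzbar (dz (coord ψ j)) z =
    force (speed k (coord ψ 2 z)) (fun i => dz (coord ψ i) z)
      (fun i => starRingEnd ℂ (dz (coord ψ i) z)) j := by
    filter_upwards [hΨeq] with z hz j
    simp only [← dzbar_coord]
    exact hz j
  have hax : ∀ᶠ t : ℝ in 𝓝 s, ψ t = β t ∧ ∀ j, dz (coord ψ j) t = phi β V t j := by
    filter_upwards [hΨax] with t ht
    refine ⟨?_, fun j => (ht j).2⟩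
    ext j
    exact (ht j).1
  have hheight : ∀ᶠ z in 𝓝 (s : ℂ), ψ z 2 ∈ weightDomain k := by
    by_cases hk : k = 1
    · exact Eventually.of_forall fun z h => absurd hk h
    have h1 : ContinuousAt (fun z => ψ z 2) (s : ℂ) :=
      ((EuclideanSpace.proj 2 : E3 →L[ℝ] ℝ).continuous.continuousAt).comp hψc.continuousAt
    have h2 : 0 < ψ s 2 := by
      rw [hax.self_of_nhds.1]
      exact h.height s hs hk
    filter_upwards [h1.eventually (lt_mem_nhds h2)] with z hz _ using hz
  set Q : ℂ → ℂ := fun z => dz (coord ψ 0) z ^ 2 + dz (coord ψ 1) z ^ 2 + dz (coord ψ 2) z ^ 2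
    with hQ
  -- `Q` is the Hopf-type differential `⟨ψ_ζ, ψ_ζ⟩`. It satisfies `dbar Q = M Q` and vanishes on the
  -- axis, so unique continuation applies with zero as second unknown.
  have hiso : ∀ᶠ z in 𝓝 (s : ℂ), Q z = 0 := by
    set M : ℂ → ℂ := fun z => 2 * (-(speed k (coord ψ 2 z) * starRingEnd ℂ (dz (coord ψ 2) z)))
      with hM
    have hMc : ContinuousAt M s := by
      have h1 : ContinuousAt (fun z => speed k (coord ψ 2 z)) s := by
        by_cases hk : k = 1
        · simp only [hk, speed_of_one]
          exact continuousAt_const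
        · have h0 : coord ψ 2 s ≠ 0 := by
            have := hheight.self_of_nhds hk
            simp only [coord]
            exact_mod_cast this.ne'
          simp only [speed, hk, if_false, Ring.inverse_eq_inv', smul_eq_mul]
          exact continuousAt_const.mul ((contDiffAt_coord hψc 2).continuousAt.inv₀ h0)
      exact continuousAt_const.mul
        ((h1.mul (Complex.continuous_conj.continuousAt.comp (hpc 2).continuousAt)).neg)
    have hQc : ContDiffAt ℝ 1 Q s :=
      (((((hpc 0).pow 2).add ((hpc 1).pow 2)).add ((hpc 2).pow 2))).of_le (by simp)
    have key := eventually_eq_zero_of_dbar_le (w₁ := Q) (w₂ := fun _ => (0 : ℂ)) (s := s)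
      (C := ‖M s‖ + 1) hQc contDiffAt_const ?_ (Eventually.of_forall fun _ => rfl) ?_
    · exact key.1
    · filter_upwards [hax, hIs] with t ht htI
      simp only [hQ, ht.2]
      exact h.phi_isotropic htI
    · have hb : ∀ᶠ z in 𝓝 (s : ℂ), ‖M z‖ < ‖M s‖ + 1 :=
        hMc.norm.eventually (gt_mem_nhds (lt_add_one _))
      filter_upwards [hb, heq, eventually_all.2 fun j => (hpc j).eventually (by simp)]
        with z hz hzeq hzd
      have h1 := hasWirtingerAt_isotropic (p := fun j => dz (coord ψ j))
        (fun j => (hzd j).differentiableAt (by simp)) hzeq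
      have h2 : dbar Q z = M z * Q z := by
        have := dzbar_eq_dbar Q z
        rw [show dbar Q z = 2 * dzbar Q z by rw [this]; ring]
        rw [show dzbar Q z = _ from h1]
        simp only [hM, hQ]
        ring
      have h3 : dhol (fun _ : ℂ => (0 : ℂ)) z = 0 := by simp [dhol]
      rw [h2, h3, norm_mul, norm_zero, add_zero, add_zero]
      gcongr
  have hD : ContinuousAt (fun z => dz (coord ψ 0) z - Complex.I * dz (coord ψ 1) z) s :=
    (hpc 0).continuousAt.sub (continuousAt_const.mul (hpc 1).continuousAt)
  have hD0 : dz (coord ψ 0) s - Complex.I * dz (coord ψ 1) s ≠ 0 := by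
    rw [hax.self_of_nhds.2, hax.self_of_nhds.2]
    exact h.phi_denom_ne_zero hs
  have hG : ContinuousAt (gaussMap ψ) s := (hpc 2).continuousAt.div hD hD0
  have hG0 : ‖gaussMap ψ s‖ < 1 := by
    have : gaussMap ψ s = initialGauss β V s := by
      simp only [gaussMap, initialGauss, hax.self_of_nhds.2]
    rw [this]
    exact h.norm_initialGauss_lt hs
  have hall : ∀ᶠ z in 𝓝 (s : ℂ), AnalyticAt ℝ ψ z ∧ ψ z 2 ∈ weightDomain k ∧
      (∀ j, dzbar (dz (coord ψ j)) z = force (speed k (coord ψ 2 z)) (fun i => dz (coord ψ i) z)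
        (fun i => starRingEnd ℂ (dz (coord ψ i) z)) j) ∧ Q z = 0 ∧
      dz (coord ψ 0) z - Complex.I * dz (coord ψ 1) z ≠ 0 ∧ ‖gaussMap ψ z‖ < 1 :=
    hψa.eventually_analyticAt.and (hheight.and (heq.and (hiso.and
      ((hD.eventually_ne hD0).and (hG.norm.eventually (gt_mem_nhds hG0))))))
  obtain ⟨r₁, hr₁, H₁⟩ := Metric.eventually_nhds_iff_ball.1 hall
  obtain ⟨r₂, hr₂, H₂⟩ := Metric.eventually_nhds_iff_ball.1 (hax.and hIs)
  have hball : ∀ t : ℝ, (t : ℂ) ∈ Metric.ball (s : ℂ) (min r₁ r₂) → t ∈ Metric.ball s r₂ := by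
    intro t ht
    rw [Metric.mem_ball, Complex.dist_eq, ← Complex.ofReal_sub, Complex.norm_real,
      Real.norm_eq_abs, ← Real.dist_eq] at ht
    exact lt_of_lt_of_le ht (min_le_right _ _)
  have H₁' : ∀ z ∈ Metric.ball (s : ℂ) (min r₁ r₂), _ := fun z hz =>
    H₁ z (Metric.ball_subset_ball (min_le_left _ _) hz)
  refine ⟨ψ, min r₁ r₂, lt_min hr₁ hr₂, ⟨fun z hz => (H₁' z hz).1, fun z hz => (H₁' z hz).2.1,
    fun z hz => (H₁' z hz).2.2.1, fun z hz => (H₁' z hz).2.2.2.1,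
    fun z hz => (H₁' z hz).2.2.2.2.1, fun z hz => (H₁' z hz).2.2.2.2.2⟩,
    fun t ht => (H₂ t (hball t ht)).1, fun t ht => (H₂ t (hball t ht)).2⟩

/-! ### The geometric Cauchy problem in a strip -/

/-- The coordinates of a map into `ℝ³`, complexified. -/
def complexify (X : ℂ → E3) (z : ℂ) (j : Fin 3) : ℂ := coord X j z

theorem contDiffAt_complexify {X : ℂ → E3} {z : ℂ} {n : WithTop ℕ∞} (hX : ContDiffAt ℝ n X z) :
    ContDiffAt ℝ n (complexify X) z :=
  contDiffAt_pi.2 fun j => contDiffAt_coord hX j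

theorem complexify_injective {X Y : ℂ → E3} {z : ℂ} (h : complexify X z = complexify Y z) :
    X z = Y z := by
  ext j
  exact Complex.ofReal_injective (congrFun h j)

namespace IsConformalSolution

variable {k : ℝ} {ψ : ℂ → E3} {U : Set ℂ} {z : ℂ}

theorem mono (h : IsConformalSolution k ψ U) {W : Set ℂ} (hW : W ⊆ U) :
    IsConformalSolution k ψ W :=
  ⟨h.analytic.mono hW, fun z hz => h.height z (hW hz), fun z hz => h.equation z (hW hz),
    fun z hz => h.isotropic z (hW hz), fun z hz => h.denom_ne_zero z (hW hz),
    fun z hz => h.norm_gaussMap_lt z (hW hz)⟩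

theorem contDiffAt (h : IsConformalSolution k ψ U) (hz : z ∈ U) (n : WithTop ℕ∞) :
    ContDiffAt ℝ n ψ z := (h.analytic z hz).contDiffAt

theorem height_ne_zero (h : IsConformalSolution k ψ U) (hz : z ∈ U) (hk : k ≠ 1) :
    coord ψ 2 z ≠ 0 := Complex.ofReal_ne_zero.2 (h.height z hz hk).ne'

theorem lap_eq (h : IsConformalSolution k ψ U) (hz : z ∈ U) :
    lap (complexify ψ) z = surfaceForce k (complexify ψ z, fderiv ℝ (complexify ψ) z) := by
  rw [lap_eq_surfaceForce_iff (contDiffAt_complexify (h.contDiffAt hz 2))]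
  intro j
  have := h.equation z hz j
  simp only [← dzbar_coord] at this
  exact this

end IsConformalSolution

/-- For real coordinates the `ζ̄`-derivative is the conjugate of the `ζ`-derivative, so the latter
determines the differential. -/
theorem fderiv_complexify_eq {X Y : ℂ → E3} {z : ℂ} (hX : DifferentiableAt ℝ X z)
    (hY : DifferentiableAt ℝ Y z) (h : ∀ j, dz (coord X j) z = dz (coord Y j) z) :
    fderiv ℝ (complexify X) z = fderiv ℝ (complexify Y) z := by
  have hc : ∀ {X : ℂ → E3}, DifferentiableAt ℝ X z → ∀ j, DifferentiableAt ℝ (coord X j) z :=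
    fun hX j => (Complex.ofRealCLM.differentiableAt).comp z
      ((EuclideanSpace.proj j : E3 →L[ℝ] ℝ).differentiableAt.comp z hX)
  have hf : ∀ {X : ℂ → E3}, DifferentiableAt ℝ X z → HasFDerivAt (complexify X)
      (ContinuousLinearMap.pi fun j => fderiv ℝ (coord X j) z) z :=
    fun hX => hasFDerivAt_pi.2 fun j => (hc hX j).hasFDerivAt
  rw [(hf hX).fderiv, (hf hY).fderiv]
  congr 1
  funext j
  have h1 := HasWirtingerAt.of_differentiableAt (hc hX j)
  have h2 := HasWirtingerAt.of_differentiableAt (hc hY j)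
  rw [HasFDerivAt.fderiv h1, HasFDerivAt.fderiv h2, dzbar_coord, dzbar_coord, h]

theorem ofReal_mem_ball_iff {s t r : ℝ} : (t : ℂ) ∈ Metric.ball (s : ℂ) r ↔ t ∈ Metric.ball s r := by
  rw [Metric.mem_ball, Metric.mem_ball, Complex.dist_eq, ← Complex.ofReal_sub, Complex.norm_real,
    Real.norm_eq_abs, ← Real.dist_eq]

theorem re_mem_ball {s r : ℝ} {z : ℂ} (h : z ∈ Metric.ball (s : ℂ) r) :
    (z.re : ℂ) ∈ Metric.ball (s : ℂ) r := by
  rw [ofReal_mem_ball_iff]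
  rw [Metric.mem_ball, Complex.dist_eq] at h
  rw [Metric.mem_ball, Real.dist_eq]
  have := Complex.abs_re_le_norm (z - s)
  simp only [Complex.sub_re, Complex.ofReal_re] at this
  linarith

theorem isPreconnected_ball_inter (s s' : ℂ) (r r' : ℝ) :
    IsPreconnected (Metric.ball s r ∩ Metric.ball s' r') :=
  ((convex_ball s r).inter (convex_ball s' r')).isPreconnected

/-- Solutions with the same Björling data on balls centred on the real axis agree. -/
theorem IsConformalSolution.eqOn_inter {k : ℝ} {β V : ℝ → E3} {ψ ψ' : ℂ → E3} {s s' r r' : ℝ}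
    (h : IsConformalSolution k ψ (Metric.ball (s : ℂ) r))
    (h' : IsConformalSolution k ψ' (Metric.ball (s' : ℂ) r'))
    (hax : HasBjorlingAxis β V ψ (Metric.ball (s : ℂ) r))
    (hax' : HasBjorlingAxis β V ψ' (Metric.ball (s' : ℂ) r')) :
    EqOn ψ ψ' (Metric.ball (s : ℂ) r ∩ Metric.ball (s' : ℂ) r') := by
  intro z hz
  have hopen : IsOpen (Metric.ball (s : ℂ) r ∩ Metric.ball (s' : ℂ) r') :=
    Metric.isOpen_ball.inter Metric.isOpen_ball
  -- Balls centred on the axis contain the real part of each of their points, so a nonempty overlap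
  -- meets the axis. There the Cauchy data agree, and analyticity spreads the equality over the
  -- convex overlap.
  set t := z.re
  have ht : (t : ℂ) ∈ Metric.ball (s : ℂ) r ∩ Metric.ball (s' : ℂ) r' :=
    ⟨re_mem_ball hz.1, re_mem_ball hz.2⟩
  have hnear := hopen.mem_nhds ht
  have hR : Tendsto (fun t : ℝ => (t : ℂ)) (𝓝 t) (𝓝 (t : ℂ)) :=
    Complex.continuous_ofReal.tendsto t
  have hloc : complexify ψ =ᶠ[𝓝 (t : ℂ)] complexify ψ' := by
    refine eventually_eq_of_lap_eq (𝓕 := surfaceForce k)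
      (contDiffAt_complexify (h.contDiffAt ht.1 2)) (contDiffAt_complexify (h'.contDiffAt ht.2 2))
      ?_ ?_ (contDiffAt_surfaceForce fun hk => h.height_ne_zero ht.1 hk) ?_ ?_
    · filter_upwards [hR.eventually hnear] with w hw
      funext j
      simp only [complexify, coord, (hax w hw.1).1, (hax' w hw.2).1]
    · filter_upwards [hR.eventually hnear] with w hw
      refine fderiv_complexify_eq ((h.contDiffAt hw.1 1).differentiableAt one_ne_zero)
        ((h'.contDiffAt hw.2 1).differentiableAt one_ne_zero) fun j => ?_
      rw [(hax w hw.1).2, (hax' w hw.2).2]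
    · filter_upwards [hnear] with w hw using h.lap_eq hw.1
    · filter_upwards [hnear] with w hw using h'.lap_eq hw.2
  have hloc' : ψ =ᶠ[𝓝 (t : ℂ)] ψ' := by
    filter_upwards [hloc] with w hw using complexify_injective hw
  exact (h.analytic.mono inter_subset_left).eqOn_of_preconnected_of_eventuallyEq
    (h'.analytic.mono inter_subset_right) (isPreconnected_ball_inter _ _ _ _) ht hloc' hz

theorem IsConformalSolution.congr {k : ℝ} {ψ ψ' : ℂ → E3} {U : Set ℂ} (hU : IsOpen U)
    (h : IsConformalSolution k ψ U) (he : EqOn ψ' ψ U) : IsConformalSolution k ψ' U := by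
  have hd : ∀ z ∈ U, ∀ j, dz (coord ψ' j) =ᶠ[𝓝 z] dz (coord ψ j) := by
    intro z hz j
    filter_upwards [hU.mem_nhds hz] with w hw
    refine Filter.EventuallyEq.dz_eq ?_
    filter_upwards [hU.mem_nhds hw] with v hv
    simp only [coord, he hv]
  have hd' : ∀ z ∈ U, ∀ j, dz (coord ψ' j) z = dz (coord ψ j) z := fun z hz j =>
    (hd z hz j).self_of_nhds
  refine ⟨h.analytic.congr hU he.symm, fun z hz => ?_, fun z hz j => ?_, fun z hz => ?_,
    fun z hz => ?_, fun z hz => ?_⟩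
  · rw [he hz]; exact h.height z hz
  · rw [(hd z hz j).dzbar_eq, h.equation z hz j]
    simp only [hd' z hz, coord, he hz]
  · simp only [hd' z hz]; exact h.isotropic z hz
  · simp only [hd' z hz]; exact h.denom_ne_zero z hz
  · simp only [gaussMap, hd' z hz]; exact h.norm_gaussMap_lt z hz

theorem IsConformalSolution.iUnion {k : ℝ} {ψ : ℂ → E3} {ι : Type*} {U : ι → Set ℂ}
    (h : ∀ i, IsConformalSolution k ψ (U i)) : IsConformalSolution k ψ (⋃ i, U i) := by
  refine ⟨fun z hz => ?_, fun z hz => ?_, fun z hz => ?_, fun z hz => ?_, fun z hz => ?_,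
    fun z hz => ?_⟩ <;> obtain ⟨i, hi⟩ := mem_iUnion.1 hz
  exacts [(h i).analytic z hi, (h i).height z hi, (h i).equation z hi, (h i).isotropic z hi,
    (h i).denom_ne_zero z hi, (h i).norm_gaussMap_lt z hi]

/-- Every neighbourhood of `I` in the plane contains a strip around `I`. -/
theorem exists_strip_subset {I : Set ℝ} {W : Set ℂ} (hW : IsOpen W) (hIW : ∀ s ∈ I, (s : ℂ) ∈ W) :
    ∃ ε : ℝ → ℝ, Continuous ε ∧ (∀ s ∈ I, 0 < ε s) ∧ strip I ε ⊆ W := by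
  -- Removing one nonreal point makes the complement nonempty, so that the distance to it, the
  -- chosen `ε`, is positive also when `W` is the whole plane.
  set W' := W \ {Complex.I} with hW'
  have hne : (W'ᶜ).Nonempty := ⟨Complex.I, by simp [hW']⟩
  have hop : IsOpen W' := hW.sdiff isClosed_singleton
  refine ⟨fun s => Metric.infDist (s : ℂ) W'ᶜ,
    (Metric.continuous_infDist_pt _).comp Complex.continuous_ofReal, fun s hs => ?_, ?_⟩
  · refine (hop.isClosed_compl.notMem_iff_infDist_pos hne).1 fun h => h ⟨hIW s hs, fun h1 => ?_⟩
    have := congrArg Complex.im (mem_singleton_iff.1 h1)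
    simp at this
  · intro z hz
    have : z ∈ Metric.ball (z.re : ℂ) (Metric.infDist (z.re : ℂ) W'ᶜ) := by
      rw [Metric.mem_ball, Complex.dist_eq]
      have e : z - (z.re : ℂ) = z.im * Complex.I := by
        apply Complex.ext <;> simp
      rw [e, norm_mul, Complex.norm_I, mul_one, Complex.norm_real]
      exact hz.2
    exact (Metric.ball_infDist_compl_subset this).1

theorem isOpen_strip {I : Set ℝ} (hI : IsOpen I) {ε : ℝ → ℝ} (hε : Continuous ε) :
    IsOpen (strip I ε) :=
  (hI.preimage Complex.continuous_re).inter
    (isOpen_lt (continuous_abs.comp Complex.continuous_im) (hε.comp Complex.continuous_re))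

theorem ofReal_mem_strip {I : Set ℝ} {ε : ℝ → ℝ} (hε : ∀ s ∈ I, 0 < ε s) {s : ℝ} (hs : s ∈ I) :
    (s : ℂ) ∈ strip I ε := by
  simpa [strip] using ⟨hs, hε s hs⟩

/-- Solution of the geometric Cauchy problem in a strip around the interval. -/
theorem exists_isConformalSolution_strip {k : ℝ} {I : Set ℝ} {β V : ℝ → E3} (hI : IsOpen I)
    (h : IsBjorlingData k I β V) :
    ∃ (ε : ℝ → ℝ) (ψ : ℂ → E3), Continuous ε ∧ (∀ s ∈ I, 0 < ε s) ∧
      IsConformalSolution k ψ (strip I ε) ∧ HasBjorlingAxis β V ψ (strip I ε) := by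
  have hex := fun s : I => exists_isConformalSolution hI h s.2
  choose ψ₀ r hr hsol hax hreal using hex
  set W : Set ℂ := ⋃ s : I, Metric.ball ((s : ℝ) : ℂ) (r s) with hW
  have hmem : ∀ z ∈ W, ∃ s : I, z ∈ Metric.ball ((s : ℝ) : ℂ) (r s) := fun z hz => mem_iUnion.1 hz
  classical
  set ψ : ℂ → E3 := fun z => if hz : z ∈ W then ψ₀ (hmem z hz).choose z else 0 with hψ
  have hψe : ∀ s : I, EqOn ψ (ψ₀ s) (Metric.ball ((s : ℝ) : ℂ) (r s)) := by
    intro s z hz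
    have hzW : z ∈ W := mem_iUnion.2 ⟨s, hz⟩
    simp only [hψ, hzW, dif_pos]
    exact (hsol _).eqOn_inter (hsol s) (hax _) (hax s) ⟨(hmem z hzW).choose_spec, hz⟩
  have hsolW : IsConformalSolution k ψ W :=
    IsConformalSolution.iUnion fun s => (hsol s).congr Metric.isOpen_ball (hψe s)
  have haxW : HasBjorlingAxis β V ψ W := by
    intro t ht
    obtain ⟨s, hs⟩ := hmem _ ht
    refine ⟨by rw [hψe s hs]; exact (hax s t hs).1, fun j => ?_⟩
    rw [← (hax s t hs).2 j]
    refine Filter.EventuallyEq.dz_eq ?_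
    filter_upwards [Metric.isOpen_ball.mem_nhds hs] with v hv
    simp only [coord, hψe s hv]
  obtain ⟨ε, hεc, hε, hsub⟩ := exists_strip_subset (I := I) (W := W)
    (isOpen_iUnion fun _ => Metric.isOpen_ball)
    (fun s hs => mem_iUnion.2 ⟨⟨s, hs⟩, Metric.mem_ball_self (hr _)⟩)
  exact ⟨ε, ψ, hεc, hε, hsolW.mono hsub, fun t ht => haxW t (hsub ht)⟩

/-! ### The equation of the Gauss map -/

/-- The denominator `(ψ₁ - iψ₂)_ζ` of the Gauss map. -/
def gaussDenom (ψ : ℂ → E3) (z : ℂ) : ℂ := dz (coord ψ 0) z - Complex.I * dz (coord ψ 1) z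

theorem conj_speed (k x : ℝ) : starRingEnd ℂ (speed k (x : ℂ)) = speed k (x : ℂ) := by
  have h2 : starRingEnd ℂ 2 = 2 := map_ofNat _ 2
  unfold speed
  split_ifs <;> simp [h2]

/-- The weights satisfy `φ̈ = -((k-1)/2) φ̇²`, uniformly in `k` including `k = 1`. This is how `k`
enters the equation of the Gauss map. -/
theorem HasWirtingerAt.speed {k : ℝ} {f : ℂ → ℂ} {a b z : ℂ} (hf : HasWirtingerAt f a b z)
    (h0 : k ≠ 1 → f z ≠ 0) :
    HasWirtingerAt (fun z => speed k (f z)) (-((k - 1) / 2) * speed k (f z) ^ 2 * a)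
      (-((k - 1) / 2) * speed k (f z) ^ 2 * b) z := by
  by_cases hk : k = 1
  · subst hk
    simp only [speed_of_one]
    exact (HasWirtingerAt.const 1).congr_deriv (by simp) (by simp)
  · have hk' : (k : ℂ) - 1 ≠ 0 := by
      rw [sub_ne_zero]
      exact_mod_cast hk
    have h := h0 hk
    simp only [WeightedMinimal.speed, hk, if_false, Ring.inverse_eq_inv', smul_eq_mul]
    refine ((hf.inv h).const_mul _).congr_deriv ?_ ?_ <;> push_cast <;> field_simp

namespace IsConformalSolution

variable {k : ℝ} {ψ : ℂ → E3} {U : Set ℂ} {z : ℂ}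

theorem gaussDenom_ne (h : IsConformalSolution k ψ U) (hz : z ∈ U) : gaussDenom ψ z ≠ 0 :=
  h.denom_ne_zero z hz

/-- Isotropy factors as `(φ₁ - iφ₂)(φ₁ + iφ₂) = -φ₃²`. With `φ₃ = ηG` this gives `φ₁ + iφ₂ = -ηG²`,
and one solves for `φ₁` and `φ₂`. -/
theorem dz_coord (h : IsConformalSolution k ψ U) (hz : z ∈ U) :
    dz (coord ψ 0) z = gaussDenom ψ z * (1 - gaussMap ψ z ^ 2) / 2 ∧
    dz (coord ψ 1) z = Complex.I * (gaussDenom ψ z * (1 + gaussMap ψ z ^ 2)) / 2 ∧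
    dz (coord ψ 2) z = gaussDenom ψ z * gaussMap ψ z := by
  have hη := h.gaussDenom_ne hz
  have hi := h.isotropic z hz
  have h2 : dz (coord ψ 2) z = gaussDenom ψ z * gaussMap ψ z := by
    rw [gaussMap, ← gaussDenom, mul_div_cancel₀ _ hη]
  have h3 : dz (coord ψ 0) z + Complex.I * dz (coord ψ 1) z
      = -(gaussDenom ψ z * gaussMap ψ z ^ 2) := by
    apply mul_left_cancel₀ hη
    have : gaussDenom ψ z * (dz (coord ψ 0) z + Complex.I * dz (coord ψ 1) z)
        = -(dz (coord ψ 2) z) ^ 2 := by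
      rw [gaussDenom]
      linear_combination hi - dz (coord ψ 1) z ^ 2 * Complex.I_sq
    rw [this, h2]
    ring
  have h4 : dz (coord ψ 0) z - Complex.I * dz (coord ψ 1) z = gaussDenom ψ z := rfl
  refine ⟨by linear_combination (h3 + h4) / 2, ?_, h2⟩
  linear_combination -Complex.I / 2 * (h3 - h4) + dz (coord ψ 1) z * Complex.I_sq

theorem contDiffAt_dz_coord (h : IsConformalSolution k ψ U) (hz : z ∈ U) (n : WithTop ℕ∞)
    (j : Fin 3) : ContDiffAt ℝ n (dz (coord ψ j)) z :=
  (contDiffAt_dz (m := ω) (contDiffAt_coord (h.contDiffAt hz ω) j) (by simp)).of_le le_top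

theorem contDiffAt_gaussDenom (h : IsConformalSolution k ψ U) (hz : z ∈ U) (n : WithTop ℕ∞) :
    ContDiffAt ℝ n (gaussDenom ψ) z :=
  (h.contDiffAt_dz_coord hz n 0).sub (contDiffAt_const.mul (h.contDiffAt_dz_coord hz n 1))

theorem contDiffAt_gaussMap (h : IsConformalSolution k ψ U) (hz : z ∈ U) (n : WithTop ℕ∞) :
    ContDiffAt ℝ n (gaussMap ψ) z := by
  have : gaussMap ψ = fun z => dz (coord ψ 2) z * (gaussDenom ψ z)⁻¹ :=
    funext fun z => div_eq_mul_inv _ _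
  rw [this]
  exact (h.contDiffAt_dz_coord hz n 2).mul
    ((h.contDiffAt_gaussDenom hz n).inv (h.gaussDenom_ne hz))

theorem hasWirtingerAt_dz_coord (h : IsConformalSolution k ψ U) (hz : z ∈ U) (j : Fin 3) :
    HasWirtingerAt (dz (coord ψ j)) (dz (dz (coord ψ j)) z) (dzbar (dz (coord ψ j)) z) z :=
  .of_differentiableAt ((h.contDiffAt_dz_coord hz 1 j).differentiableAt one_ne_zero)

theorem hasWirtingerAt_gaussDenom (h : IsConformalSolution k ψ U) (hz : z ∈ U) :
    HasWirtingerAt (gaussDenom ψ) (dz (gaussDenom ψ) z)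
      (-(speed k (coord ψ 2 z) / 2) * (gaussDenom ψ z * starRingEnd ℂ (gaussDenom ψ z))
        * starRingEnd ℂ (gaussMap ψ z)
        * (1 - gaussMap ψ z * starRingEnd ℂ (gaussMap ψ z))) z := by
  have h1 := (h.hasWirtingerAt_dz_coord hz 0).sub
    ((h.hasWirtingerAt_dz_coord hz 1).const_mul Complex.I)
  refine HasWirtingerAt.congr_deriv (f := gaussDenom ψ) h1 h1.dz_eq.symm ?_
  obtain ⟨p0, p1, p2⟩ := h.dz_coord hz
  rw [h.equation z hz, h.equation z hz, force, force, if_neg (by decide), if_neg (by decide)]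
  simp only [ smul_eq_mul, p0, p1, p2, map_div₀, map_mul, map_sub, map_add, map_pow, map_one,
    Complex.conj_I, map_ofNat]
  ring_nf
  simp only [Complex.I_sq]
  ring

theorem dzbar_dz_coord_two (h : IsConformalSolution k ψ U) (hz : z ∈ U) :
    dzbar (dz (coord ψ 2)) z = speed k (coord ψ 2 z) / 4
      * (gaussDenom ψ z * starRingEnd ℂ (gaussDenom ψ z))
      * (1 - gaussMap ψ z * starRingEnd ℂ (gaussMap ψ z)) ^ 2 := by
  obtain ⟨p0, p1, p2⟩ := h.dz_coord hz
  rw [h.equation z hz]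
  simp only [force, smul_eq_mul, p0, p1, p2, map_div₀, map_mul, map_sub, map_add, map_pow, map_one,
    Complex.conj_I, map_ofNat, Fin.sum_univ_three, if_true]
  ring_nf
  simp only [Complex.I_sq]
  ring

/-- The quotient rule, with the surface equation replacing the second derivatives: `G_ζ̄` is an
algebraic expression in first derivatives of `ψ` and the height. It yields both the initial value of
`G_ζ̄` and the representation formulas. -/
theorem hasWirtingerAt_gaussMap (h : IsConformalSolution k ψ U) (hz : z ∈ U) :
    HasWirtingerAt (gaussMap ψ) (dz (gaussMap ψ) z)
      (speed k (coord ψ 2 z) / 4 * starRingEnd ℂ (gaussDenom ψ z)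
        * (1 - (gaussMap ψ z * starRingEnd ℂ (gaussMap ψ z)) ^ 2)) z := by
  have hη := h.gaussDenom_ne hz
  have h1 := (h.hasWirtingerAt_dz_coord hz 2).div (h.hasWirtingerAt_gaussDenom hz) hη
  refine HasWirtingerAt.congr_deriv (f := gaussMap ψ) h1 h1.dz_eq.symm ?_
  rw [h.dzbar_dz_coord_two hz, (h.dz_coord hz).2.2]
  field_simp
  ring

theorem one_sub_ne_zero (h : IsConformalSolution k ψ U) (hz : z ∈ U) :
    1 - (gaussMap ψ z * starRingEnd ℂ (gaussMap ψ z)) ^ 2 ≠ 0 := by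
  rw [Complex.mul_conj', ← pow_mul]
  have h1 := h.norm_gaussMap_lt z hz
  have : ‖gaussMap ψ z‖ ^ (2 * 2) < 1 := pow_lt_one₀ (norm_nonneg _) h1 (by norm_num)
  rw [sub_ne_zero]
  exact_mod_cast this.ne'

theorem norm_pow_four (w : ℂ) : (‖w‖ : ℂ) ^ 4 = (w * starRingEnd ℂ w) ^ 2 := by
  rw [Complex.mul_conj', ← pow_mul]

/-- The conjugate of the formula for `G_ζ̄`. Multiplying by `1 - G²`, `i(1 + G²)` or `G` recovers
the derivatives of the coordinates up to the factor `speed`. -/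
theorem density_gaussMap (h : IsConformalSolution k ψ U) (hz : z ∈ U) :
    density (gaussMap ψ) z = speed k (coord ψ 2 z) * gaussDenom ψ z / 4 := by
  have h1 : dz (conjFun (gaussMap ψ)) z = _ := (h.hasWirtingerAt_gaussMap hz).star.dz_eq
  have h0 := h.one_sub_ne_zero hz
  rw [density, h1, norm_pow_four, div_eq_iff h0]
  simp only [coord, map_mul, map_div₀, map_sub, map_pow, map_one, map_ofNat, Complex.conj_conj,
    conj_speed]
  ring

/-- Differentiate `G_ζ̄ = (q/4) η̄ (1 - |G|⁴)` in `ζ` and substitute `qη = 4 conj(G_ζ̄)/(1 - |G|⁴)`.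
The multiples of `-2G|G_ζ̄|²/(1 - |G|⁴)` from `q`, `η̄` and `|G|⁴` are `k - 1`, `1 - |G|²` and
`|G|²`, which add up to `k`. -/
theorem gauss_equation (hU : IsOpen U) (h : IsConformalSolution k ψ U) (hz : z ∈ U) :
    dzbar (dz (gaussMap ψ)) z
      + 2 * ((‖gaussMap ψ z‖ : ℂ) ^ 2 * dz (gaussMap ψ) z * dzbar (gaussMap ψ) z
        / (1 - (‖gaussMap ψ z‖ : ℂ) ^ 4)) * conjFun (gaussMap ψ) z
      + 2 * (k : ℂ) * ((‖dzbar (gaussMap ψ) z‖ : ℂ) ^ 2 / (1 - (‖gaussMap ψ z‖ : ℂ) ^ 4))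
        * gaussMap ψ z = 0 := by
  have h0 := h.one_sub_ne_zero hz
  have hG := h.hasWirtingerAt_gaussMap hz
  have hη := h.hasWirtingerAt_gaussDenom hz
  have hc : HasWirtingerAt (coord ψ 2) (dz (coord ψ 2) z) (dzbar (coord ψ 2) z) z :=
    .of_differentiableAt
      ((contDiffAt_coord (h.contDiffAt hz 1) 2).differentiableAt one_ne_zero)
  have hev : dzbar (gaussMap ψ) =ᶠ[𝓝 z] fun z => speed k (coord ψ 2 z)
      * starRingEnd ℂ (gaussDenom ψ z)
        * (1 - (gaussMap ψ z * starRingEnd ℂ (gaussMap ψ z)) ^ 2) * (1 / 4) := by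
    filter_upwards [hU.mem_nhds hz] with w hw
    rw [(h.hasWirtingerAt_gaussMap hw).dzbar_eq]
    ring
  have hd := ((((hc.speed fun hk => h.height_ne_zero hz hk).mul hη.star).mul
    ((HasWirtingerAt.const 1).sub (hG.mul hG.star).pow_two)).mul (HasWirtingerAt.const (1 / 4)))
  rw [← dz_dzbar_comm (h.contDiffAt_gaussMap hz 2), hev.dz_eq, hd.dz_eq, hG.dzbar_eq,
    ← Complex.mul_conj' (_ * _), norm_pow_four, ← Complex.mul_conj' (gaussMap ψ z),
    (h.dz_coord hz).2.2, conjFun]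
  have hs : starRingEnd ℂ (speed k (coord ψ 2 z)) = speed k (coord ψ 2 z) := conj_speed _ _
  simp only [map_mul, map_neg, map_div₀, map_sub, map_pow, map_one, map_ofNat, Complex.conj_conj,
    hs]
  generalize speed k (coord ψ 2 z) = q at *
  generalize gaussMap ψ z = G at *
  generalize gaussDenom ψ z = η at *
  generalize dz (gaussMap ψ) z = D at *
  generalize starRingEnd ℂ G = Gc at *
  generalize starRingEnd ℂ η = ηc at *
  simp only [mul_comm Gc G]
  generalize 1 - (G * Gc) ^ 2 = T at *
  field_simp
  ring

theorem isGaussSolution {I : Set ℝ} {β V : ℝ → E3} (hU : IsOpen U)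
    (h : IsConformalSolution k ψ U) (hax : HasBjorlingAxis β V ψ U)
    (hIU : ∀ s ∈ I, (s : ℂ) ∈ U) : IsGaussSolution k I β V U (gaussMap ψ) := by
  have hinit : ∀ s ∈ I, gaussMap ψ s = initialGauss β V s := fun s hs => by
    simp only [gaussMap, initialGauss, (hax s (hIU s hs)).2]
  refine ⟨fun z hz => (h.contDiffAt_gaussMap hz 2).contDiffWithinAt,
    fun z hz => (h.norm_gaussMap_lt z hz).ne, fun z hz => h.gauss_equation hU hz, hinit, ?_⟩
  intro s hs
  have hsU := hIU s hs
  have hη : gaussDenom ψ s = phi β V s 0 - Complex.I * phi β V s 1 := by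
    simp only [gaussDenom, (hax s hsU).2]
  rw [(h.hasWirtingerAt_gaussMap hsU).dzbar_eq, hinit s hs, initialGaussDzbar, hη,
    ← norm_pow_four, coord, (hax s hsU).1]
  simp only [map_sub, map_mul, Complex.conj_I]
  by_cases hk : k = 1
  · subst hk
    simp only [speed_of_one, if_true]
    ring
  · have hk' : (k : ℂ) - 1 ≠ 0 := by
      rw [sub_ne_zero]
      exact_mod_cast hk
    have hb : (β s 2 : ℂ) ≠ 0 := by
      have := h.height_ne_zero hsU hk
      rwa [coord, (hax s hsU).1] at this
    simp only [speed, hk, if_false, Ring.inverse_eq_inv', smul_eq_mul]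
    push_cast
    field_simp
    ring

theorem analyticOnNhd_gaussMap (h : IsConformalSolution k ψ U) :
    AnalyticOnNhd ℝ (gaussMap ψ) U :=
  fun _ hz => (h.contDiffAt_gaussMap hz ω).analyticAt

end IsConformalSolution

/-! ### Uniqueness for the Gauss map -/

/-- The right-hand side of the Gauss map equation `ΔG = 𝓕(G, DG)`. -/
def gaussForce (k : ℝ) (J : ℂ × (ℂ →L[ℝ] ℂ)) : ℂ :=
  let p := (J.2 1 - Complex.I * J.2 Complex.I) / 2
  let q := (J.2 1 + Complex.I * J.2 Complex.I) / 2
  let g := J.1 * starRingEnd ℂ J.1;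
  -4 * (2 * (g * p * q * (1 - g ^ 2)⁻¹) * starRingEnd ℂ J.1
    + 2 * (k : ℂ) * (q * starRingEnd ℂ q * (1 - g ^ 2)⁻¹) * J.1)

theorem contDiffAt_gaussForce {k : ℝ} {J : ℂ × (ℂ →L[ℝ] ℂ)} (hJ : ‖J.1‖ ≠ 1) :
    ContDiffAt ℝ 1 (gaussForce k) J := by
  have h1 : ContDiffAt ℝ 1 (fun J : ℂ × (ℂ →L[ℝ] ℂ) => J.1) J := contDiffAt_fst
  have hs : ∀ {f : ℂ × (ℂ →L[ℝ] ℂ) → ℂ}, ContDiffAt ℝ 1 f J →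
      ContDiffAt ℝ 1 (fun J => starRingEnd ℂ (f J)) J := fun hf =>
    Complex.conjCLE.contDiff.contDiffAt.comp J hf
  have h2 : ∀ w, ContDiffAt ℝ 1 (fun J : ℂ × (ℂ →L[ℝ] ℂ) => J.2 w) J := fun w =>
    contDiffAt_snd.clm_apply contDiffAt_const
  have hp := ((h2 1).sub (contDiffAt_const (c := Complex.I).mul (h2 Complex.I))).div_const 2
  have hq := ((h2 1).add (contDiffAt_const (c := Complex.I).mul (h2 Complex.I))).div_const 2
  have hg := h1.mul (hs h1)
  have hr : ContDiffAt ℝ 1 (fun J : ℂ × (ℂ →L[ℝ] ℂ) =>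
      (1 - (J.1 * starRingEnd ℂ J.1) ^ 2)⁻¹) J := by
    refine (contDiffAt_const.sub (hg.pow 2)).inv ?_
    rw [Complex.mul_conj', ← pow_mul, sub_ne_zero]
    intro h
    have h3 : ‖J.1‖ ^ (2 * 2) = 1 := by exact_mod_cast h.symm
    exact hJ ((pow_eq_one_iff_of_nonneg (norm_nonneg _) (by norm_num)).1 h3)
  exact contDiffAt_const.mul ((((contDiffAt_const.mul (((hg.mul hp).mul hq).mul hr)).mul
    (hs h1))).add ((contDiffAt_const.mul ((hq.mul (hs hq)).mul hr)).mul h1))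

theorem lap_eq_four_mul {h : ℂ → ℂ} {z : ℂ} (hh : ContDiffAt ℝ 2 h z) :
    lap h z = 4 * dzbar (dz h) z := by
  rw [← dbar_dhol hh, dzbar_eq_dbar]
  have hd := (contDiffAt_dhol (m := 1) hh (by norm_num)).differentiableAt one_ne_zero
  have : dz h = fun z => (2⁻¹ : ℂ) * dhol h z := funext fun w => by
    rw [dz_eq_dhol, div_eq_inv_mul]
  have h2 : dbar (dz h) z = 2⁻¹ * dbar (dhol h) z := by
    simp only [dbar, this, fderiv_const_mul hd, smul_apply, smul_eq_mul]
    ring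
  rw [h2]
  ring

theorem IsGaussSolution.lap_eq {k : ℝ} {I : Set ℝ} {β V : ℝ → E3} {U : Set ℂ} {G : ℂ → ℂ}
    (hU : IsOpen U) (h : IsGaussSolution k I β V U G) {z : ℂ} (hz : z ∈ U) :
    lap G z = gaussForce k (G z, fderiv ℝ G z) := by
  have hc : ContDiffAt ℝ 2 G z := h.contDiffOn.contDiffAt (hU.mem_nhds hz)
  have he := h.equation z hz
  rw [lap_eq_four_mul hc, gaussForce]
  simp only
  change 4 * dzbar (dz G) z = -4 * (2 * (_ * dz G z * dzbar G z * _) * _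
    + 2 * (k : ℂ) * (dzbar G z * starRingEnd ℂ (dzbar G z) * _) * G z)
  simp only [Complex.mul_conj', ← pow_mul, div_eq_mul_inv, conjFun] at he ⊢
  linear_combination 4 * he

theorem fderiv_eq_zero_of_axis {h : ℂ → ℂ} {t : ℝ} (hh : DifferentiableAt ℝ h t)
    (h0 : ∀ᶠ t' : ℝ in 𝓝 t, h t' = 0) (h1 : dzbar h t = 0) : fderiv ℝ h t = 0 := by
  have h2 : fderiv ℝ h t 1 = 0 := fderiv_one_eq_zero_of_axis hh h0
  refine clm_complex_ext h2 ?_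
  simpa [dzbar, h2] using h1

/-- Uniqueness for the Cauchy problem of the Gauss map. -/
theorem IsGaussSolution.eqOn {k : ℝ} {I : Set ℝ} {β V : ℝ → E3} {U : Set ℂ} {G G' : ℂ → ℂ}
    (hU : IsOpen U) (hUc : IsPreconnected U) (hI : IsOpen I) (hne : I.Nonempty)
    (hIU : ∀ s ∈ I, (s : ℂ) ∈ U) (h : IsGaussSolution k I β V U G)
    (h' : IsGaussSolution k I β V U G') : EqOn G' G U := by
  have hc : ∀ z ∈ U, ContDiffAt ℝ 2 G z := fun z hz => h.contDiffOn.contDiffAt (hU.mem_nhds hz)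
  have hc' : ∀ z ∈ U, ContDiffAt ℝ 2 G' z := fun z hz =>
    h'.contDiffOn.contDiffAt (hU.mem_nhds hz)
  have hd : ∀ z ∈ U, fderiv ℝ (fun z => G' z - G z) z = fderiv ℝ G' z - fderiv ℝ G z :=
    fun z hz => fderiv_fun_sub ((hc' z hz).differentiableAt two_ne_zero)
      ((hc z hz).differentiableAt two_ne_zero)
  have he : ∀ z ∈ U, ∀ᶠ w in 𝓝 z, lap G w = gaussForce k (G w, fderiv ℝ G w) := fun z hz => by
    filter_upwards [hU.mem_nhds hz] with w hw using h.lap_eq hU hw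
  have he' : ∀ z ∈ U, ∀ᶠ w in 𝓝 z, lap G' w = gaussForce k (G' w, fderiv ℝ G' w) :=
    fun z hz => by
      filter_upwards [hU.mem_nhds hz] with w hw using h'.lap_eq hU hw
  obtain ⟨s, hs⟩ := hne
  have hsU := hIU s hs
  have hIs : ∀ᶠ t in 𝓝 s, t ∈ I := hI.mem_nhds hs
  -- Equal values on the axis fix the tangential derivative, and equal `G_ζ̄` then fixes the normal
  -- one.
  have hsame : ∀ t ∈ I, fderiv ℝ G' t = fderiv ℝ G t := by
    intro t ht
    have htU := hIU t ht
    rw [← sub_eq_zero, ← hd _ htU]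
    refine fderiv_eq_zero_of_axis (((hc' _ htU).sub (hc _ htU)).differentiableAt two_ne_zero)
      ?_ ?_
    · filter_upwards [hI.mem_nhds ht] with t' ht'
      rw [h'.initial t' ht', h.initial t' ht', sub_self]
    · have e1 := h'.initial_dzbar t ht
      have e2 := h.initial_dzbar t ht
      rw [← e2] at e1
      simp only [dzbar, hd _ htU, sub_apply] at e1 ⊢
      linear_combination e1
  have hloc : G' =ᶠ[𝓝 (s : ℂ)] G := by
    refine eventually_eq_of_lap_eq (𝓕 := gaussForce k) (hc' _ hsU) (hc _ hsU) ?_ ?_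
      (contDiffAt_gaussForce (h'.norm_ne_one _ hsU)) (he' _ hsU) (he _ hsU)
    · filter_upwards [hIs] with t ht
      rw [h'.initial t ht, h.initial t ht]
    · filter_upwards [hIs] with t ht using hsame t ht
  -- The linear inequality for the difference is available exactly at points where the two `1`-jets
  -- coincide, which is all that weak unique continuation asks for.
  have key := eqOn_zero_of_lap_le (h := fun z => G' z - G z) hU hUc
    (h'.contDiffOn.sub h.contDiffOn) (fun q hq h0 h1 => ?_) hsU
    (by filter_upwards [hloc] with w hw; simp [hw])
  · intro z hz
    exact sub_eq_zero.1 (key hz)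
  · rw [hd q hq] at h1
    exact exists_lap_sub_le (hc' q hq) (hc q hq) (sub_eq_zero.1 h0) (sub_eq_zero.1 h1)
      (contDiffAt_gaussForce (h'.norm_ne_one _ hq)) (he' q hq) (he q hq)

/-! ### Curvature and conformality -/

/-- An injective linear map from the plane has positive Gram determinant. -/
theorem gram_pos {L : ℂ →L[ℝ] E3} (hL : Function.Injective L) :
    0 < inner ℝ (L 1) (L 1) * inner ℝ (L Complex.I) (L Complex.I) - inner ℝ (L 1) (L Complex.I) ^ 2 ∧
      0 < (inner ℝ (L 1) (L 1) : ℝ) := by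
  have h1 : L 1 ≠ 0 := fun h => one_ne_zero (hL (h.trans (map_zero L).symm))
  have hE : 0 < (inner ℝ (L 1) (L 1) : ℝ) := real_inner_self_pos.2 h1
  refine ⟨?_, hE⟩
  set E : ℝ := inner ℝ (L 1) (L 1) with hEd
  set F : ℝ := inner ℝ (L 1) (L Complex.I) with hFd
  -- This vector is `E` times the component of `L i` orthogonal to `L 1`; its squared length is `E`
  -- times the Gram determinant.
  have h2 : E • L Complex.I - F • L 1 ≠ 0 := by
    intro h
    have h3 : L (E • Complex.I - F • (1 : ℂ)) = L 0 := by
      rw [map_sub, map_smul, map_smul, h, map_zero]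
    have h4 := congrArg Complex.im (hL h3)
    simp at h4
    exact hE.ne' h4
  have h5 := real_inner_self_pos.2 h2
  have h6 : (inner ℝ (L Complex.I) (L 1) : ℝ) = F := real_inner_comm _ _
  simp only [inner_sub_left, inner_sub_right, real_inner_smul_left, real_inner_smul_right, h6,
    ← hEd, ← hFd] at h5
  by_contra hcon
  push Not at hcon
  have := mul_nonpos_of_nonneg_of_nonpos hE.le hcon
  linarith

/-- The mean curvature equation tested on normal vectors. -/
theorem meanCurvatureVector_eq_iff {X : ℂ → E3} {p : ℂ}
    (himm : Function.Injective (fderiv ℝ X p)) (y : E3) :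
    meanCurvatureVector X p = normalPart X p y ↔ ∀ n : E3, inner ℝ (partialU X p) n = (0 : ℝ) →
      inner ℝ (partialV X p) n = (0 : ℝ) →
      inner ℝ ((inner ℝ (partialV X p) (partialV X p) : ℝ) • partialU (partialU X) p
        - (2 * (inner ℝ (partialU X p) (partialV X p) : ℝ)) • partialV (partialU X) p
        + (inner ℝ (partialU X p) (partialU X p) : ℝ) • partialV (partialV X) p) n
      = (inner ℝ (partialU X p) (partialU X p) * inner ℝ (partialV X p) (partialV X p)
        - inner ℝ (partialU X p) (partialV X p) ^ 2) * (inner ℝ y n : ℝ) := by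
  set x : E3 := (inner ℝ (partialV X p) (partialV X p) : ℝ) • partialU (partialU X) p
        - (2 * (inner ℝ (partialU X p) (partialV X p) : ℝ)) • partialV (partialU X) p
        + (inner ℝ (partialU X p) (partialU X p) : ℝ) • partialV (partialV X) p with hx
  set d : ℝ := inner ℝ (partialU X p) (partialU X p) * inner ℝ (partialV X p) (partialV X p)
        - inner ℝ (partialU X p) (partialV X p) ^ 2 with hd
  have hd0 : d ≠ 0 := (gram_pos himm).1.ne'
  set K := ((fderiv ℝ X p).toLinearMap.range)ᗮ with hK
  have hmem : ∀ n : E3, n ∈ K ↔ inner ℝ (partialU X p) n = (0 : ℝ) ∧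
      inner ℝ (partialV X p) n = (0 : ℝ) := by
    intro n
    rw [hK, Submodule.mem_orthogonal]
    constructor
    · exact fun h => ⟨h _ ⟨1, rfl⟩, h _ ⟨Complex.I, rfl⟩⟩
    · rintro ⟨h1, h2⟩ _ ⟨w, rfl⟩
      have : w = w.re • (1 : ℂ) + w.im • Complex.I := by simp [Complex.re_add_im]
      change inner ℝ (fderiv ℝ X p w) n = (0 : ℝ)
      rw [this, map_add, map_smul, map_smul, inner_add_left, real_inner_smul_left,
        real_inner_smul_left]
      change _ * inner ℝ (partialU X p) n + _ * inner ℝ (partialV X p) n = 0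
      rw [h1, h2]
      simp
  have hproj : ∀ v : E3, ∀ n ∈ K, (inner ℝ (K.starProjection v) n : ℝ) = inner ℝ v n := by
    intro v n hn
    have := Submodule.starProjection_inner_eq_zero (K := K) v n hn
    rw [inner_sub_left, sub_eq_zero] at this
    exact this.symm
  change d⁻¹ • K.starProjection x = K.starProjection y ↔ _
  constructor
  · intro h n h1 h2
    have hn := (hmem n).2 ⟨h1, h2⟩
    rw [← hproj x n hn, ← hproj y n hn, ← h, real_inner_smul_left, mul_inv_cancel_left₀ hd0]
  · intro h
    -- The difference of the two sides is itself a normal vector, so it can be tested against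
    -- itself.
    rw [← sub_eq_zero, ← inner_self_eq_zero (𝕜 := ℝ)]
    set m := d⁻¹ • K.starProjection x - K.starProjection y with hm
    have hmK : m ∈ K := K.sub_mem (K.smul_mem _ (K.starProjection_apply_mem x))
      (K.starProjection_apply_mem y)
    have h1 := h m ((hmem m).1 hmK).1 ((hmem m).1 hmK).2
    conv_lhs => rw [hm]
    rw [inner_sub_left, real_inner_smul_left, hproj x m hmK, hproj y m hmK, h1,
      inv_mul_cancel_left₀ hd0, sub_self]

/-- Coordinates as real linear maps into `ℂ`. -/
def coordCLM (j : Fin 3) : E3 →L[ℝ] ℂ := Complex.ofRealCLM.comp (EuclideanSpace.proj j)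

theorem fderiv_coord {X : ℂ → E3} {z : ℂ} (hX : DifferentiableAt ℝ X z) (j : Fin 3) (w : ℂ) :
    fderiv ℝ (coord X j) z w = (fderiv ℝ X z w j : ℂ) := by
  have := ((coordCLM j).hasFDerivAt.comp z hX.hasFDerivAt).fderiv
  change fderiv ℝ (coord X j) z = _ at this
  rw [this]
  rfl

theorem fderiv_apply_eq {X : ℂ → E3} {z : ℂ} (hX : DifferentiableAt ℝ X z) (j : Fin 3) (w : ℂ) :
    fderiv ℝ X z w j = 2 * (dz (coord X j) z * w).re := by
  have h1 : DifferentiableAt ℝ (coord X j) z := (coordCLM j).differentiableAt.comp z hX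
  have h2 := HasFDerivAt.fderiv (HasWirtingerAt.of_differentiableAt h1)
  have h3 := fderiv_coord hX j w
  rw [h2, dzbar_coord] at h3
  apply Complex.ofReal_injective
  rw [← h3, ← Complex.add_conj]
  simp

theorem partialU_apply {X : ℂ → E3} {z : ℂ} (hX : DifferentiableAt ℝ X z) (j : Fin 3) :
    partialU X z j = 2 * (dz (coord X j) z).re := by
  rw [partialU, fderiv_apply_eq hX, mul_one]

theorem partialV_apply {X : ℂ → E3} {z : ℂ} (hX : DifferentiableAt ℝ X z) (j : Fin 3) :
    partialV X z j = -(2 * (dz (coord X j) z).im) := by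
  rw [partialV, fderiv_apply_eq hX, Complex.mul_I_re, mul_neg]

/-- This links the real second derivatives in the mean curvature to the complex form of the
equation. -/
theorem laplacian_apply {X : ℂ → E3} {z : ℂ} (hX : ContDiffAt ℝ 2 X z) (j : Fin 3) :
    ((partialU (partialU X) z j + partialV (partialV X) z j : ℝ) : ℂ)
      = 4 * dzbar (dz (coord X j)) z := by
  rw [← lap_eq_four_mul (contDiffAt_coord hX j), lap]
  have hd : ∀ w, DifferentiableAt ℝ (fun z => fderiv ℝ X z w) z := fun w =>
    ((hX.fderiv_right (m := 1) (by norm_num)).clm_apply contDiffAt_const).differentiableAt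
      one_ne_zero
  have h1 : ∀ w, (fun z => fderiv ℝ (coord X j) z w) =ᶠ[𝓝 z]
      coord (fun z => fderiv ℝ X z w) j := by
    intro w
    filter_upwards [hX.eventually (by simp)] with v hv
    exact fderiv_coord (hv.differentiableAt two_ne_zero) j w
  rw [(h1 1).fderiv_eq, (h1 Complex.I).fderiv_eq, fderiv_coord (hd _), fderiv_coord (hd _)]
  push_cast
  rfl

theorem deriv_weight {k x : ℝ} (hx : x ∈ weightDomain k) :
    ((deriv (weight k) x : ℝ) : ℂ) = speed k (x : ℂ) := by
  by_cases hk : k = 1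
  · have : weight k = fun z => z := funext fun z => by simp [weight, hk]
    rw [this, hk, speed_of_one]
    simp
  · have : weight k = fun z => 2 / (k - 1) * Real.log z := funext fun z => by simp [weight, hk]
    rw [this, deriv_const_mul _ (Real.differentiableAt_log (hx hk).ne'), Real.deriv_log]
    simp [speed, hk]

namespace IsConformalSolution

variable {k : ℝ} {ψ : ℂ → E3} {U : Set ℂ} {z : ℂ}

theorem differentiableAt (h : IsConformalSolution k ψ U) (hz : z ∈ U) : DifferentiableAt ℝ ψ z :=
  (h.contDiffAt hz 1).differentiableAt one_ne_zero

theorem isConformalOn (h : IsConformalSolution k ψ U) : IsConformalOn ψ U := by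
  intro z hz
  have hd := h.differentiableAt hz
  have hi := h.isotropic z hz
  simp only [inner_E3, partialU_apply hd, partialV_apply hd]
  have h1 := congrArg Complex.re hi
  have h2 := congrArg Complex.im hi
  simp [sq] at h1 h2
  constructor
  · linear_combination 4 * h1
  · linear_combination -2 * h2

theorem inner_partialU_pos (h : IsConformalSolution k ψ U) (hz : z ∈ U) :
    0 < (inner ℝ (partialU ψ z) (partialU ψ z) : ℝ) := by
  refine real_inner_self_pos.2 fun h0 => ?_
  have hd := h.differentiableAt hz
  have h1 := (h.isConformalOn z hz).1
  rw [h0, inner_zero_left] at h1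
  have h2 : partialV ψ z = 0 := inner_self_eq_zero.1 h1.symm
  have h3 : ∀ j, dz (coord ψ j) z = 0 := by
    intro j
    have e1 := partialU_apply hd j
    have e2 := partialV_apply hd j
    rw [h0] at e1
    rw [h2] at e2
    simp at e1 e2
    exact Complex.ext e1 e2
  apply h.denom_ne_zero z hz
  rw [h3, h3]
  simp

theorem injective_fderiv (h : IsConformalSolution k ψ U) (hz : z ∈ U) :
    Function.Injective (fderiv ℝ ψ z) := by
  rw [injective_iff_map_eq_zero]
  intro w hw
  obtain ⟨c1, c2⟩ := h.isConformalOn z hz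
  have hE := h.inner_partialU_pos hz
  have hw' : w.re • partialU ψ z + w.im • partialV ψ z = 0 := by
    rw [← hw, partialU, partialV, ← map_smul, ← map_smul, ← map_add]
    congr 1
    simp [Complex.re_add_im]
  have h1 := congrArg (fun x => (inner ℝ (partialU ψ z) x : ℝ)) hw'
  have h2 := congrArg (fun x => (inner ℝ (partialV ψ z) x : ℝ)) hw'
  simp only [inner_add_right, real_inner_smul_right, c2, inner_zero_right, ← c1,
    real_inner_comm (partialU ψ z) (partialV ψ z), mul_zero, add_zero, zero_add, mul_eq_zero,
    hE.ne', or_false] at h1 h2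
  exact Complex.ext h1 h2

theorem isGaussMapOn (h : IsConformalSolution k ψ U) : IsGaussMapOn ψ (gaussMap ψ) U := by
  intro z hz
  refine ⟨h.denom_ne_zero z hz, rfl, fun w => ?_⟩
  have hd := h.differentiableAt hz
  obtain ⟨p0, p1, p2⟩ := h.dz_coord hz
  -- Complex bilinear orthogonality of `ψ_ζ` to the unnormalized normal; its real and imaginary
  -- parts give orthogonality to every tangent vector.
  have key : dz (coord ψ 0) z * ((-2 * (gaussMap ψ z).re : ℝ) : ℂ)
      + dz (coord ψ 1) z * ((-2 * (gaussMap ψ z).im : ℝ) : ℂ)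
      + dz (coord ψ 2) z * ((1 - ‖gaussMap ψ z‖ ^ 2 : ℝ) : ℂ) = 0 := by
    rw [p0, p1, p2]
    push_cast
    rw [← Complex.mul_conj', Complex.re_eq_add_conj, Complex.im_eq_sub_conj]
    field_simp
    ring
  rw [unitNormal, real_inner_smul_right, inner_E3]
  simp only [fderiv_apply_eq hd]
  refine mul_eq_zero_of_right _ ?_
  generalize (1 - ‖gaussMap ψ z‖ ^ 2 : ℝ) = m at key ⊢
  have h2 := congrArg (fun x => (x * w).re) key
  simp at h2 ⊢
  linear_combination 2 * h2

/-- Conformality reduces the curvature equation to `⟨Δψ, n⟩ = E φ̇ n₃` for normal `n`. In `Δψ =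
4ψ_ζζ̄` the terms along `ψ_ζ` and `ψ_ζ̄` are tangential, and `E = 2⟨ψ_ζ, ψ_ζ̄⟩`. -/
theorem isMinimalOn (h : IsConformalSolution k ψ U) :
    IsMinimalOn (weight k) (weightDomain k) ψ U := by
  refine ⟨fun z hz => (h.contDiffAt hz ∞).contDiffWithinAt, fun z hz => h.injective_fderiv hz,
    h.height, fun z hz => ?_⟩
  rw [meanCurvatureVector_eq_iff (h.injective_fderiv hz)]
  intro n hu hv
  obtain ⟨c1, c2⟩ := h.isConformalOn z hz
  have hd := h.differentiableAt hz
  have hw := deriv_weight (h.height z hz)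
  set φ' := deriv (weight k) (ψ z 2) with hφ'
  have hlap : ∀ j, partialU (partialU ψ) z j + partialV (partialV ψ) z j
      = 2 * φ' * ((if j = 2 then ∑ i, Complex.normSq (dz (coord ψ i) z) else 0)
        - 2 * ((dz (coord ψ 2) z).re * (dz (coord ψ j) z).re
          + (dz (coord ψ 2) z).im * (dz (coord ψ j) z).im)) := by
    intro j
    apply Complex.ofReal_injective
    rw [laplacian_apply (h.contDiffAt hz 2), h.equation z hz, force, coord, ← hw]
    simp only [smul_eq_mul, Complex.mul_conj, ← Complex.ofReal_sum]
    apply Complex.ext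
    · split_ifs <;> simp <;> ring_nf
    · split_ifs <;> simp <;> ring_nf <;> simp
  have h0 := hlap 0
  have h1 := hlap 1
  have h2 := hlap 2
  simp only [if_true, Fin.sum_univ_three, Complex.normSq_apply] at h2
  rw [if_neg (by decide)] at h0 h1
  have hc := c1
  simp only [inner_E3, partialU_apply hd, partialV_apply hd] at hu hv hc
  rw [c2, ← c1]
  simp only [mul_zero, zero_smul, sub_zero, inner_E3, partialU_apply hd, e3, PiLp.add_apply,
    PiLp.smul_apply, smul_eq_mul]
  simp only [Matrix.cons_val, mul_zero, mul_one, zero_mul, zero_add, add_zero]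
  generalize (dz (coord ψ 0) z).re = a0 at *
  generalize (dz (coord ψ 1) z).re = a1 at *
  generalize (dz (coord ψ 2) z).re = a2 at *
  generalize (dz (coord ψ 0) z).im = b0 at *
  generalize (dz (coord ψ 1) z).im = b1 at *
  generalize (dz (coord ψ 2) z).im = b2 at *
  -- `hu` and `hv` remove the tangential terms; `hc` trades the sum of the squared imaginary parts
  -- for that of the real parts.
  linear_combination 4 * (a0 ^ 2 + a1 ^ 2 + a2 ^ 2) * (n 0 * h0 + n 1 * h1 + n 2 * h2)
    - 8 * (a0 ^ 2 + a1 ^ 2 + a2 ^ 2) * φ' * (a2 * hu - b2 * hv)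
    - 2 * (a0 ^ 2 + a1 ^ 2 + a2 ^ 2) * φ' * n 2 * hc

end IsConformalSolution

/-! ### The representation formulas -/

/-- A function with `P_ζ = f / 2` is the real part of the line integral of `f`. -/
theorem isReIntegral_of_hasWirtingerAt {U : Set ℂ} {ζ₀ : ℂ} {f : ℂ → ℂ} {P : ℂ → ℝ}
    (hf : ContinuousOn f U) (h0 : P ζ₀ = 0)
    (hP : ∀ z ∈ U, HasWirtingerAt (fun z => (P z : ℂ)) (f z / 2) (starRingEnd ℂ (f z / 2)) z) :
    IsReIntegral U ζ₀ f P := by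
  intro ζ _ c hc hc0 hc1 hcU
  have hfc : ContinuousOn (fun t => f (c t) * deriv c t) (uIcc 0 1) := by
    rw [uIcc_of_le zero_le_one]
    exact (hf.comp hc.continuous.continuousOn hcU).mul (hc.continuous_deriv le_rfl).continuousOn
  have hint := hfc.intervalIntegrable (μ := volume)
  -- `P` is a globally defined real primitive, so independence of the path is automatic and no
  -- simple connectivity is used.
  have hre : ∀ t ∈ uIcc (0 : ℝ) 1, HasDerivAt (fun t => P (c t)) (f (c t) * deriv c t).re t := by
    intro t ht
    rw [uIcc_of_le zero_le_one] at ht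
    have h1 := HasFDerivAt.comp_hasDerivAt t (hP _ (hcU t ht))
      (hc.differentiable one_ne_zero t).hasDerivAt
    have h2 : HasDerivAt (fun t => P (c t)) _ t := Complex.reCLM.hasFDerivAt.comp_hasDerivAt t h1
    refine h2.congr_deriv ?_
    have e2 : starRingEnd ℂ 2 = 2 := map_ofNat _ 2
    simp [e2]
    ring
  have hre_int : IntervalIntegrable (fun t => (f (c t) * deriv c t).re) volume 0 1 :=
    (Complex.continuous_re.comp_continuousOn hfc).intervalIntegrable
  have h3 := intervalIntegral.integral_eq_sub_of_hasDerivAt hre hre_int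
  have h4 := Complex.reCLM.intervalIntegral_comp_comm hint
  simp only [Complex.reCLM_apply] at h4
  rw [← h4, h3, hc0, hc1, h0, sub_zero]

namespace IsConformalSolution

variable {k : ℝ} {ψ : ℂ → E3} {U : Set ℂ} {z : ℂ}

theorem hasWirtingerAt_coord (h : IsConformalSolution k ψ U) (hz : z ∈ U) (j : Fin 3) :
    HasWirtingerAt (coord ψ j) (dz (coord ψ j) z) (starRingEnd ℂ (dz (coord ψ j) z)) z :=
  (HasWirtingerAt.of_differentiableAt
    ((contDiffAt_coord (h.contDiffAt hz 1) j).differentiableAt one_ne_zero)).congr_deriv rfl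
    (dzbar_coord ψ j z)

/-- Affine functions of a coordinate as line integrals. -/
theorem isReIntegral_coord (h : IsConformalSolution k ψ U) {ζ₀ : ℂ} {f : ℂ → ℂ} {r : ℝ}
    (j : Fin 3) (hf : ∀ z ∈ U, f z = 2 * r * dz (coord ψ j) z) :
    IsReIntegral U ζ₀ f fun z => r * (ψ z j - ψ ζ₀ j) := by
  refine isReIntegral_of_hasWirtingerAt ?_ (by simp) fun z hz => ?_
  · refine ContinuousOn.congr (fun z hz => ContinuousAt.continuousWithinAt ?_) hf
    exact continuousAt_const.mul (h.contDiffAt_dz_coord hz 1 j).continuousAt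
  · have h1 := ((h.hasWirtingerAt_coord hz j).sub
      (HasWirtingerAt.const (ψ ζ₀ j : ℂ))).const_mul (r : ℂ)
    have h2 : (fun z => ((r * (ψ z j - ψ ζ₀ j) : ℝ) : ℂ))
        = fun z => (r : ℂ) * (coord ψ j z - (ψ ζ₀ j : ℂ)) := by
      funext w
      simp [coord]
    rw [h2, hf z hz]
    refine h1.congr_deriv (by ring) ?_
    have e2 : starRingEnd ℂ 2 = 2 := map_ofNat _ 2
    simp [e2]
    ring

/-- Here `speed` is `1`, so the integrands are one half, one half and one quarter of the derivatives
`ψ¹_ζ`, `ψ²_ζ`, `ψ³_ζ`. The real part of the integral supplies a further one half. -/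
theorem isTranslatingRep (h : IsConformalSolution 1 ψ U) (ζ₀ : ℂ) :
    IsTranslatingRep U ζ₀ (gaussMap ψ) fun z => ψ z - ψ ζ₀ := by
  refine ⟨_, _, _, h.isReIntegral_coord (r := 1 / 4) 0 fun z hz => ?_,
    h.isReIntegral_coord (r := 1 / 4) 1 fun z hz => ?_,
    h.isReIntegral_coord (r := 1 / 8) 2 fun z hz => ?_, fun ζ _ => ?_⟩
  · rw [h.density_gaussMap hz, (h.dz_coord hz).1, speed_of_one]
    push_cast
    ring
  · rw [h.density_gaussMap hz, (h.dz_coord hz).2.1, speed_of_one]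
    push_cast
    ring
  · rw [h.density_gaussMap hz, (h.dz_coord hz).2.2, speed_of_one]
    push_cast
    ring
  · ext j
    fin_cases j <;> simp <;> ring

/-- The third integrand is `ψ³_ζ / (2(k-1)ψ³)`, a logarithmic derivative, so `Γ` is the normalized
height `ψ³ / ψ³(ζ₀)`. Multiplying the density by `Γ` cancels the height in its denominator and makes
the other two integrands constant multiples of `ψ¹_ζ` and `ψ²_ζ`. -/
theorem isSingularRep (h : IsConformalSolution k ψ U) (hk : k ≠ 1) (hk0 : k ≠ 0) {ζ₀ : ℂ}
    (hζ₀ : ζ₀ ∈ U) :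
    ∃ Y, IsSingularRep k U ζ₀ (gaussMap ψ) Y ∧ ∀ ζ ∈ U,
      ψ ζ = !₂[ψ ζ₀ 0, ψ ζ₀ 1, 0] + ((k - 1) * ψ ζ₀ 2 / (2 * k)) • Y ζ := by
  have hk1 : k - 1 ≠ 0 := sub_ne_zero.2 hk
  have hkc : (k : ℂ) - 1 ≠ 0 := by exact_mod_cast hk1
  set b : ℝ := ψ ζ₀ 2 with hb
  have hbpos : 0 < b := h.height ζ₀ hζ₀ hk
  have hbc : (b : ℂ) ≠ 0 := Complex.ofReal_ne_zero.2 hbpos.ne'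
  have hdens : ∀ z ∈ U, density (gaussMap ψ) z
      = gaussDenom ψ z / (2 * ((k : ℂ) - 1) * coord ψ 2 z) := by
    intro z hz
    have hc := h.height_ne_zero hz hk
    rw [h.density_gaussMap hz]
    simp only [speed, hk, if_false, Ring.inverse_eq_inv', smul_eq_mul]
    push_cast
    field_simp
    ring
  refine ⟨fun ζ => !₂[4 * k * ((1 / (2 * (k - 1) * b)) * (ψ ζ 0 - ψ ζ₀ 0)),
    4 * k * ((1 / (2 * (k - 1) * b)) * (ψ ζ 1 - ψ ζ₀ 1)), 2 * k / (k - 1) * (ψ ζ 2 / b)],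
    ⟨_, _, fun ζ => (4 * (k - 1))⁻¹ * Real.log (b⁻¹ * ψ ζ 2), fun ζ => ψ ζ 2 / b, ?_, ?_,
    h.isReIntegral_coord 0 fun z hz => ?_, h.isReIntegral_coord 1 fun z hz => ?_,
    fun ζ _ => rfl⟩, ?_⟩
  · refine isReIntegral_of_hasWirtingerAt (ContinuousOn.congr (f := fun z =>
      gaussDenom ψ z * (2 * ((k : ℂ) - 1) * coord ψ 2 z)⁻¹ * gaussMap ψ z)
      (fun z hz => ContinuousAt.continuousWithinAt ?_) fun z hz => ?_)
      (by simp [← hb, hbpos.ne']) fun z hz => ?_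
    · have hc := h.height_ne_zero hz hk
      exact ((h.contDiffAt_gaussDenom hz 1).continuousAt.mul ((continuousAt_const.mul
        (contDiffAt_coord (h.contDiffAt hz 1) 2).continuousAt).inv₀
        (mul_ne_zero (mul_ne_zero two_ne_zero hkc) hc))).mul
        (h.contDiffAt_gaussMap hz 1).continuousAt
    · rw [hdens z hz, div_eq_mul_inv]
    · have hc := h.height_ne_zero hz hk
      have hpos : 0 < ψ z 2 := h.height z hz hk
      have hW := h.hasWirtingerAt_coord hz 2
      have h1 : HasFDerivAt (fun z => ψ z 2)
          ((EuclideanSpace.proj 2 : E3 →L[ℝ] ℝ).comp (fderiv ℝ ψ z)) z :=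
        (EuclideanSpace.proj 2 : E3 →L[ℝ] ℝ).hasFDerivAt.comp z (h.differentiableAt hz).hasFDerivAt
      have h2 := ((h1.const_mul b⁻¹).log (mul_pos (inv_pos.2 hbpos) hpos).ne').const_mul (4 * (k - 1))⁻¹
      have h3 := Complex.ofRealCLM.hasFDerivAt.comp z h2
      refine HasWirtingerAt.of_hasFDerivAt h3 fun w => ?_
      have h4 := fderiv_coord (h.differentiableAt hz) 2 w
      rw [HasFDerivAt.fderiv hW] at h4
      have h5 : density (gaussMap ψ) z * gaussMap ψ z / 2
          = (((4 * (k - 1) * ψ z 2)⁻¹ : ℝ) : ℂ) * dz (coord ψ 2) z := by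
        rw [hdens z hz, (h.dz_coord hz).2.2]
        push_cast
        rw [show (ψ z 2 : ℂ) = coord ψ 2 z from rfl]
        field_simp
        ring
      have h6 : (Complex.ofRealCLM.comp ((4 * (k - 1))⁻¹ • (b⁻¹ * ψ z 2)⁻¹ • b⁻¹ •
          (EuclideanSpace.proj 2 : E3 →L[ℝ] ℝ).comp (fderiv ℝ ψ z))) w
          = (((4 * (k - 1) * ψ z 2)⁻¹ : ℝ) : ℂ) * (fderiv ℝ ψ z w 2 : ℝ) := by
        rw [← Complex.ofReal_mul]
        change (((4 * (k - 1))⁻¹ * ((b⁻¹ * ψ z 2)⁻¹ * (b⁻¹ * fderiv ℝ ψ z w 2)) : ℝ) : ℂ) = _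
        congr 1
        field_simp
      rw [h5, map_mul, Complex.conj_ofReal, h6, ← h4]
      simp
      ring
  · intro ζ hζ
    have hpos : 0 < ψ ζ 2 := h.height ζ hζ hk
    rw [mul_inv_cancel_left₀ (by simpa using hk1), Real.exp_log (by positivity)]
    exact div_eq_inv_mul _ _
  · have hc := h.height_ne_zero hz hk
    rw [hdens z hz, (h.dz_coord hz).1]
    push_cast
    rw [show (ψ z 2 : ℂ) = coord ψ 2 z from rfl]
    field_simp
  · have hc := h.height_ne_zero hz hk
    rw [hdens z hz, (h.dz_coord hz).2.1]
    push_cast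
    rw [show (ψ z 2 : ℂ) = coord ψ 2 z from rfl]
    field_simp
  · intro ζ _
    ext j
    fin_cases j <;> simp <;> field_simp <;> ring

end IsConformalSolution

/-! ### The equation of minimal surfaces on jets -/

/-- The vector product in `ℝ³`. -/
def cross (a b : E3) : E3 :=
  !₂[a 1 * b 2 - a 2 * b 1, a 2 * b 0 - a 0 * b 2, a 0 * b 1 - a 1 * b 0]

theorem inner_cross (a b : E3) : inner ℝ a (cross a b) = (0 : ℝ) ∧ inner ℝ b (cross a b) = (0 : ℝ) := by
  simp only [inner_E3, cross]
  constructor <;> simp <;> ring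

/-- The square of the triple product is the Gram determinant. -/
theorem inner_cross_sq {n a b : E3} (ha : inner ℝ a n = (0 : ℝ)) (hb : inner ℝ b n = (0 : ℝ)) :
    (inner ℝ n (cross a b) : ℝ) ^ 2
      = inner ℝ n n * (inner ℝ a a * inner ℝ b b - inner ℝ a b ^ 2) := by
  have key : (inner ℝ n (cross a b) : ℝ) ^ 2
      = inner ℝ n n * (inner ℝ a a * inner ℝ b b - inner ℝ a b ^ 2)
        - inner ℝ a n * (inner ℝ a n * inner ℝ b b - inner ℝ b n * inner ℝ a b)
        + inner ℝ b n * (inner ℝ a n * inner ℝ a b - inner ℝ b n * inner ℝ a a) := by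
    simp only [inner_E3, cross]
    simp
    ring
  rw [key, ha, hb]
  ring

/-- The equation of `[φ, e₃]`-minimal surfaces, tested on normal vectors. -/
def SatisfiesMinimalEq (φ : ℝ → ℝ) (X : ℂ → E3) (z : ℂ) : Prop :=
  ∀ n : E3, inner ℝ (fderiv ℝ X z 1) n = (0 : ℝ) → inner ℝ (fderiv ℝ X z Complex.I) n = (0 : ℝ) →
    inner ℝ (fderiv ℝ X z Complex.I) (fderiv ℝ X z Complex.I)
        * inner ℝ (fderiv ℝ (fderiv ℝ X) z 1 1) n
      - 2 * inner ℝ (fderiv ℝ X z 1) (fderiv ℝ X z Complex.I)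
        * inner ℝ (fderiv ℝ (fderiv ℝ X) z Complex.I 1) n
      + inner ℝ (fderiv ℝ X z 1) (fderiv ℝ X z 1)
        * inner ℝ (fderiv ℝ (fderiv ℝ X) z Complex.I Complex.I) n
    = (inner ℝ (fderiv ℝ X z 1) (fderiv ℝ X z 1)
        * inner ℝ (fderiv ℝ X z Complex.I) (fderiv ℝ X z Complex.I)
      - inner ℝ (fderiv ℝ X z 1) (fderiv ℝ X z Complex.I) ^ 2) * (deriv φ (X z 2) * n 2)

theorem fderiv_fderiv_apply {F : Type*} [NormedAddCommGroup F] [NormedSpace ℝ F] {X : ℂ → F}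
    {z : ℂ} (hX : ContDiffAt ℝ 2 X z) (v w : ℂ) :
    fderiv ℝ (fun z => fderiv ℝ X z w) z v = fderiv ℝ (fderiv ℝ X) z v w := by
  have h1 := ((hX.fderiv_right (m := 1) (by norm_num)).differentiableAt one_ne_zero).hasFDerivAt
  rw [(h1.clm_apply (hasFDerivAt_const w z)).fderiv]
  simp

theorem satisfiesMinimalEq_of_isMinimalOn {φ : ℝ → ℝ} {J : Set ℝ} {X : ℂ → E3} {Ω : Set ℂ}
    (hΩ : IsOpen Ω) (h : IsMinimalOn φ J X Ω) {z : ℂ} (hz : z ∈ Ω) : SatisfiesMinimalEq φ X z := by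
  intro n h1 h2
  have hc : ContDiffAt ℝ 2 X z := (h.smooth.contDiffAt (hΩ.mem_nhds hz)).of_le (by norm_cast)
  have := (meanCurvatureVector_eq_iff (h.immersion z hz) _).1 (h.mean_curvature z hz) n h1 h2
  have e : (inner ℝ (deriv φ (X z 2) • e3) n : ℝ) = deriv φ (X z 2) * n 2 := by
    rw [real_inner_smul_left, inner_E3, e3]
    simp
  have a1 := fderiv_fderiv_apply hc 1 1
  have a2 := fderiv_fderiv_apply hc Complex.I 1
  have a3 := fderiv_fderiv_apply hc Complex.I Complex.I
  rw [e, inner_add_left, inner_sub_left, real_inner_smul_left, real_inner_smul_left,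
    real_inner_smul_left] at this
  rw [← a1, ← a2, ← a3]
  exact this

/-- The equation is invariant under changes of parameter. -/
theorem SatisfiesMinimalEq.comp {φ : ℝ → ℝ} {Y : ℂ → E3} {θ : ℂ → ℂ} {z : ℂ}
    (hY : ContDiffAt ℝ 2 Y (θ z)) (hθ : ContDiffAt ℝ 2 θ z)
    (hinj : Function.Injective (fderiv ℝ θ z)) (h : SatisfiesMinimalEq φ Y (θ z)) :
    SatisfiesMinimalEq φ (fun z => Y (θ z)) z := by
  have hd : fderiv ℝ (fun z => Y (θ z)) =ᶠ[𝓝 z]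
      fun w => (fderiv ℝ Y (θ w)).comp (fderiv ℝ θ w) := by
    filter_upwards [hθ.continuousAt.eventually (hY.eventually (by simp)), hθ.eventually (by simp)]
      with w h1 h2
    exact fderiv_comp w (h1.differentiableAt two_ne_zero) (h2.differentiableAt two_ne_zero)
  set A := fderiv ℝ Y (θ z) with hA
  set L := fderiv ℝ θ z with hL
  set B := fderiv ℝ (fderiv ℝ Y) (θ z) with hB
  have h1 : ∀ w, fderiv ℝ (fun z => Y (θ z)) z w = A (L w) := fun w => by
    rw [hd.eq_of_nhds]; rfl
  have hsymm : ∀ v w, B v w = B w v := fun v w =>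
    (hY.isSymmSndFDerivAt (by simp)).eq v w
  -- The second derivative of `θ` contributes only a tangential vector, which normal test vectors do
  -- not see.
  have h2 : ∀ v w, fderiv ℝ (fderiv ℝ (fun z => Y (θ z))) z v w
      = B (L v) (L w) + A (fderiv ℝ (fderiv ℝ θ) z v w) := by
    intro v w
    have hYd := ((hY.fderiv_right (m := 1) (by norm_num)).differentiableAt one_ne_zero).hasFDerivAt
    have hθd := ((hθ.fderiv_right (m := 1) (by norm_num)).differentiableAt one_ne_zero).hasFDerivAt
    have hθ1 := (hθ.differentiableAt two_ne_zero).hasFDerivAt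
    have h3 : HasFDerivAt (fun w => (fderiv ℝ Y (θ w)).comp (fderiv ℝ θ w)) _ z :=
      (hYd.comp z hθ1).clm_comp hθd
    rw [hd.fderiv_eq, h3.fderiv, add_comm (B _ _)]
    rfl
  have hsurj : Function.Surjective L :=
    (LinearMap.injective_iff_surjective (f := L.toLinearMap)).1 hinj
  have hdec : ∀ w : ℂ, w = w.re • (1 : ℂ) + w.im • Complex.I := fun w => by
    simp [Complex.re_add_im]
  intro n hn1 hnI
  simp only [h1] at hn1 hnI
  have hperp : ∀ w, inner ℝ (A w) n = (0 : ℝ) := by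
    intro w
    obtain ⟨v, rfl⟩ := hsurj w
    rw [hdec v, map_add, map_add, map_smul, map_smul, map_smul, map_smul, inner_add_left,
      real_inner_smul_left, real_inner_smul_left, hn1, hnI]
    simp
  have key := h n (hperp 1) (hperp Complex.I)
  simp only [← hA, ← hB] at key
  simp only [h1, h2, inner_add_left, hperp, add_zero]
  set a := (L 1).re
  set b := (L 1).im
  set c := (L Complex.I).re
  set d := (L Complex.I).im
  have e1 : L 1 = a • (1 : ℂ) + b • Complex.I := hdec _
  have e2 : L Complex.I = c • (1 : ℂ) + d • Complex.I := hdec _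
  have s1 : inner ℝ (A Complex.I) (A 1) = (inner ℝ (A 1) (A Complex.I) : ℝ) := real_inner_comm _ _
  rw [e1, e2]
  simp only [map_add, map_smul, add_apply, smul_apply, inner_add_left, inner_add_right,
    real_inner_smul_left, real_inner_smul_right, s1, hsymm 1 Complex.I]
  -- Both sides of the equation scale by the square of the Jacobian determinant of `θ`.
  linear_combination (a * d - b * c) ^ 2 * key

/-- The `2`-jet of a parametrized surface. -/
def jet (X : ℂ → E3) (z : ℂ) : Fin 6 → E3 :=
  ![X z, fderiv ℝ X z 1, fderiv ℝ X z Complex.I, fderiv ℝ (fderiv ℝ X) z 1 1,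
    fderiv ℝ (fderiv ℝ X) z Complex.I 1, fderiv ℝ (fderiv ℝ X) z Complex.I Complex.I]

/-- The equation of `[φ_k, e₃]`-minimal surfaces as a function on jets. -/
def minimalDefect (k : ℝ) (J : Fin 6 → E3) : ℝ :=
  inner ℝ (J 2) (J 2) * inner ℝ (J 3) (cross (J 1) (J 2))
    - 2 * inner ℝ (J 1) (J 2) * inner ℝ (J 4) (cross (J 1) (J 2))
    + inner ℝ (J 1) (J 1) * inner ℝ (J 5) (cross (J 1) (J 2))
    - (inner ℝ (J 1) (J 1) * inner ℝ (J 2) (J 2) - inner ℝ (J 1) (J 2) ^ 2)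
      * (deriv (weight k) (J 0 2) * cross (J 1) (J 2) 2)

theorem SatisfiesMinimalEq.minimalDefect_jet {k : ℝ} {X : ℂ → E3} {z : ℂ}
    (h : SatisfiesMinimalEq (weight k) X z) : minimalDefect k (jet X z) = 0 := by
  have := h (cross (fderiv ℝ X z 1) (fderiv ℝ X z Complex.I)) (inner_cross _ _).1 (inner_cross _ _).2
  rw [← sub_eq_zero] at this
  exact this

theorem contDiffAt_jet_component {J : Fin 6 → E3} (i : Fin 6) (j : Fin 3) :
    ContDiffAt ℝ 1 (fun J : Fin 6 → E3 => J i j) J :=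
  (EuclideanSpace.proj j : E3 →L[ℝ] ℝ).contDiff.contDiffAt.comp J
    (contDiff_apply ℝ E3 i).contDiffAt

theorem contDiffAt_deriv_weight {k x : ℝ} (hx : x ∈ weightDomain k) :
    ContDiffAt ℝ 1 (deriv (weight k)) x := by
  by_cases hk : k = 1
  · have : weight k = fun z => z := funext fun z => by simp [weight, hk]
    rw [this]
    simp only [deriv_id'']
    exact contDiffAt_const
  · have hw : weight k = fun z => 2 / (k - 1) * Real.log z := funext fun z => by simp [weight, hk]
    have h0 : 0 < x := hx hk
    have h1 : ContDiffAt ℝ 2 (weight k) x := by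
      rw [hw]
      exact contDiffAt_const.mul (contDiffAt_id.log h0.ne')
    have h2 := h1.fderiv_right (m := 1) (by norm_num)
    exact h2.clm_apply contDiffAt_const

theorem contDiffAt_minimalDefect {k : ℝ} {J : Fin 6 → E3} (hJ : J 0 2 ∈ weightDomain k) :
    ContDiffAt ℝ 1 (minimalDefect k) J := by
  have hc := fun i j => contDiffAt_jet_component (J := J) i j
  have hw : ContDiffAt ℝ 1 (fun J : Fin 6 → E3 => deriv (weight k) (J 0 2)) J :=
    ContDiffAt.comp (g := deriv (weight k)) (f := fun J : Fin 6 → E3 => J 0 2) J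
      (contDiffAt_deriv_weight hJ) (hc 0 2)
  unfold minimalDefect
  simp only [inner_E3, cross, PiLp.toLp_apply, Matrix.cons_val]
  fun_prop

theorem continuousAt_jet {X : ℂ → E3} {z : ℂ} (hX : ContDiffAt ℝ 2 X z) :
    ContinuousAt (jet X) z := by
  have h1 := (hX.fderiv_right (m := 1) (by norm_num))
  have h2 := (h1.fderiv_right (m := 0) (by norm_num)).continuousAt
  have h1 := h1.continuousAt
  rw [continuousAt_pi]
  intro i
  fin_cases i
  · exact hX.continuousAt
  · exact h1.clm_apply continuousAt_const
  · exact h1.clm_apply continuousAt_const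
  · exact (h2.clm_apply continuousAt_const).clm_apply continuousAt_const
  · exact (h2.clm_apply continuousAt_const).clm_apply continuousAt_const
  · exact (h2.clm_apply continuousAt_const).clm_apply continuousAt_const

/-! ### Normal graphs -/

theorem fderiv_smul_apply {f : ℂ → ℝ} {N : ℂ → E3} {z : ℂ} (hf : DifferentiableAt ℝ f z)
    (hN : DifferentiableAt ℝ N z) (w : ℂ) :
    fderiv ℝ (fun z => f z • N z) z w = f z • fderiv ℝ N z w + fderiv ℝ f z w • N z := by
  rw [(hf.hasFDerivAt.fun_smul hN.hasFDerivAt).fderiv]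
  simp

theorem fderiv_fderiv_smul_apply {f : ℂ → ℝ} {N : ℂ → E3} {z : ℂ} (hf : ContDiffAt ℝ 2 f z)
    (hN : ContDiffAt ℝ 2 N z) (v w : ℂ) :
    fderiv ℝ (fderiv ℝ fun z => f z • N z) z v w = f z • fderiv ℝ (fderiv ℝ N) z v w
      + fderiv ℝ f z v • fderiv ℝ N z w + fderiv ℝ f z w • fderiv ℝ N z v
      + fderiv ℝ (fderiv ℝ f) z v w • N z := by
  have hR : ContDiffAt ℝ 2 (fun z => f z • N z) z := hf.smul hN
  rw [← fderiv_fderiv_apply hR]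
  have h1 : (fun z => fderiv ℝ (fun z => f z • N z) z w)
      =ᶠ[𝓝 z] fun z => f z • fderiv ℝ N z w + fderiv ℝ f z w • N z := by
    filter_upwards [hf.eventually (by simp), hN.eventually (by simp)] with y h1 h2
    exact fderiv_smul_apply (h1.differentiableAt two_ne_zero) (h2.differentiableAt two_ne_zero) w
  have d1 : ∀ {F : Type} [NormedAddCommGroup F] [NormedSpace ℝ F] {g : ℂ → F},
      ContDiffAt ℝ 2 g z → DifferentiableAt ℝ (fun z => fderiv ℝ g z w) z := fun hg =>
    ((hg.fderiv_right (m := 1) (by norm_num)).clm_apply contDiffAt_const).differentiableAt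
      one_ne_zero
  have hf1 := hf.differentiableAt two_ne_zero
  have hN1 := hN.differentiableAt two_ne_zero
  rw [h1.fderiv_eq, fderiv_fun_add (hf1.fun_smul (d1 hN)) ((d1 hf).fun_smul hN1), add_apply,
    fderiv_smul_apply hf1 (d1 hN), fderiv_smul_apply (d1 hf) hN1, fderiv_fderiv_apply hN,
    fderiv_fderiv_apply hf]
  abel

/-- A normal variation adds to the defect its Laplacian, up to terms of lower order. -/
theorem minimalDefect_add {k : ℝ} (J : Fin 6 → E3) (r m t : ℝ) (n : E3)
    (h1 : inner ℝ (J 1) (J 1) = (inner ℝ (J 2) (J 2) : ℝ)) (h2 : inner ℝ (J 1) (J 2) = (0 : ℝ)) :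
    minimalDefect k (J + ![0, 0, 0, r • n, m • n, t • n])
      = minimalDefect k J + inner ℝ (J 1) (J 1) * inner ℝ n (cross (J 1) (J 2)) * (r + t) := by
  unfold minimalDefect
  simp only [Pi.add_apply, Matrix.cons_val, add_zero, inner_add_left, real_inner_smul_left, h2, h1]
  ring

theorem lap_ofReal {f : ℂ → ℝ} {z : ℂ} (hf : ContDiffAt ℝ 2 f z) :
    lap (fun z => (f z : ℂ)) z = ((fderiv ℝ (fderiv ℝ f) z 1 1
      + fderiv ℝ (fderiv ℝ f) z Complex.I Complex.I : ℝ) : ℂ) := by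
  have hcomp : ∀ {g : ℂ → ℝ} {y : ℂ}, DifferentiableAt ℝ g y → ∀ w,
      fderiv ℝ (fun z => (g z : ℂ)) y w = (fderiv ℝ g y w : ℂ) := by
    intro g y hg w
    have : fderiv ℝ (fun z => (g z : ℂ)) y = _ :=
      (Complex.ofRealCLM.hasFDerivAt.comp y hg.hasFDerivAt).fderiv
    rw [this]
    rfl
  have h1 : ∀ w, (fun z => fderiv ℝ (fun z => (f z : ℂ)) z w)
      =ᶠ[𝓝 z] fun z => (fderiv ℝ f z w : ℂ) := by
    intro w
    filter_upwards [hf.eventually (by simp)] with y hy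
    exact hcomp (hy.differentiableAt two_ne_zero) w
  have hd : ∀ w, DifferentiableAt ℝ (fun z => fderiv ℝ f z w) z := fun w =>
    ((hf.fderiv_right (m := 1) (by norm_num)).clm_apply contDiffAt_const).differentiableAt
      one_ne_zero
  rw [lap, (h1 1).fderiv_eq, (h1 Complex.I).fderiv_eq, hcomp (hd _), hcomp (hd _),
    fderiv_fderiv_apply hf, fderiv_fderiv_apply hf]
  push_cast
  rfl

theorem norm_fderiv_ofReal {f : ℂ → ℝ} {z : ℂ} (hf : DifferentiableAt ℝ f z) :
    ‖fderiv ℝ f z‖ ≤ ‖fderiv ℝ (fun z => (f z : ℂ)) z‖ := by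
  have : fderiv ℝ (fun z => (f z : ℂ)) z = Complex.ofRealCLM.comp (fderiv ℝ f z) :=
    (Complex.ofRealCLM.hasFDerivAt.comp z hf.hasFDerivAt).fderiv
  refine ContinuousLinearMap.opNorm_le_bound _ (norm_nonneg _) fun w => ?_
  have h1 := (fderiv ℝ (fun z => (f z : ℂ)) z).le_opNorm w
  have h2 : ‖fderiv ℝ (fun z => (f z : ℂ)) z w‖ = ‖fderiv ℝ f z w‖ := by
    rw [this]
    exact Complex.norm_real _
  rwa [h2] at h1

/-- The difference between the jet of `ψ + fN` and the jet of `ψ` with the Hessian of `f` added in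
the direction of `N`. -/
theorem norm_jet_sub_le {ψ N : ℂ → E3} {f : ℂ → ℝ} {z : ℂ} {M : ℝ} (hψ : ContDiffAt ℝ 2 ψ z)
    (hN : ContDiffAt ℝ 2 N z) (hf : ContDiffAt ℝ 2 f z) (h0 : ‖N z‖ ≤ M)
    (h1 : ‖fderiv ℝ N z‖ ≤ M) (h2 : ‖fderiv ℝ (fderiv ℝ N) z‖ ≤ M) :
    ‖jet (fun z => ψ z + f z • N z) z - (jet ψ z + ![0, 0, 0,
      fderiv ℝ (fderiv ℝ f) z 1 1 • N z, fderiv ℝ (fderiv ℝ f) z Complex.I 1 • N z,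
      fderiv ℝ (fderiv ℝ f) z Complex.I Complex.I • N z])‖
      ≤ 2 * M * (‖f z‖ + ‖fderiv ℝ f z‖) := by
  have hM : 0 ≤ M := (norm_nonneg _).trans h0
  have hR : ContDiffAt ℝ 2 (fun z => f z • N z) z := hf.smul hN
  have d1 : ∀ w, fderiv ℝ (fun z => ψ z + f z • N z) z w = fderiv ℝ ψ z w
      + (f z • fderiv ℝ N z w + fderiv ℝ f z w • N z) := by
    intro w
    rw [fderiv_fun_add (hψ.differentiableAt two_ne_zero) (hR.differentiableAt two_ne_zero),
      add_apply, fderiv_smul_apply (hf.differentiableAt two_ne_zero)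
        (hN.differentiableAt two_ne_zero)]
  have d2 : ∀ v w, fderiv ℝ (fderiv ℝ fun z => ψ z + f z • N z) z v w
      = fderiv ℝ (fderiv ℝ ψ) z v w + (f z • fderiv ℝ (fderiv ℝ N) z v w
      + fderiv ℝ f z v • fderiv ℝ N z w + fderiv ℝ f z w • fderiv ℝ N z v
      + fderiv ℝ (fderiv ℝ f) z v w • N z) := by
    intro v w
    rw [← fderiv_fderiv_smul_apply hf hN]
    have : fderiv ℝ (fun z => ψ z + f z • N z) =ᶠ[𝓝 z]
        fun z => fderiv ℝ ψ z + fderiv ℝ (fun z => f z • N z) z := by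
      filter_upwards [hψ.eventually (by simp), hR.eventually (by simp)] with y e1 e2
      exact fderiv_fun_add (e1.differentiableAt two_ne_zero) (e2.differentiableAt two_ne_zero)
    rw [this.fderiv_eq, fderiv_fun_add
      ((hψ.fderiv_right (m := 1) (by norm_num)).differentiableAt one_ne_zero)
      ((hR.fderiv_right (m := 1) (by norm_num)).differentiableAt one_ne_zero), add_apply, add_apply]
  have hf0 := norm_nonneg (f z)
  have hf1 := norm_nonneg (fderiv ℝ f z)
  have b1 : ∀ w : ℂ, ‖w‖ ≤ 1 → ‖fderiv ℝ f z w‖ ≤ ‖fderiv ℝ f z‖ := fun w hw =>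
    ContinuousLinearMap.unit_le_opNorm _ _ hw
  have b2 : ∀ w : ℂ, ‖w‖ ≤ 1 → ‖fderiv ℝ N z w‖ ≤ M := fun w hw =>
    (ContinuousLinearMap.unit_le_opNorm _ _ hw).trans h1
  have b3 : ∀ v w : ℂ, ‖v‖ ≤ 1 → ‖w‖ ≤ 1 → ‖fderiv ℝ (fderiv ℝ N) z v w‖ ≤ M := fun v w hv hw =>
    (ContinuousLinearMap.unit_le_opNorm _ _ hw).trans
      ((ContinuousLinearMap.unit_le_opNorm _ _ hv).trans h2)
  have c1 : ∀ w : ℂ, ‖w‖ ≤ 1 → ‖fderiv ℝ (fun z => ψ z + f z • N z) z w - fderiv ℝ ψ z w‖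
      ≤ 2 * M * (‖f z‖ + ‖fderiv ℝ f z‖) := by
    intro w hw
    rw [d1, add_sub_cancel_left]
    calc _ ≤ ‖f z‖ * ‖fderiv ℝ N z w‖ + ‖fderiv ℝ f z w‖ * ‖N z‖ := by
          rw [← norm_smul, ← norm_smul]
          exact norm_add_le _ _
      _ ≤ ‖f z‖ * M + ‖fderiv ℝ f z‖ * M := by
          gcongr
          exacts [b2 w hw, b1 w hw]
      _ ≤ _ := by nlinarith
  have c2 : ∀ v w : ℂ, ‖v‖ ≤ 1 → ‖w‖ ≤ 1 → ‖fderiv ℝ (fderiv ℝ fun z => ψ z + f z • N z) z v w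
      - (fderiv ℝ (fderiv ℝ ψ) z v w + fderiv ℝ (fderiv ℝ f) z v w • N z)‖
      ≤ 2 * M * (‖f z‖ + ‖fderiv ℝ f z‖) := by
    intro v w hv hw
    rw [d2, show ∀ a b c d e : E3, a + (b + c + d + e) - (a + e) = b + c + d by intros; abel]
    calc _ ≤ ‖f z‖ * ‖fderiv ℝ (fderiv ℝ N) z v w‖ + ‖fderiv ℝ f z v‖ * ‖fderiv ℝ N z w‖
          + ‖fderiv ℝ f z w‖ * ‖fderiv ℝ N z v‖ := by
          rw [← norm_smul, ← norm_smul, ← norm_smul]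
          exact norm_add₃_le
      _ ≤ ‖f z‖ * M + ‖fderiv ℝ f z‖ * M + ‖fderiv ℝ f z‖ * M := by
          gcongr
          exacts [b3 v w hv hw, b1 v hv, b2 w hw, b1 w hw, b2 v hv]
      _ ≤ _ := by nlinarith
  have n1 : ‖(1 : ℂ)‖ ≤ 1 := by simp
  have nI : ‖Complex.I‖ ≤ 1 := by simp
  rw [pi_norm_le_iff_of_nonneg (by positivity)]
  intro i
  fin_cases i
  · simp only [jet, Pi.sub_apply, Pi.add_apply]
    simp only [Fin.zero_eta, Matrix.cons_val, add_zero, add_sub_cancel_left]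
    rw [norm_smul]
    calc ‖f z‖ * ‖N z‖ ≤ ‖f z‖ * M := by gcongr
      _ ≤ _ := by nlinarith [mul_nonneg hM hf0, mul_nonneg hM hf1]
  · simpa [jet] using c1 1 n1
  · simpa [jet] using c1 Complex.I nI
  · simpa [jet] using c2 1 1 n1 n1
  · simpa [jet] using c2 Complex.I 1 nI n1
  · simpa [jet] using c2 Complex.I Complex.I nI nI

/-- A normal graph over a conformal surface which satisfies the same equation, and which is
tangent to it along the real axis, coincides with it. -/
theorem eventually_eq_zero_of_normal_graph {k : ℝ} {ψ N : ℂ → E3} {f : ℂ → ℝ} {s : ℝ}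
    (hψ : ContDiffAt ℝ 2 ψ s) (hN : ContDiffAt ℝ 2 N s) (hf : ContDiffAt ℝ 2 f s)
    (hdom : ψ s 2 ∈ weightDomain k) (hinj : Function.Injective (fderiv ℝ ψ s))
    (hconf : ∀ᶠ z in 𝓝 (s : ℂ),
      inner ℝ (fderiv ℝ ψ z 1) (fderiv ℝ ψ z 1)
        = (inner ℝ (fderiv ℝ ψ z Complex.I) (fderiv ℝ ψ z Complex.I) : ℝ) ∧
      inner ℝ (fderiv ℝ ψ z 1) (fderiv ℝ ψ z Complex.I) = (0 : ℝ))
    (hnormal : ∀ w, inner ℝ (fderiv ℝ ψ s w) (N s) = (0 : ℝ)) (hN0 : N s ≠ 0)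
    (hmin : ∀ᶠ z in 𝓝 (s : ℂ), SatisfiesMinimalEq (weight k) ψ z)
    (hmin' : ∀ᶠ z in 𝓝 (s : ℂ), SatisfiesMinimalEq (weight k) (fun z => ψ z + f z • N z) z)
    (h0 : ∀ᶠ t : ℝ in 𝓝 s, f t = 0) (h1 : ∀ᶠ t : ℝ in 𝓝 s, fderiv ℝ f t = 0) :
    f =ᶠ[𝓝 (s : ℂ)] 0 := by
  -- An intermediate jet: it keeps the second derivatives of `f` and drops the terms with `f` and
  -- `Df`. Its defect is an explicit multiple of `Δf`, and its distance to the true jet is of lower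
  -- order.
  set ext : ℂ → Fin 6 → E3 := fun z => jet ψ z + ![0, 0, 0, fderiv ℝ (fderiv ℝ f) z 1 1 • N z,
    fderiv ℝ (fderiv ℝ f) z Complex.I 1 • N z,
    fderiv ℝ (fderiv ℝ f) z Complex.I Complex.I • N z] with hext
  set Z : ℂ → E3 := fun z => ψ z + f z • N z with hZ
  have hZc : ContDiffAt ℝ 2 Z s := hψ.add (hf.smul hN)
  obtain ⟨M, hM⟩ : ∃ M : ℝ, ∀ᶠ z in 𝓝 (s : ℂ), ‖N z‖ ≤ M ∧ ‖fderiv ℝ N z‖ ≤ M ∧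
      ‖fderiv ℝ (fderiv ℝ N) z‖ ≤ M := by
    have e1 := (hN.fderiv_right (m := 1) (by norm_num))
    have e2 := (e1.fderiv_right (m := 0) (by norm_num)).continuousAt
    refine ⟨max (‖N s‖ + 1) (max (‖fderiv ℝ N s‖ + 1) (‖fderiv ℝ (fderiv ℝ N) s‖ + 1)), ?_⟩
    filter_upwards [hN.continuousAt.norm.eventually (gt_mem_nhds (lt_add_one _)),
      e1.continuousAt.norm.eventually (gt_mem_nhds (lt_add_one _)),
      e2.norm.eventually (gt_mem_nhds (lt_add_one _))] with z z1 z2 z3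
    exact ⟨z1.le.trans (le_max_left _ _), z2.le.trans ((le_max_left _ _).trans (le_max_right _ _)),
      z3.le.trans ((le_max_right _ _).trans (le_max_right _ _))⟩
  have hdiff : ∀ᶠ z in 𝓝 (s : ℂ), ‖jet Z z - ext z‖ ≤ 2 * M * (‖f z‖ + ‖fderiv ℝ f z‖) := by
    filter_upwards [hM, hψ.eventually (by simp), hN.eventually (by simp), hf.eventually (by simp)]
      with z hz e1 e2 e3
    exact norm_jet_sub_le e1 e2 e3 hz.1 hz.2.1 hz.2.2
  have hbase : jet Z s = ext s := by
    have := hdiff.self_of_nhds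
    rw [h0.self_of_nhds, h1.self_of_nhds] at this
    simpa [sub_eq_zero] using this
  have hextc : ContinuousAt ext s := by
    have e1 := (hf.fderiv_right (m := 1) (by norm_num))
    have e2 := (e1.fderiv_right (m := 0) (by norm_num)).continuousAt
    have e3 : ∀ v w, ContinuousAt (fun z => fderiv ℝ (fderiv ℝ f) z v w • N z) s := fun v w =>
      ((e2.clm_apply continuousAt_const).clm_apply continuousAt_const).smul hN.continuousAt
    refine (continuousAt_jet hψ).add (continuousAt_pi.2 fun i => ?_)
    fin_cases i
    · exact continuousAt_const
    · exact continuousAt_const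
    · exact continuousAt_const
    · exact e3 _ _
    · exact e3 _ _
    · exact e3 _ _
  have hJdom : ext s 0 2 ∈ weightDomain k := by
    simpa [hext, jet] using hdom
  obtain ⟨K, T, hT, hK⟩ := (contDiffAt_minimalDefect hJdom).exists_lipschitzOnWith
  have hTZ : ∀ᶠ z in 𝓝 (s : ℂ), jet Z z ∈ T :=
    (continuousAt_jet hZc).eventually (by rw [hbase]; exact hT)
  have hTe : ∀ᶠ z in 𝓝 (s : ℂ), ext z ∈ T := hextc.eventually hT
  set κ : ℂ → ℝ := fun z => inner ℝ (fderiv ℝ ψ z 1) (fderiv ℝ ψ z 1)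
    * inner ℝ (N z) (cross (fderiv ℝ ψ z 1) (fderiv ℝ ψ z Complex.I)) with hκ
  -- `κ` is the coefficient of `Δf` in the defect. It is nonzero because `N` is a nonzero normal and
  -- the square of the triple product is `|N|²` times the Gram determinant.
  have hκ0 : κ s ≠ 0 := by
    obtain ⟨g1, g2⟩ := gram_pos hinj
    refine mul_ne_zero g2.ne' fun h => ?_
    have e := inner_cross_sq (hnormal 1) (hnormal Complex.I)
    rw [h] at e
    have : (0 : ℝ) < inner ℝ (N s) (N s) := real_inner_self_pos.2 hN0
    have := mul_pos this g1
    linarith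
  have hκc : ContinuousAt κ s := by
    have e1 := (hψ.fderiv_right (m := 1) (by norm_num)).continuousAt
    have hc : ∀ w j, ContinuousAt (fun z => fderiv ℝ ψ z w j) s := fun w j =>
      (EuclideanSpace.proj j : E3 →L[ℝ] ℝ).continuous.continuousAt.comp
        (e1.clm_apply continuousAt_const)
    have hc2 : ∀ j, ContinuousAt (fun z => N z j) s := fun j =>
      (EuclideanSpace.proj j : E3 →L[ℝ] ℝ).continuous.continuousAt.comp hN.continuousAt
    simp only [hκ, inner_E3, cross, Matrix.cons_val]
    fun_prop
  have hκb : ∀ᶠ z in 𝓝 (s : ℂ), ‖κ s‖ / 2 < ‖κ z‖ :=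
    hκc.norm.eventually (lt_mem_nhds (half_lt_self (norm_pos_iff.2 hκ0)))
  have key := eventually_eq_zero_of_lap_le (h := fun z => (f z : ℂ)) (s := s)
    (C := K * (2 * M) * (2 / ‖κ s‖)) (Complex.ofRealCLM.contDiff.contDiffAt.comp _ hf)
    (by filter_upwards [h0] with t ht; simp [ht]) ?_ ?_
  · filter_upwards [key] with z hz
    simpa using hz
  · have hR : Tendsto (fun t : ℝ => (t : ℂ)) (𝓝 s) (𝓝 (s : ℂ)) :=
      Complex.continuous_ofReal.tendsto s
    filter_upwards [h1, hR.eventually (hf.eventually (by simp))] with t ht hd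
    have : fderiv ℝ (fun z => (f z : ℂ)) t = Complex.ofRealCLM.comp (fderiv ℝ f t) :=
      (Complex.ofRealCLM.hasFDerivAt.comp _
        (hd.differentiableAt two_ne_zero).hasFDerivAt).fderiv
    rw [this, ht, ContinuousLinearMap.comp_zero]
  · filter_upwards [hdiff, hTZ, hTe, hκb, hconf, hmin, hmin', hf.eventually (by simp)]
      with z z1 z2 z3 z4 z5 z6 z7 z8
    have e1 := hK.norm_sub_le z2 z3
    rw [z7.minimalDefect_jet, hext] at e1
    simp only at e1
    rw [minimalDefect_add _ _ _ _ _ z5.1 z5.2, z6.minimalDefect_jet, zero_add, zero_sub,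
      norm_neg, norm_mul] at e1
    -- The defects of `jet Z` and of `jet ψ` are zero, so the Lipschitz bound compares `κ Δf` with
    -- the discarded lower order terms.
    have e2 : ‖κ z‖ * ‖lap (fun z => (f z : ℂ)) z‖ ≤ K * ‖jet Z z - ext z‖ := by
      rw [lap_ofReal z8, Complex.norm_real]
      exact e1
    have e3 := norm_fderiv_ofReal (z8.differentiableAt two_ne_zero)
    have hp : 0 < ‖κ s‖ := norm_pos_iff.2 hκ0
    have hM0 : 0 ≤ M := (norm_nonneg _).trans hM.self_of_nhds.1
    have e4 : ‖κ s‖ / 2 * ‖lap (fun z => (f z : ℂ)) z‖ ≤ K * (2 * M) *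
        (‖(f z : ℂ)‖ + ‖fderiv ℝ (fun z => (f z : ℂ)) z‖) := by
      calc _ ≤ ‖κ z‖ * ‖lap (fun z => (f z : ℂ)) z‖ := by gcongr
        _ ≤ K * ‖jet Z z - ext z‖ := e2
        _ ≤ K * (2 * M * (‖f z‖ + ‖fderiv ℝ f z‖)) := by gcongr
        _ ≤ K * (2 * M * (‖(f z : ℂ)‖ + ‖fderiv ℝ (fun z => (f z : ℂ)) z‖)) := by
            rw [Complex.norm_real]
            gcongr
        _ = _ := by ring
    calc ‖lap (fun z => (f z : ℂ)) z‖
        = 2 / ‖κ s‖ * (‖κ s‖ / 2 * ‖lap (fun z => (f z : ℂ)) z‖) := by field_simp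
      _ ≤ 2 / ‖κ s‖ * (K * (2 * M) *
          (‖(f z : ℂ)‖ + ‖fderiv ℝ (fun z => (f z : ℂ)) z‖)) := by gcongr
      _ = _ := by ring

/-! ### Reparametrization -/

theorem eventually_injective_fderiv {E F : Type*} [NormedAddCommGroup E] [NormedSpace ℝ E]
    [NormedAddCommGroup F] [NormedSpace ℝ F] [FiniteDimensional ℝ E] {f : E → F} {a : E}
    (hf : ContDiffAt ℝ 1 f a) (hinj : Function.Injective (fderiv ℝ f a)) :
    ∀ᶠ x in 𝓝 a, Function.Injective (fderiv ℝ f x) := by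
  have h1 := (hf.fderiv_right (m := 0) (by norm_num)).continuousAt
  exact h1.eventually
    ((ContinuousLinearMap.isOpen_injective (𝕜 := ℝ) (E := E) (F := F)).mem_nhds hinj)

/-- The smooth inverse function theorem in equal finite dimensions. -/
theorem exists_smooth_openPartialHomeomorph {E F : Type*} [NormedAddCommGroup E] [NormedSpace ℝ E]
    [NormedAddCommGroup F] [NormedSpace ℝ F] [FiniteDimensional ℝ E] [FiniteDimensional ℝ F]
    (hdim : Module.finrank ℝ E = Module.finrank ℝ F) {f : E → F} {a : E}
    (hf : ∀ᶠ x in 𝓝 a, ContDiffAt ℝ ∞ f x) (hinj : Function.Injective (fderiv ℝ f a)) :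
    ∃ e : OpenPartialHomeomorph E F, a ∈ e.source ∧ (e : E → F) = f ∧
      (∀ x ∈ e.source, ContDiffAt ℝ ∞ f x) ∧ ∀ y ∈ e.target, ContDiffAt ℝ ∞ e.symm y := by
  have : CompleteSpace E := FiniteDimensional.complete ℝ E
  have hequiv : ∀ x, ContDiffAt ℝ ∞ f x → Function.Injective (fderiv ℝ f x) →
      ∃ L : E ≃L[ℝ] F, HasFDerivAt f (L : E →L[ℝ] F) x := by
    intro x hx hi
    refine ⟨(LinearEquiv.ofInjectiveOfFinrankEq (fderiv ℝ f x).toLinearMap hi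
      hdim).toContinuousLinearEquiv, ?_⟩
    convert (hx.differentiableAt (by simp)).hasFDerivAt using 1
    ext w
    rfl
  obtain ⟨L, hL⟩ := hequiv a hf.self_of_nhds hinj
  set e₀ := hf.self_of_nhds.toOpenPartialHomeomorph f hL (by simp) with he₀
  -- Restricting to an open set where `f` is smooth with invertible derivative makes the inverse
  -- smooth on its whole domain, not only at one point.
  have hev := hf.and (eventually_injective_fderiv (hf.self_of_nhds.of_le (by norm_cast)) hinj)
  obtain ⟨S, hS, hSo, haS⟩ := eventually_nhds_iff.1 hev
  refine ⟨e₀.restrOpen S hSo, ?_, rfl, ?_, ?_⟩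
  · exact ⟨hf.self_of_nhds.mem_toOpenPartialHomeomorph_source hL (by simp), haS⟩
  · exact fun x hx => (hS x hx.2).1
  · intro y hy
    have hx := (e₀.restrOpen S hSo).map_target hy
    obtain ⟨L', hL'⟩ := hequiv _ (hS _ hx.2).1 (hS _ hx.2).2
    exact OpenPartialHomeomorph.contDiffAt_symm (e₀.restrOpen S hSo) hy hL' (hS _ hx.2).1

theorem contDiff_unitNormal : ContDiff ℝ ∞ unitNormal := by
  unfold unitNormal
  have hn : ContDiff ℝ ∞ fun w : ℂ => ‖w‖ ^ 2 := contDiff_norm_sq ℝ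
  refine ContDiff.smul ((contDiff_const.add hn).inv fun w => by positivity) ?_
  rw [contDiff_euclidean]
  intro j
  fin_cases j
  · exact contDiff_const.mul Complex.reCLM.contDiff
  · exact contDiff_const.mul Complex.imCLM.contDiff
  · exact contDiff_const.sub hn

theorem norm_unitNormal (w : ℂ) : ‖unitNormal w‖ = 1 := by
  have h : ‖unitNormal w‖ ^ 2 = 1 := by
    have hw : ‖w‖ ^ 2 = w.re ^ 2 + w.im ^ 2 := by
      rw [Complex.sq_norm, Complex.normSq_apply]; ring
    rw [norm_sq_E3, unitNormal, hw]
    simp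
    field_simp
    ring
  exact (pow_eq_one_iff_of_nonneg (norm_nonneg _) two_ne_zero).1 h

theorem SatisfiesMinimalEq.congr {φ : ℝ → ℝ} {X X' : ℂ → E3} {z : ℂ}
    (h : SatisfiesMinimalEq φ X z) (he : X' =ᶠ[𝓝 z] X) : SatisfiesMinimalEq φ X' z := by
  have h1 := he.fderiv (𝕜 := ℝ)
  unfold SatisfiesMinimalEq
  rw [h1.fderiv_eq, h1.eq_of_nhds, he.eq_of_nhds]
  exact h

/-- A surface that is tangent to `ψ` along the real axis is locally a reparametrization of it. -/
theorem IsConformalSolution.exists_reparametrization {k : ℝ} {ψ : ℂ → E3} {U Ω : Set ℂ} {s : ℝ}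
    {Y : ℂ → E3} {c : ℝ → ℂ} (hU : IsOpen U) (h : IsConformalSolution k ψ U) (hs : (s : ℂ) ∈ U)
    (hΩ : IsOpen Ω) (hY : IsMinimalOn (weight k) (weightDomain k) Y Ω) (hc : ContinuousAt c s)
    (hcΩ : c s ∈ Ω) (hYc : ∀ᶠ t in 𝓝 s, Y (c t) = ψ t)
    (hnormal : ∀ᶠ t : ℝ in 𝓝 s, ∀ w,
      inner ℝ (fderiv ℝ Y (c t) w) (unitNormal (gaussMap ψ t)) = (0 : ℝ)) :
    ∃ θ : ℂ → ℂ, (∀ᶠ z in 𝓝 (s : ℂ), ContDiffAt ℝ ∞ θ z ∧ Function.Injective (fderiv ℝ θ z) ∧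
      θ z ∈ Ω ∧ Y (θ z) = ψ z) ∧ ∀ᶠ t : ℝ in 𝓝 s, θ t = c t := by
  set N : ℂ → E3 := fun z => unitNormal (gaussMap ψ z) with hN
  have hNc : ∀ z ∈ U, ContDiffAt ℝ ∞ N z := fun z hz =>
    contDiff_unitNormal.contDiffAt.comp z (h.contDiffAt_gaussMap hz ∞)
  have hYs : ∀ q ∈ Ω, ContDiffAt ℝ ∞ Y q := fun q hq => hY.smooth.contDiffAt (hΩ.mem_nhds hq)
  have hNN : ∀ z, inner ℝ (N z) (N z) = (1 : ℝ) := fun z => by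
    rw [real_inner_self_eq_norm_sq, hN, norm_unitNormal, one_pow]
  have hR : Tendsto (fun t : ℝ => (t : ℂ)) (𝓝 s) (𝓝 (s : ℂ)) :=
    Complex.continuous_ofReal.tendsto s
  -- Inverting `T` at `(z, ψ z)` solves `Y q = ψ z + f N(z)` for `q` and `f`: the competing surface
  -- is written as a normal graph over `ψ`, with `z` carried along as parameter.
  set T : ℂ × (ℂ × ℝ) → ℂ × E3 := fun p => (p.1, Y p.2.1 - p.2.2 • N p.1) with hT
  set a : ℂ × (ℂ × ℝ) := ((s : ℂ), (c s, 0)) with ha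
  have hTc : ∀ᶠ p in 𝓝 a, ContDiffAt ℝ ∞ T p := by
    have h1 : ∀ᶠ p in 𝓝 a, p.1 ∈ U := continuousAt_fst.eventually (hU.mem_nhds hs)
    have h2 : ∀ᶠ p in 𝓝 a, p.2.1 ∈ Ω :=
      (continuous_fst.comp continuous_snd).continuousAt.eventually (hΩ.mem_nhds hcΩ)
    filter_upwards [h1, h2] with p p1 p2
    have e1 : ContDiffAt ℝ ∞ (fun p : ℂ × (ℂ × ℝ) => Y p.2.1) p :=
      ContDiffAt.comp (g := Y) (f := fun p : ℂ × (ℂ × ℝ) => p.2.1) p (hYs _ p2)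
        (contDiff_fst.comp contDiff_snd).contDiffAt
    have e2 : ContDiffAt ℝ ∞ (fun p : ℂ × (ℂ × ℝ) => N p.1) p :=
      ContDiffAt.comp (g := N) (f := fun p : ℂ × (ℂ × ℝ) => p.1) p (hNc _ p1) contDiffAt_fst
    exact contDiffAt_fst.prodMk
      (e1.sub ((contDiff_snd.comp contDiff_snd).contDiffAt.smul e2))
  -- Pairing with `N s` isolates the normal coordinate, because `Y` is tangent to `ψ` there; the
  -- rest is injectivity of the immersion `Y`.
  have hTinj : Function.Injective (fderiv ℝ T a) := by
    have e1 : HasFDerivAt (fun p : ℂ × (ℂ × ℝ) => Y p.2.1) ((fderiv ℝ Y (c s)).comp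
        ((ContinuousLinearMap.fst ℝ ℂ ℝ).comp (ContinuousLinearMap.snd ℝ ℂ (ℂ × ℝ)))) a :=
      HasFDerivAt.comp (g := Y) a ((hYs _ hcΩ).differentiableAt (by simp)).hasFDerivAt
        (hasFDerivAt_fst.comp a hasFDerivAt_snd)
    have e2 : HasFDerivAt (fun p : ℂ × (ℂ × ℝ) => N p.1) ((fderiv ℝ N s).comp
        (ContinuousLinearMap.fst ℝ ℂ (ℂ × ℝ))) a :=
      HasFDerivAt.comp (g := N) a ((hNc _ hs).differentiableAt (by simp)).hasFDerivAt
        hasFDerivAt_fst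
    have e3 : HasFDerivAt (fun p : ℂ × (ℂ × ℝ) => p.2.2)
        ((ContinuousLinearMap.snd ℝ ℂ ℝ).comp (ContinuousLinearMap.snd ℝ ℂ (ℂ × ℝ))) a :=
      hasFDerivAt_snd.comp a hasFDerivAt_snd
    have e4 : HasFDerivAt T _ a := hasFDerivAt_fst.prodMk (e1.sub (e3.fun_smul e2))
    rw [e4.fderiv, injective_iff_map_eq_zero]
    rintro ⟨z', q', f'⟩ hp
    rw [Prod.ext_iff] at hp
    obtain ⟨hp1, hp2⟩ := hp
    have hz : z' = 0 := by simpa using hp1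
    have hp3 : fderiv ℝ Y (c s) q' - f' • N s = 0 := by
      simpa [ha, hz] using hp2
    have h5 := congrArg (fun x => (inner ℝ x (N s) : ℝ)) hp3
    simp only [inner_sub_left, real_inner_smul_left, hNN, inner_zero_left] at h5
    rw [hnormal.self_of_nhds q'] at h5
    have hf : f' = 0 := by linarith
    rw [hf, zero_smul, sub_zero] at hp3
    have hq : q' = 0 := hY.immersion _ hcΩ (hp3.trans (map_zero _).symm)
    rw [hz, hq, hf]
    rfl
  obtain ⟨e, hae, heT, -, hesymm⟩ := exists_smooth_openPartialHomeomorph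
    (by simp [Module.finrank_prod, Complex.finrank_real_complex]) hTc hTinj
  have heT' : ∀ p, e p = T p := fun p => by rw [heT]
  have hTa : T a = ((s : ℂ), ψ s) := by
    simp only [hT, ha, zero_smul, sub_zero, hYc.self_of_nhds]
  set D : ℂ → ℂ × E3 := fun z => (z, ψ z) with hD
  have hDc : ∀ z ∈ U, ContDiffAt ℝ ∞ D z := fun z hz => contDiffAt_id.prodMk (h.contDiffAt hz ∞)
  have hDs : D s ∈ e.target := by
    have := e.map_source hae
    rwa [heT', hTa] at this
  have hesD : e.symm (D s) = a := by
    have := e.left_inv hae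
    rwa [heT', hTa] at this
  set θ : ℂ → ℂ := fun z => (e.symm (D z)).2.1 with hθ
  set f : ℂ → ℝ := fun z => (e.symm (D z)).2.2 with hf
  have hUs : ∀ᶠ z in 𝓝 (s : ℂ), z ∈ U := hU.mem_nhds hs
  have htar : ∀ᶠ z in 𝓝 (s : ℂ), D z ∈ e.target :=
    (hDc _ hs).continuousAt.eventually (e.open_target.mem_nhds hDs)
  have hsm : ∀ᶠ z in 𝓝 (s : ℂ), ContDiffAt ℝ ∞ θ z ∧ ContDiffAt ℝ ∞ f z := by
    filter_upwards [hUs, htar] with z z1 z2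
    have := (hesymm _ z2).comp z (hDc z z1)
    exact ⟨(contDiff_fst.comp contDiff_snd).contDiffAt.comp z this,
      (contDiff_snd.comp contDiff_snd).contDiffAt.comp z this⟩
  have hθs : θ s = c s := by simp only [hθ, hesD, ha]
  have hθΩ : ∀ᶠ z in 𝓝 (s : ℂ), θ z ∈ Ω :=
    hsm.self_of_nhds.1.continuousAt.eventually (hΩ.mem_nhds (by rwa [hθs]))
  have hgraph : ∀ᶠ z in 𝓝 (s : ℂ), Y (θ z) = ψ z + f z • N z := by
    filter_upwards [htar] with z hz
    have e1 := e.right_inv hz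
    rw [heT'] at e1
    simp only [hT, hD, Prod.mk.injEq] at e1
    have e2 := e1.2
    rw [sub_eq_iff_eq_add] at e2
    rw [e1.1] at e2
    exact e2
  -- `(t, c t, 0)` is mapped by `T` to `(t, ψ t)` and, by continuity of `c`, lies in the domain of
  -- the local inverse.
  have haxis : ∀ᶠ t : ℝ in 𝓝 s, θ t = c t ∧ f t = 0 := by
    have h1 : ContinuousAt (fun t : ℝ => ((t : ℂ), (c t, (0 : ℝ)))) s :=
      Complex.continuous_ofReal.continuousAt.prodMk (hc.prodMk continuousAt_const)
    filter_upwards [hYc, h1.eventually (e.open_source.mem_nhds hae)] with t t1 t2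
    have e1 := e.left_inv t2
    rw [heT'] at e1
    simp only [hT, zero_smul, sub_zero, t1] at e1
    simp only [hθ, hf, hD, e1, and_self]
  have hD1 : ∀ᶠ z in 𝓝 (s : ℂ), ∀ w, fderiv ℝ Y (θ z) (fderiv ℝ θ z w)
      = fderiv ℝ ψ z w + (f z • fderiv ℝ N z w + fderiv ℝ f z w • N z) := by
    filter_upwards [hUs, hsm, hθΩ, hgraph.eventually_nhds] with z z1 z2 z3 z4 w
    have e1 : fderiv ℝ (fun z => Y (θ z)) z = (fderiv ℝ Y (θ z)).comp (fderiv ℝ θ z) :=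
      fderiv_comp z ((hYs _ z3).differentiableAt (by simp)) (z2.1.differentiableAt (by simp))
    have d1 := z2.2.differentiableAt (by simp : (∞ : WithTop ℕ∞) ≠ 0)
    have d2 := (hNc z z1).differentiableAt (by simp : (∞ : WithTop ℕ∞) ≠ 0)
    have e2 : (fun z => Y (θ z)) =ᶠ[𝓝 z] fun z => ψ z + f z • N z := z4
    rw [← fderiv_smul_apply d1 d2, ← add_apply,
      ← fderiv_fun_add (h.differentiableAt z1) (d1.fun_smul d2), ← e2.fderiv_eq, e1]
    rfl
  have hgn : ∀ z ∈ U, ∀ w, inner ℝ (fderiv ℝ ψ z w) (N z) = (0 : ℝ) := fun z hz =>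
    (h.isGaussMapOn z hz).2.2
  -- Take the normal component of the differentiated graph equation; both surfaces have normal `N`
  -- along the axis.
  have hf1 : ∀ᶠ t : ℝ in 𝓝 s, fderiv ℝ f t = 0 := by
    filter_upwards [haxis, hR.eventually hD1, hnormal, hR.eventually hUs] with t t1 t2 t3 t4
    refine ContinuousLinearMap.ext fun w => ?_
    have e1 := congrArg (fun x => (inner ℝ x (N t) : ℝ)) (t2 w)
    simp only [t1.1, t1.2, zero_smul, zero_add, inner_add_left, real_inner_smul_left, hNN,
      hgn _ t4, mul_one] at e1
    rw [← e1]
    exact t3 _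
  have hθinj : Function.Injective (fderiv ℝ θ s) := by
    rw [injective_iff_map_eq_zero]
    intro w hw
    have e1 := hD1.self_of_nhds w
    rw [hw, map_zero, haxis.self_of_nhds.2, hf1.self_of_nhds] at e1
    simp only [zero_smul, zero_apply, add_zero] at e1
    exact h.injective_fderiv hs (e1.symm.trans (map_zero _).symm)
  have hle : (2 : WithTop ℕ∞) ≤ ∞ := by norm_cast
  have hθinj' := eventually_injective_fderiv (hsm.self_of_nhds.1.of_le (by norm_cast)) hθinj
  have hf0 : f =ᶠ[𝓝 (s : ℂ)] 0 := by
    refine eventually_eq_zero_of_normal_graph (k := k) (N := N) (h.contDiffAt hs 2)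
      ((hNc _ hs).of_le hle) (hsm.self_of_nhds.2.of_le hle) (h.height _ hs)
      (h.injective_fderiv hs) ?_ (hgn _ hs) ?_ ?_ ?_ (haxis.mono fun _ h => h.2) hf1
    · filter_upwards [hUs] with z hz using h.isConformalOn z hz
    · intro h0
      have := hNN s
      rw [h0, inner_zero_left] at this
      exact zero_ne_one this
    · filter_upwards [hUs] with z hz using satisfiesMinimalEq_of_isMinimalOn hU h.isMinimalOn hz
    · filter_upwards [hsm, hθΩ, hθinj', hgraph.eventually_nhds] with z z1 z2 z3 z4
      refine SatisfiesMinimalEq.congr ?_ (EventuallyEq.symm z4)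
      exact SatisfiesMinimalEq.comp ((hYs _ z2).of_le hle) (z1.1.of_le hle) z3
        (satisfiesMinimalEq_of_isMinimalOn hΩ hY z2)
  refine ⟨θ, ?_, haxis.mono fun _ h => h.1⟩
  filter_upwards [hsm, hθinj', hθΩ, hgraph, hf0] with z z1 z2 z3 z4 z5
  refine ⟨z1.1, z2, z3, ?_⟩
  rw [z4, z5]
  simp

/-! ### Uniqueness of the surface -/

/-- An immersion is locally injective. -/
theorem eventually_injective_of_fderiv {Y : ℂ → E3} {a : ℂ} (hY : ContDiffAt ℝ 1 Y a)
    (hinj : Function.Injective (fderiv ℝ Y a)) :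
    ∀ᶠ p : ℂ × ℂ in 𝓝 (a, a), Y p.1 = Y p.2 → p.1 = p.2 := by
  obtain ⟨K, hK, hanti⟩ := LinearMap.exists_antilipschitzWith (fderiv ℝ Y a).toLinearMap
    (LinearMap.ker_eq_bot.2 hinj)
  -- With error constant `1/(2K)`, two points with equal image would satisfy `|x - y| ≤ |x - y|/2`.
  have hlo := (hY.hasStrictFDerivAt one_ne_zero).isLittleO.def
    (show (0 : ℝ) < 1 / (2 * K) by positivity)
  filter_upwards [hlo] with p hp he
  rw [he, sub_self, zero_sub, norm_neg] at hp
  have h1 := hanti.le_mul_dist p.1 p.2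
  rw [dist_eq_norm, dist_eq_norm] at h1
  change _ ≤ K * ‖fderiv ℝ Y a p.1 - fderiv ℝ Y a p.2‖ at h1
  rw [← map_sub] at h1
  have hK' : (0 : ℝ) < K := hK
  have h2 : ‖p.1 - p.2‖ ≤ ‖p.1 - p.2‖ / 2 := by
    calc ‖p.1 - p.2‖ ≤ K * ‖fderiv ℝ Y a (p.1 - p.2)‖ := h1
      _ ≤ K * (1 / (2 * K) * ‖p.1 - p.2‖) := by gcongr
      _ = ‖p.1 - p.2‖ / 2 := by field_simp
  have h3 : ‖p.1 - p.2‖ ≤ 0 := by linarith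
  exact sub_eq_zero.1 (norm_le_zero_iff.1 h3)

section Surface

variable {φ : ℝ → ℝ} {J : Set ℝ} {S : Type*} [TopologicalSpace S] [ChartedSpace ℂ S] {X : S → E3}

theorem IsMinimalImmersion.contDiffAt (h : IsMinimalImmersion φ J X) (p : S) {q : ℂ}
    (hq : q ∈ (chartAt ℂ p).target) : ContDiffAt ℝ ∞ (X ∘ (chartAt ℂ p).symm) q :=
  (h p).smooth.contDiffAt ((chartAt ℂ p).open_target.mem_nhds hq)

theorem IsMinimalImmersion.eventually_injective (h : IsMinimalImmersion φ J X) (p : S) :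
    ∀ᶠ q : S × S in 𝓝 (p, p), X q.1 = X q.2 → q.1 = q.2 := by
  set χ := chartAt ℂ p
  have hp : p ∈ χ.source := mem_chart_source ℂ p
  have hχp : χ p ∈ χ.target := χ.map_source hp
  have h1 := eventually_injective_of_fderiv ((h.contDiffAt p hχp).of_le (by norm_cast))
    ((h p).immersion _ hχp)
  have hc : ContinuousAt (fun q : S × S => (χ q.1, χ q.2)) (p, p) :=
    ContinuousAt.prodMk (ContinuousAt.comp (x := ((p, p) : S × S)) (χ.continuousAt hp) continuousAt_fst)
      (ContinuousAt.comp (x := ((p, p) : S × S)) (χ.continuousAt hp) continuousAt_snd)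
  have hs : ∀ᶠ q : S × S in 𝓝 (p, p), q.1 ∈ χ.source ∧ q.2 ∈ χ.source :=
    (continuousAt_fst.eventually (χ.open_source.mem_nhds hp)).and
      (continuousAt_snd.eventually (χ.open_source.mem_nhds hp))
  filter_upwards [hc.eventually h1, hs] with q q1 q2 he
  have : χ q.1 = χ q.2 := q1 (by
    simp only [Function.comp_apply]
    rw [χ.left_inv q2.1, χ.left_inv q2.2, he])
  exact χ.injOn q2.1 q2.2 this

/-- In a chart, the tangent planes are the ranges of the manifold derivative. -/
theorem IsMinimalImmersion.fderiv_chart [IsManifold 𝓘(ℝ, ℂ) ∞ S] (h : IsMinimalImmersion φ J X)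
    (p : S) {q : S} (hq : q ∈ (chartAt ℂ p).source) (w : ℂ) :
    ∃ w' : TangentSpace 𝓘(ℝ, ℂ) q, fderiv ℝ (X ∘ (chartAt ℂ p).symm) (chartAt ℂ p q) w
      = mfderiv 𝓘(ℝ, ℂ) 𝓘(ℝ, E3) X q w' := by
  have : IsManifold 𝓘(ℝ, ℂ) 1 S := IsManifold.of_le (m := 1) (n := ∞) (by norm_cast)
  set χ := chartAt ℂ p
  have hχ : χ q ∈ χ.target := χ.map_source hq
  have hχm : MDifferentiableAt 𝓘(ℝ, ℂ) 𝓘(ℝ, ℂ) χ q :=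
    mdifferentiableAt_atlas (chart_mem_atlas ℂ p) hq
  have hχs : MDifferentiableAt 𝓘(ℝ, ℂ) 𝓘(ℝ, ℂ) χ.symm (χ q) :=
    mdifferentiableAt_atlas_symm (chart_mem_atlas ℂ p) hχ
  have hY : MDifferentiableAt 𝓘(ℝ, ℂ) 𝓘(ℝ, E3) (X ∘ χ.symm) (χ q) :=
    ((h.contDiffAt p hχ).differentiableAt (by simp)).mdifferentiableAt
  have hX : MDifferentiableAt 𝓘(ℝ, ℂ) 𝓘(ℝ, E3) X q := by
    refine (MDifferentiableAt.comp q hY hχm).congr_of_eventuallyEq ?_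
    filter_upwards [χ.open_source.mem_nhds hq] with q' hq'
    simp only [Function.comp_apply, χ.left_inv hq']
  have hX' : MDifferentiableAt 𝓘(ℝ, ℂ) 𝓘(ℝ, E3) X (χ.symm (χ q)) := by rwa [χ.left_inv hq]
  have key := mfderiv_comp (χ q) hX' hχs
  rw [mfderiv_eq_fderiv] at key
  have key2 : ∃ w' : TangentSpace 𝓘(ℝ, ℂ) (χ.symm (χ q)),
      fderiv ℝ (X ∘ χ.symm) (χ q) w = mfderiv 𝓘(ℝ, ℂ) 𝓘(ℝ, E3) X (χ.symm (χ q)) w' :=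
    ⟨mfderiv 𝓘(ℝ, ℂ) 𝓘(ℝ, ℂ) χ.symm (χ q) w, by rw [key]; rfl⟩
  rwa [χ.left_inv hq] at key2

theorem isLocalDiffeomorphAt_of_fderiv_injective {θ : ℂ → ℂ} {z : ℂ}
    (hθ : ∀ᶠ w in 𝓝 z, ContDiffAt ℝ ∞ θ w) (hinj : Function.Injective (fderiv ℝ θ z)) :
    IsLocalDiffeomorphAt 𝓘(ℝ, ℂ) 𝓘(ℝ, ℂ) ∞ θ z := by
  obtain ⟨e, hz, he, hsm, hsm'⟩ := exists_smooth_openPartialHomeomorph rfl hθ hinj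
  refine ⟨⟨e.toPartialEquiv, e.open_source, e.open_target, ?_, ?_⟩, hz, fun w _ => ?_⟩
  · change ContMDiffOn 𝓘(ℝ, ℂ) 𝓘(ℝ, ℂ) ∞ (e : ℂ → ℂ) e.source
    rw [he, contMDiffOn_iff_contDiffOn]
    exact fun w hw => (hsm w hw).contDiffWithinAt
  · change ContMDiffOn 𝓘(ℝ, ℂ) 𝓘(ℝ, ℂ) ∞ (e.symm : ℂ → ℂ) e.target
    rw [contMDiffOn_iff_contDiffOn]
    exact fun w hw => (hsm' w hw).contDiffWithinAt
  · change θ w = (e : ℂ → ℂ) w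
    rw [he]

theorem isLocalDiffeomorphAt_chart_symm [IsManifold 𝓘(ℝ, ℂ) ∞ S] (p : S) {q : ℂ}
    (hq : q ∈ (chartAt ℂ p).target) :
    IsLocalDiffeomorphAt 𝓘(ℝ, ℂ) 𝓘(ℝ, ℂ) ∞ (chartAt ℂ p).symm q :=
  ⟨⟨(chartAt ℂ p).symm.toPartialEquiv, (chartAt ℂ p).open_target, (chartAt ℂ p).open_source,
    contMDiffOn_chart_symm, contMDiffOn_chart⟩, hq, fun _ _ => rfl⟩

theorem isLocalDiffeomorphAt_congr {g g' : ℂ → S} {z : ℂ}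
    (hg : IsLocalDiffeomorphAt 𝓘(ℝ, ℂ) 𝓘(ℝ, ℂ) ∞ g z) (he : g' =ᶠ[𝓝 z] g) :
    IsLocalDiffeomorphAt 𝓘(ℝ, ℂ) 𝓘(ℝ, ℂ) ∞ g' z := by
  obtain ⟨Φ, hz, hΦ⟩ := hg
  obtain ⟨A, hA, hAo, hzA⟩ := eventually_nhds_iff.1 he
  set e := Φ.toOpenPartialHomeomorph.restrOpen A hAo
  have hsub : e.source ⊆ Φ.source := fun x hx => hx.1
  have hsub' : e.target ⊆ Φ.target := fun x hx => hx.1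
  exact ⟨⟨e.toPartialEquiv, e.open_source, e.open_target, Φ.contMDiffOn_toFun.mono hsub,
    Φ.contMDiffOn_invFun.mono hsub'⟩, ⟨hz, hzA⟩, fun x hx => (hA x hx.2).trans (hΦ hx.1)⟩

end Surface

section Uniqueness

variable {k : ℝ} {I : Set ℝ} {β V : ℝ → E3} {ψ : ℂ → E3} {U : Set ℂ}

/-- Local uniqueness of the surface solving the geometric Cauchy problem. -/
theorem SolvesCauchyProblem.exists_local_lift {S : Type*} [TopologicalSpace S] [ChartedSpace ℂ S]
    [IsManifold 𝓘(ℝ, ℂ) ∞ S] {X : S → E3} {γ : ℝ → S} (hX : SolvesCauchyProblem k I β V X γ)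
    (hI : IsOpen I) (hdata : IsBjorlingData k I β V) (hU : IsOpen U)
    (h : IsConformalSolution k ψ U) (hax : HasBjorlingAxis β V ψ U)
    (hIU : ∀ s ∈ I, (s : ℂ) ∈ U) {s : ℝ} (hs : s ∈ I) :
    ∃ g : ℂ → S, (∀ᶠ z in 𝓝 (s : ℂ), IsLocalDiffeomorphAt 𝓘(ℝ, ℂ) 𝓘(ℝ, ℂ) ∞ g z ∧
      X (g z) = ψ z) ∧ ∀ᶠ t : ℝ in 𝓝 s, g t = γ t := by
  set χ := chartAt ℂ (γ s) with hχ
  have hIs : ∀ᶠ t in 𝓝 s, t ∈ I := hI.mem_nhds hs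
  have hγ : ContinuousAt γ s := hX.continuous_lift.continuousAt (hI.mem_nhds hs)
  have hsrc : γ s ∈ χ.source := mem_chart_source ℂ (γ s)
  have hγs : ∀ᶠ t in 𝓝 s, γ t ∈ χ.source := hγ.eventually (χ.open_source.mem_nhds hsrc)
  -- Along the curve the normal of `ψ` is the prescribed field, so the competing surface is tangent
  -- to `ψ` there.
  have hN : ∀ t ∈ I, unitNormal (gaussMap ψ t) = V t := fun t ht => by
    rw [← hdata.unitNormal_initialGauss ht]
    congr 1
    simp only [gaussMap, initialGauss, (hax t (hIU t ht)).2]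
  obtain ⟨θ, hθ, hθax⟩ := h.exists_reparametrization (c := fun t => χ (γ t)) hU (hIU s hs)
    χ.open_target (hX.minimal (γ s)) ((χ.continuousAt hsrc).comp hγ) (χ.map_source hsrc)
    (by
      filter_upwards [hIs, hγs] with t t1 t2
      rw [Function.comp_apply, χ.left_inv t2, hX.contains t t1, (hax t (hIU t t1)).1])
    (by
      filter_upwards [hIs, hγs] with t t1 t2 w
      obtain ⟨w', hw'⟩ := hX.minimal.fderiv_chart (γ s) t2 w
      rw [hw', hN t t1]
      exact (real_inner_comm (V t) _).trans (hX.normal t t1 w'))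
  refine ⟨fun z => χ.symm (θ z), ?_, ?_⟩
  · filter_upwards [hθ.eventually_nhds] with z hz
    obtain ⟨-, z2, z3, z4⟩ := hz.self_of_nhds
    refine ⟨?_, z4⟩
    exact IsLocalDiffeomorphAt.comp 𝓘(ℝ, ℂ) S
      (isLocalDiffeomorphAt_of_fderiv_injective (hz.mono fun _ h => h.1) z2)
      (isLocalDiffeomorphAt_chart_symm (γ s) z3)
  · filter_upwards [hθax, hγs] with t t1 t2
    rw [t1, χ.left_inv t2]

/-- Two lifts of `ψ` through an immersion that agree near a point agree on connected sets. -/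
theorem IsMinimalImmersion.eqOn_of_lift {φ : ℝ → ℝ} {J : Set ℝ} {S : Type*} [TopologicalSpace S]
    [T2Space S] [ChartedSpace ℂ S] {X : S → E3} (hX : IsMinimalImmersion φ J X) {C : Set ℂ}
    (hC : IsPreconnected C) (hCo : IsOpen C) {g g' : ℂ → S} (hg : ∀ z ∈ C, ContinuousAt g z)
    (hg' : ∀ z ∈ C, ContinuousAt g' z) (he : ∀ z ∈ C, X (g z) = X (g' z)) {z₀ : ℂ} (hz₀ : z₀ ∈ C)
    (h0 : g z₀ = g' z₀) : EqOn g g' C := by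
  -- Local injectivity of `X` makes the coincidence set open; that it is closed in `C` follows from
  -- the Hausdorff property.
  have hloc : ∀ z ∈ C, g z = g' z → g =ᶠ[𝓝 z] g' := by
    intro z hz hzz
    have h1 := hX.eventually_injective (g z)
    have h2 : Tendsto (fun w => (g w, g' w)) (𝓝 z) (𝓝 (g z, g z)) := by
      have := (hg z hz).prodMk (hg' z hz)
      simp only [ContinuousAt, ← hzz] at this
      exact this
    filter_upwards [h2.eventually h1, hCo.mem_nhds hz] with w w1 w2
    exact w1 (he w w2)
  suffices hs : C ⊆ {z | g =ᶠ[𝓝 z] g'} from fun z hz => (hs hz).eq_of_nhds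
  refine hC.subset_of_closure_inter_subset isOpen_setOfPred_eventually_nhds
    ⟨z₀, hz₀, hloc z₀ hz₀ h0⟩ ?_
  rintro z ⟨hzc, hz⟩
  refine hloc z hz (tendsto_nhds_unique_of_frequently_eq (hg z hz) (hg' z hz) ?_)
  exact (mem_closure_iff_frequently.1 hzc).mono fun w hw => EventuallyEq.eq_of_nhds hw

/-- Uniqueness of the surface solving the geometric Cauchy problem. -/
theorem SolvesCauchyProblem.exists_lift {S : Type*} [TopologicalSpace S] [T2Space S]
    [ChartedSpace ℂ S] [IsManifold 𝓘(ℝ, ℂ) ∞ S] {X : S → E3} {γ : ℝ → S}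
    (hX : SolvesCauchyProblem k I β V X γ) (hI : IsOpen I) (hdata : IsBjorlingData k I β V)
    (hU : IsOpen U) (h : IsConformalSolution k ψ U) (hax : HasBjorlingAxis β V ψ U)
    (hIU : ∀ s ∈ I, (s : ℂ) ∈ U) :
    ∃ (W : Set ℂ) (g : ℂ → S), IsOpen W ∧ W ⊆ U ∧ (∀ s ∈ I, (s : ℂ) ∈ W) ∧
      IsLocalDiffeomorphOn 𝓘(ℝ, ℂ) 𝓘(ℝ, ℂ) ∞ g W ∧
      (∀ s ∈ I, g (s : ℂ) = γ s) ∧ ∀ z ∈ W, X (g z) = ψ z := by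
  have hex : ∀ s : I, ∃ g : ℂ → S, ∃ r > 0, ∀ z ∈ Metric.ball ((s : ℝ) : ℂ) r, z ∈ U ∧
      IsLocalDiffeomorphAt 𝓘(ℝ, ℂ) 𝓘(ℝ, ℂ) ∞ g z ∧ X (g z) = ψ z ∧
      ∀ t : ℝ, (t : ℂ) = z → g t = γ t := by
    intro s
    obtain ⟨g, hg, hgax⟩ := hX.exists_local_lift hI hdata hU h hax hIU s.2
    have h1 : ∀ᶠ z in 𝓝 ((s : ℝ) : ℂ), ∀ t : ℝ, (t : ℂ) = z → g t = γ t := by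
      have hre : Tendsto Complex.re (𝓝 ((s : ℝ) : ℂ)) (𝓝 (s : ℝ)) := by
        simpa using Complex.continuous_re.tendsto ((s : ℝ) : ℂ)
      filter_upwards [hre.eventually hgax] with z hz t ht
      rw [← ht, Complex.ofReal_re] at hz
      exact hz
    have hUs : ∀ᶠ z in 𝓝 ((s : ℝ) : ℂ), z ∈ U := hU.mem_nhds (hIU s s.2)
    obtain ⟨r, hr, H⟩ := Metric.eventually_nhds_iff_ball.1
      (hUs.and (hg.and h1))
    exact ⟨g, r, hr, fun z hz => ⟨(H z hz).1, (H z hz).2.1.1, (H z hz).2.1.2, (H z hz).2.2⟩⟩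
  choose g₀ r hr H using hex
  set W : Set ℂ := ⋃ s : I, Metric.ball ((s : ℝ) : ℂ) (r s) with hW
  have hmem : ∀ z ∈ W, ∃ s : I, z ∈ Metric.ball ((s : ℝ) : ℂ) (r s) := fun z hz => mem_iUnion.1 hz
  -- A nonempty overlap is convex and contains a real point, where both lifts equal `γ`.
  have hover : ∀ s s' : I, EqOn (g₀ s) (g₀ s')
      (Metric.ball ((s : ℝ) : ℂ) (r s) ∩ Metric.ball ((s' : ℝ) : ℂ) (r s')) := by
    intro s s' z hz
    have hre : (z.re : ℂ) ∈ Metric.ball ((s : ℝ) : ℂ) (r s) ∩ Metric.ball ((s' : ℝ) : ℂ) (r s') :=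
      ⟨re_mem_ball hz.1, re_mem_ball hz.2⟩
    refine hX.minimal.eqOn_of_lift (isPreconnected_ball_inter _ _ _ _)
      (Metric.isOpen_ball.inter Metric.isOpen_ball)
      (fun w hw => (H s w hw.1).2.1.contMDiffAt.continuousAt)
      (fun w hw => (H s' w hw.2).2.1.contMDiffAt.continuousAt)
      (fun w hw => by rw [(H s w hw.1).2.2.1, (H s' w hw.2).2.2.1]) hre ?_ hz
    rw [(H s _ hre.1).2.2.2 _ rfl, (H s' _ hre.2).2.2.2 _ rfl]
  by_cases hne : Nonempty S
  swap
  · refine ⟨∅, fun z => (hne ⟨γ z.re⟩).elim, isOpen_empty, empty_subset _, fun s _ => (hne ⟨γ s⟩).elim,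
      fun x => x.2.elim, fun s _ => (hne ⟨γ s⟩).elim, fun z hz => hz.elim⟩
  classical
  set g : ℂ → S := fun z => if hz : z ∈ W then g₀ (hmem z hz).choose z else γ z.re with hg
  have hge : ∀ s : I, EqOn g (g₀ s) (Metric.ball ((s : ℝ) : ℂ) (r s)) := by
    intro s z hz
    have hzW : z ∈ W := mem_iUnion.2 ⟨s, hz⟩
    simp only [hg, hzW, dif_pos]
    exact hover _ s ⟨(hmem z hzW).choose_spec, hz⟩
  refine ⟨W, g, isOpen_iUnion fun _ => Metric.isOpen_ball, fun z hz => ?_, fun s hs => ?_,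
    fun z => ?_, fun s hs => ?_, fun z hz => ?_⟩
  · obtain ⟨s, hs⟩ := hmem z hz
    exact (H s z hs).1
  · exact mem_iUnion.2 ⟨⟨s, hs⟩, Metric.mem_ball_self (hr _)⟩
  · obtain ⟨s, hs⟩ := hmem z.1 z.2
    exact isLocalDiffeomorphAt_congr (H s z hs).2.1
      ((hge s).eventuallyEq_of_mem (Metric.isOpen_ball.mem_nhds hs))
  · have hs' := Metric.mem_ball_self (x := ((s : ℝ) : ℂ)) (hr ⟨s, hs⟩)
    rw [hge ⟨s, hs⟩ hs']
    exact (H _ _ hs').2.2.2 s rfl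
  · obtain ⟨s, hs⟩ := hmem z hz
    rw [hge s hs]
    exact (H s z hs).2.2.1

end Uniqueness

end WeightedMinimal

end

/-! ### The main theorem -/

open WeightedMinimal in
theorem mainTheorem11 (k : ℝ) (hk : k ≠ 0) (I : Set ℝ) (hI : IsOpen I) (hI' : I.OrdConnected)
    (β V : ℝ → E3) (hdata : IsBjorlingData k I β V) :
    ∃ (ε : ℝ → ℝ) (G : ℂ → ℂ) (ψ : ℂ → E3),
      ContinuousOn ε I ∧ (∀ s ∈ I, 0 < ε s) ∧
      -- the solution `G` of the Cauchy problem for the Gauss map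
      AnalyticOnNhd ℝ G (strip I ε) ∧
      IsGaussSolution k I β V (strip I ε) G ∧
      (∀ s ∈ I, phi β V s 0 - Complex.I * phi β V s 1 ≠ 0 ∧
        (phi β V s 2 ≠ 0 →
          initialGauss β V s = -((phi β V s 0 + Complex.I * phi β V s 1) / phi β V s 2))) ∧
      -- its uniqueness
      (∀ U' : Set ℂ, IsOpen U' → IsPreconnected U' → U' ⊆ strip I ε →
        (∀ s ∈ I, (s : ℂ) ∈ U') →
        ∀ G' : ℂ → ℂ, IsGaussSolution k I β V U' G' → Set.EqOn G' G U') ∧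
      -- the surface `ψ` solves the geometric Cauchy problem and `G` is its Gauss map
      IsMinimalOn (weight k) (weightDomain k) ψ (strip I ε) ∧
      IsConformalOn ψ (strip I ε) ∧
      IsGaussMapOn ψ G (strip I ε) ∧
      (∀ s ∈ I, ψ (s : ℂ) = β s) ∧
      (∀ s ∈ I, unitNormal (G (s : ℂ)) = V s) ∧
      -- the representation formulas
      (k = 1 → ∀ s₀ ∈ I, ∃ Y : ℂ → E3, IsTranslatingRep (strip I ε) (s₀ : ℂ) G Y ∧
        ∀ ζ ∈ strip I ε, ψ ζ = β s₀ + Y ζ) ∧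
      (k ≠ 1 → ∀ s₀ ∈ I, ∃ Y : ℂ → E3, IsSingularRep k (strip I ε) (s₀ : ℂ) G Y ∧
        ∀ ζ ∈ strip I ε,
          ψ ζ = !₂[β s₀ 0, β s₀ 1, 0] + ((k - 1) * β s₀ 2 / (2 * k)) • Y ζ) ∧
      -- uniqueness: any surface solving the Cauchy problem is `ψ` near the curve,
      -- up to a change of parameter that fixes the curve
      (∀ (S : Type*) [TopologicalSpace S] [T2Space S] [ChartedSpace ℂ S]
        [IsManifold 𝓘(ℝ, ℂ) ∞ S] (X : S → E3) (γ : ℝ → S),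
        SolvesCauchyProblem k I β V X γ →
        ∃ (W : Set ℂ) (h : ℂ → S), IsOpen W ∧ W ⊆ strip I ε ∧ (∀ s ∈ I, (s : ℂ) ∈ W) ∧
          IsLocalDiffeomorphOn 𝓘(ℝ, ℂ) 𝓘(ℝ, ℂ) ∞ h W ∧
          (∀ s ∈ I, h (s : ℂ) = γ s) ∧ ∀ z ∈ W, X (h z) = ψ z) := by
  obtain ⟨ε, ψ, hεc, hε, hψ, hax⟩ := exists_isConformalSolution_strip hI hdata
  have hU := isOpen_strip hI hεc
  have hIU : ∀ s ∈ I, (s : ℂ) ∈ strip I ε := fun s hs => ofReal_mem_strip hε hs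
  have hG := hψ.isGaussSolution (I := I) hU hax hIU
  refine ⟨ε, gaussMap ψ, ψ, hεc.continuousOn, hε, hψ.analyticOnNhd_gaussMap, hG,
    fun s hs => ⟨hdata.phi_denom_ne_zero hs, hdata.initialGauss_eq_neg hs⟩, ?_, hψ.isMinimalOn,
    hψ.isConformalOn, hψ.isGaussMapOn, fun s hs => (hax s (hIU s hs)).1, fun s hs => ?_, ?_, ?_,
    ?_⟩
  -- A point of `U'` lies in the strip, so its real part witnesses that `I` is nonempty; the
  -- comparison is made on `U'` with the restricted solution.
  · intro U' hU' hUc hsub hIU' G' hG' z hz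
    have hne : I.Nonempty := ⟨z.re, (hsub hz).1⟩
    exact IsGaussSolution.eqOn hU' hUc hI hne hIU' (hψ.mono hsub |>.isGaussSolution hU'
      (fun t ht => hax t (hsub ht)) hIU') hG' hz
  · rw [hG.initial s hs, hdata.unitNormal_initialGauss hs]
  · rintro rfl s₀ hs₀
    refine ⟨_, hψ.isTranslatingRep (s₀ : ℂ), fun ζ _ => ?_⟩
    rw [(hax s₀ (hIU s₀ hs₀)).1, add_sub_cancel]
  · intro hk1 s₀ hs₀
    have := hψ.isSingularRep hk1 hk (hIU s₀ hs₀)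
    rwa [(hax s₀ (hIU s₀ hs₀)).1] at this
  · intro S _ _ _ _ X γ hX
    exact hX.exists_lift hI hdata hU hψ hax hIU
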